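/- Let $n\ge 2$. For $u=(u_1,\dots,u_{n-1})\in\mathbb{R}^{n-1}$ put $$\widetilde\Delta(u)=\prod_{1\le i<j\le n}(u_i+\cdots+u_{j-1}),\qquad \varpi_n(u)=\prod_{1\le i<j\le n}2\sin\tfrac12(u_i+\cdots+u_{j-1}),$$ let $t_1,\dots,t_n$ be the solution of $t_j-t_{j+1}=u_j$, $\sum_j t_j=0$, and let $T=\mathrm{diag}(e^{\mathrm{i}t_1},\dots,e^{\mathrm{i}t_n})\in SU(n)$ and $\Delta(e^{\mathrm{i}t})=\prod_{i<j}(e^{\mathrm{i}t_i}-e^{\mathrm{i}t_j})$. Call $u$ regular if $\Delta(e^{\mathrm{i}t})\neq0$. For regular $u$ let $$\widehat D_n(u)=\sum_{p\in\mathbb{Z}^{n-1}}\frac1{\widetilde\Delta(u+2\pi p)},\qquad D_n(u)=\sum_{p\in\mathbb{Z}^{n-1}}\frac{(-1)^{(n-1)\sum_j jp_j}}{\widetilde\Delta(u+2\pi p)},$$ both sums being limits of the sums over $|p_j|\le N$ as $N\to\infty$, and let $\widehat R_n(T)=\widehat D_n\varpi_n$, $R_n(T)=D_n\varpi_n$,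 extended by continuity to all $T$. For a tuple $\kappa=(\kappa_1,\dots,\kappa_{n-1})$ of nonnegative integers let $\chi_\kappa(T)=\det\big(e^{\mathrm{i}t_i\ell_j(\kappa+\rho)}\big)/\Delta(e^{\mathrm{i}t})$ (extended by continuity), with $\ell_j(\kappa+\rho)=\kappa_j+\cdots+\kappa_{n-1}+n-j$, be the character of the irreducible representation of $SU(n)$ with Dynkin labels $\kappa$. For a $U(n)$ weight $\lambda=(\lambda_1,\dots,\lambda_n)\in\mathbb{Z}^n$ (Dynkin labels) let $\ell_i(\lambda)=\lambda_i+\cdots+\lambda_n$; a triple $(\lambda,\mu;\nu)$ of weights is compatible if $\sum_{k=1}^n k(\lambda_k+\mu_k-\nu_k)=0$. For $P,P',P''\in S_n$ and $\alpha,\beta,\gamma\in\mathbb{R}^n$ let $$A_j(P,P',P'')=\sum_{k=1}^j(\alpha_{P(k)}+\beta_{P'(k)}-\gamma_{P''(k)})-\frac jn\sum_{k=1}^n(\alpha_k+\beta_k-\gamma_k),\quad 1\le j\le n-1 .$$ **Proposition.** (a) For every regular $u$ the sum defining $\widehat D_n(u)$ converges, absolutely if $n>2$, and $\widehat D_n\varpi_n$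 extends to a continuous function $\widehat R_n$. (b) Let $(\lambda,\mu;\nu)$ be a compatible triple and $\alpha=\ell(\lambda)$, $\beta=\ell(\mu)$, $\gamma=\ell(\nu)$. For all $P,P',P''\in S_n$, with $A_j=A_j(P,P',P'')$, $$\int_{\mathbb{R}^{n-1}}\frac{\prod_{j}du_j\,e^{\mathrm{i}u_jA_j}}{\widetilde\Delta(u)}=\mathrm{i}^{\,n(n-1)/2}\int_{(-\pi,\pi)^{n-1}}\prod_{j}du_j\,e^{\mathrm{i}u_jA_j}\,\frac{\widehat R_n(T)}{\Delta(e^{\mathrm{i}t})}.$$ Both integrals exist as principal values: on the left one integrates over the $u$ with $\varepsilon<|u_i+\cdots+u_{j-1}|<M$ for all $i<j$ and lets $\varepsilon\to0^+$ and $M\to\infty$ independently; on the right one integrates over the $u\in(-\pi,\pi)^{n-1}$ with $|e^{\mathrm{i}t_i}-e^{\mathrm{i}t_j}|>\varepsilon$ for all $i<j$ and lets $\varepsilon\to0^+$. If $n>2$, the same equality holds, with absolutely convergent Lebesgue integrals, when $\prod_je^{\mathrm{i}u_jA_j}$ is replaced on both sides by $\sum_{P,P',P''\in S_n}\varepsilon_P\varepsilon_{P'}\varepsilon_{P''}\prod_je^{\mathrm{i}u_jA_j(P,P',P'')}$,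 where $\varepsilon$ denotes the signature. (c) $\widehat R_n(T)$ is a symmetric polynomial with real coefficients in $e^{\mathrm{i}t_1},\dots,e^{\mathrm{i}t_n}$. There are a finite set $\widehat{\mathcal K}$ of highest weights of $SU(n)$ and nonzero rational numbers $\hat r_\kappa$ $(\kappa\in\widehat{\mathcal K})$, depending only on $n$ and uniquely determined, with $\widehat R_n(T)=\sum_{\kappa\in\widehat{\mathcal K}}\hat r_\kappa\chi_\kappa(T)$ for all $T$. They are invariant under $\kappa=(\kappa_1,\dots,\kappa_{n-1})\mapsto(\kappa_{n-1},\dots,\kappa_1)$ (complex conjugation of characters), so that $\widehat R_n$ is a rational combination of the real class functions $\chi_\kappa+\overline{\chi_\kappa}$. Moreover $\widehat R_n(I)=1$. (d) If $n$ is odd then $\widehat R_n=R_n$, and every finite expansion of $R_n$ on the $\chi_\kappa$ with nonzero rational coefficients has the same set of highest weights $\widehat{\mathcal K}$ and the same coefficients $\hat r_\kappa$. -/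

import Mathlib

open Filter Topology MeasureTheory

noncomputable section

namespace Horn

/-! Conventions. `n` is the rank parameter of `SU(n)`. Indices are zero-based: `Fin n` stands for
`1, …, n` and `Fin (n - 1)` for `1, …, n - 1`. A vector `u : Fin (n - 1) → ℝ` holds the variables
`u_j = t_j - t_{j+1}`. -/

/-- `u_i + u_{i+1} + ⋯ + u_{j-1}`, for `i < j`. -/
def gap (n : ℕ) (u : Fin (n - 1) → ℝ) (i j : Fin n) : ℝ :=
  ∑ k : Fin (n - 1), if i.val ≤ k.val ∧ k.val < j.val then u k else 0

/-- `Δ̃(u) = ∏_{i<j} (u_i + ⋯ + u_{j-1})`. -/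
def deltaTilde (n : ℕ) (u : Fin (n - 1) → ℝ) : ℝ :=
  ∏ i : Fin n, ∏ j ∈ Finset.Ioi i, gap n u i j

/-- The solution `t` of `t_j - t_{j+1} = u_j`, `∑ t_j = 0`, that is
`t_i = (u_i + ⋯ + u_{n-1}) - (1/n) ∑_{j<n} j u_j`. -/
def angle (n : ℕ) (u : Fin (n - 1) → ℝ) (i : Fin n) : ℝ :=
  (∑ k : Fin (n - 1), if i.val ≤ k.val then u k else 0)
    - (∑ k : Fin (n - 1), ((k.val : ℝ) + 1) * u k) / n

/-- The `i`-th diagonal entry `e^{i t_i}` of the matrix `T = diag(e^{i t_1}, …, e^{i t_n})` of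
`SU(n)`. Every diagonal matrix of `SU(n)` arises in this way, and `u = 0` gives `T = I`. -/
def torusEntry (n : ℕ) (u : Fin (n - 1) → ℝ) (i : Fin n) : ℂ :=
  Complex.exp (Complex.I * (angle n u i : ℂ))

/-- `Δ(e^{it}) = ∏_{i<j} (e^{i t_i} - e^{i t_j})`. -/
def deltaExp (n : ℕ) (u : Fin (n - 1) → ℝ) : ℂ :=
  ∏ i : Fin n, ∏ j ∈ Finset.Ioi i, (torusEntry n u i - torusEntry n u j)

/-- The `u` for which the eigenvalues of `T` are pairwise distinct. -/
def regular (n : ℕ) : Set (Fin (n - 1) → ℝ) := {u | deltaExp n u ≠ 0}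

/-- `ϖ_n = ∏_{i<j} 2 sin((u_i + ⋯ + u_{j-1}) / 2)`. -/
def varpi (n : ℕ) (u : Fin (n - 1) → ℝ) : ℝ :=
  ∏ i : Fin n, ∏ j ∈ Finset.Ioi i, 2 * Real.sin (gap n u i j / 2)

/-- The point `u + 2π p`. -/
def shift (n : ℕ) (u : Fin (n - 1) → ℝ) (p : Fin (n - 1) → ℤ) : Fin (n - 1) → ℝ :=
  fun k => u k + (p k : ℝ) * (2 * Real.pi)

/-- The integer points of the cube `[-N, N]^{n-1}`. -/
def box (n N : ℕ) : Finset (Fin (n - 1) → ℤ) :=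
  Fintype.piFinset fun _ => Finset.Icc (-(N : ℤ)) (N : ℤ)

/-- Partial sum, over `|p_j| ≤ N`, of the unsigned periodization of `1 / Δ̃`. -/
def DhatPartial (n : ℕ) (u : Fin (n - 1) → ℝ) (N : ℕ) : ℝ :=
  ∑ p ∈ box n N, 1 / deltaTilde n (shift n u p)

/-- `D̂_n`: the unsigned periodization of `1 / Δ̃`, as the limit of its sums over the cubes
`|p_j| ≤ N` (for `n = 2` this is the principal value of the series). -/
def Dhat (n : ℕ) (u : Fin (n - 1) → ℝ) : ℝ :=
  limUnder atTop (DhatPartial n u)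

/-- Partial sum of the signed periodization, with sign `(-1)^{(n-1) ∑ j p_j}`. -/
def DPartial (n : ℕ) (u : Fin (n - 1) → ℝ) (N : ℕ) : ℝ :=
  ∑ p ∈ box n N,
    (-1 : ℝ) ^ (((n : ℤ) - 1) * ∑ k : Fin (n - 1), ((k.val : ℤ) + 1) * p k)
      * (1 / deltaTilde n (shift n u p))

/-- `D_n`: the signed periodization of `1 / Δ̃`. -/
def D (n : ℕ) (u : Fin (n - 1) → ℝ) : ℝ :=
  limUnder atTop (DPartial n u)

/-- `R̂_n = D̂_n ϖ_n` on regular points, extended by continuity. -/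
def Rhat (n : ℕ) : (Fin (n - 1) → ℝ) → ℝ :=
  extendFrom (regular n) fun u => Dhat n u * varpi n u

/-- `R_n = D_n ϖ_n` on regular points, extended by continuity. -/
def R (n : ℕ) : (Fin (n - 1) → ℝ) → ℝ :=
  extendFrom (regular n) fun u => D n u * varpi n u

/-- The `j`-th component of `ℓ(κ + ρ)`, for the highest weight of `SU(n)` with Dynkin labels
`κ_1, …, κ_{n-1}`: `κ_j + ⋯ + κ_{n-1} + (n - j)`. -/
def shiftedEll (n : ℕ) (κ : Fin (n - 1) → ℕ) (j : Fin n) : ℕ :=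
  (∑ k : Fin (n - 1), if j.val ≤ k.val then κ k else 0) + (n - 1 - j.val)

/-- The character `χ_κ(T)` of the irreducible representation of `SU(n)` of highest weight `κ`,
`det(e^{i t_i ℓ_j(κ+ρ)}) / Δ(e^{it})` on regular points, extended by continuity. -/
def character (n : ℕ) (κ : Fin (n - 1) → ℕ) : (Fin (n - 1) → ℝ) → ℂ :=
  extendFrom (regular n) fun u =>
    (Matrix.of fun i j : Fin n => torusEntry n u i ^ shiftedEll n κ j).det / deltaExp n u

/-- `ℓ_i(λ) = λ_i + ⋯ + λ_n` for a weight of `U(n)` with Dynkin labels `λ_1, …, λ_n`. -/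
def ell (n : ℕ) (lam : Fin n → ℤ) (i : Fin n) : ℝ :=
  ∑ j ∈ Finset.Ici i, (lam j : ℝ)

/-- `∑_{k=1}^n k (λ_k + μ_k - ν_k) = 0`. -/
def Compatible (n : ℕ) (lam mu nu : Fin n → ℤ) : Prop :=
  ∑ k : Fin n, ((k.val : ℤ) + 1) * (lam k + mu k - nu k) = 0

/-- `A_j(P, P', P'') = ∑_{k ≤ j} (α_{P(k)} + β_{P'(k)} - γ_{P''(k)})
- (j/n) ∑_k (α_k + β_k - γ_k)`. -/
def A (n : ℕ) (α β γ : Fin n → ℝ) (P P' P'' : Equiv.Perm (Fin n)) (j : Fin (n - 1)) : ℝ :=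
  (∑ k : Fin n, if k.val ≤ j.val then α (P k) + β (P' k) - γ (P'' k) else 0)
    - ((j.val : ℝ) + 1) / n * ∑ k : Fin n, (α k + β k - γ k)

/-- `∏_j e^{i u_j a_j}`. -/
def planeWave (n : ℕ) (a u : Fin (n - 1) → ℝ) : ℂ :=
  ∏ j : Fin (n - 1), Complex.exp (Complex.I * (u j : ℂ) * (a j : ℂ))

/-- The numerator `∑_{P,P',P''} ε_P ε_{P'} ε_{P''} ∏_j e^{i u_j A_j(P,P',P'')}`. -/
def alternatingWave (n : ℕ) (α β γ : Fin n → ℝ) (u : Fin (n - 1) → ℝ) : ℂ :=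
  ∑ P : Equiv.Perm (Fin n), ∑ P' : Equiv.Perm (Fin n), ∑ P'' : Equiv.Perm (Fin n),
    ((Equiv.Perm.sign P * Equiv.Perm.sign P' * Equiv.Perm.sign P'' : ℤˣ) : ℂ)
      * planeWave n (A n α β γ P P' P'') u

/-- `L` is the principal value of the integral over `ℝ^{n-1}` of a function with poles on the
hyperplanes `u_i + ⋯ + u_{j-1} = 0`: the neighbourhoods `|u_i + ⋯ + u_{j-1}| ≤ ε` of all of them and
the regions `|u_i + ⋯ + u_{j-1}| ≥ M` are cut out, and `ε → 0+`, `M → ∞` independently. -/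
def HasPVWhole (n : ℕ) (f : (Fin (n - 1) → ℝ) → ℂ) (L : ℂ) : Prop :=
  Tendsto
    (fun q : ℝ × ℝ =>
      ∫ u in {u : Fin (n - 1) → ℝ |
        ∀ i j : Fin n, i < j → q.1 < |gap n u i j| ∧ |gap n u i j| < q.2}, f u)
    (𝓝[>] (0 : ℝ) ×ˢ atTop) (𝓝 L)

/-- The cube `(-π, π)^{n-1}`. -/
def cube (n : ℕ) : Set (Fin (n - 1) → ℝ) :=
  {u | ∀ k, u k ∈ Set.Ioo (-Real.pi) Real.pi}

/-- `L` is the principal value of the integral over `(-π, π)^{n-1}` of a function with poles where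
two eigenvalues of `T` coincide: the regions `|e^{i t_i} - e^{i t_j}| ≤ ε` are cut out, and
`ε → 0+`. -/
def HasPVCube (n : ℕ) (f : (Fin (n - 1) → ℝ) → ℂ) (L : ℂ) : Prop :=
  Tendsto
    (fun ε : ℝ =>
      ∫ u in {u | u ∈ cube n ∧
        ∀ i j : Fin n, i < j → ε < ‖torusEntry n u i - torusEntry n u j‖}, f u)
    (𝓝[>] (0 : ℝ)) (𝓝 L)

end Horn

end

noncomputable section

namespace Horn

/-! Put n = m + 1. Under u ↦ u + 2πp each factor of ϖ changes only by a sign, so D̂ϖ is the lattice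
sum of signed products of sinc((x_i - x_j)/2), where x_i = u_i + ⋯ + u_m. For m ≥ 2 its terms are
dominated by ∏ 1/(1 + |gap of p|), summable over ℤ^m by `summable_wtProd`. Hence the series
converges absolutely, R̂ is continuous, and R̂(I) = 1 because at u = 0 only p = 0 contributes. For m
= 1 the cotangent series gives R̂ = cos(u/2).

R̂ is a polynomial for the following reason. Partial fractions (`invProd_induction`) reduce the sum
over one lattice coordinate to sums Σ_s (y + 2πs)^(-a), which are derivatives of the cotangent and
hence, up to powers of i, rational polynomials in `dcot y`. Since `dcot` is periodic, these leave
the remaining sum unchanged in type, and induction on m (`hasSum_gapTerm`) makes D̂ a power of i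
times a rational polynomial in the `dcot (x_i - x_j)`. Thus R̂, lifted to the angles of U(n),
becomes polynomial after multiplication by a power of the Vandermonde product Δ. As R̂ is
continuous, the factors z_i - z_j can be divided out one by one (`divides_X_sub_X`).

D̂ and ϖ are both alternating, so R̂ is symmetric. Antisymmetrizing R̂Δ turns monomials into
alternants, that is, into Δ times characters (`exists_expansion`). Distinct monomials on the torus
are distinct homomorphisms, so the expansion is unique (`linearIndependent_char`). Conjugating it
and using that R̂ is real gives the invariance of the coefficients.

For the integrals, compatibility makes the plane waves periodic. An antisymmetrized wave is Δ times
a bounded continuous function (`divisible_altMono`), so dividing it by Δ̃ leaves at most a multiple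
of the sinc product. For m ≥ 2 the integral over ℝ^m may be unfolded over the translates of the
cube, and the periodized 1/Δ̃ is i^(n(n-1)/2) R̂/Δ (`Divisible.integral_div`). A single wave is
replaced by its antisymmetrization through averaging over the symmetric group, under which the
truncated integrals are invariant (`setIntegral_mono_mul`); the cut-offs then disappear because the
alternating integrand is integrable. For m = 1 the integral over the line is only conditional, and
it is reached along the radii (2N + 1)π (`Divisible.tendsto_setIntegral_ball`). -/

/-! ### Vandermonde products. -/

/-- The product of the differences `v i - v j` over `i < j`. -/
def vand {R : Type*} [CommRing R] {n : ℕ} (v : Fin n → R) : R :=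
  ∏ i : Fin n, ∏ j ∈ Finset.Ioi i, (v i - v j)

theorem vand_eq_det {R : Type*} [CommRing R] {n : ℕ} (v : Fin n → R) :
    vand v = (Matrix.vandermonde fun i => -v i).det := by
  rw [Matrix.det_vandermonde, vand]
  refine Finset.prod_congr rfl fun i _ => Finset.prod_congr rfl fun j _ => ?_
  ring

theorem vand_comp_perm {R : Type*} [CommRing R] {n : ℕ} (v : Fin n → R)
    (w : Equiv.Perm (Fin n)) : vand (v ∘ w) = ((Equiv.Perm.sign w : ℤˣ) : ℤ) * vand v := by
  rw [vand_eq_det, vand_eq_det, ← Matrix.det_permute]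
  rfl

theorem vand_ne_zero_iff {R : Type*} [CommRing R] [IsDomain R] {n : ℕ} {v : Fin n → R} :
    vand v ≠ 0 ↔ Function.Injective v := by
  rw [vand_eq_det, Matrix.det_vandermonde_ne_zero_iff]
  exact (neg_injective (G := R)).of_comp_iff v

theorem map_vand {R S : Type*} [CommRing R] [CommRing S] (f : R →+* S) {n : ℕ} (v : Fin n → R) :
    f (vand v) = vand (f ∘ v) := by
  simp [vand, map_prod]

theorem vand_add_const {R : Type*} [CommRing R] {n : ℕ} (v : Fin n → R) (c : R) :
    vand (fun i => v i + c) = vand v := by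
  simp [vand]

/-! ### Coordinates on the torus and the action of the symmetric group. -/

/-- `u_i + ⋯ + u_m`, the solution of `x_j - x_{j+1} = u_j` whose last component vanishes. -/
def coord {R : Type*} [AddCommMonoid R] {m : ℕ} (u : Fin m → R) (i : Fin (m + 1)) : R :=
  ∑ k : Fin m, if i.val ≤ k.val then u k else 0

section coord

variable {m : ℕ}

@[simp] theorem coord_last {R : Type*} [AddCommMonoid R] (u : Fin m → R) :
    coord u (Fin.last m) = 0 := by
  refine Finset.sum_eq_zero fun k _ => if_neg ?_
  have := k.2
  simp only [Fin.val_last]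
  omega

@[simp] theorem coord_cons_zero {R : Type*} [AddCommMonoid R] (a : R) (u : Fin m → R) :
    coord (Fin.cons a u : Fin (m + 1) → R) 0 = a + coord u 0 := by
  simp [coord, Fin.sum_univ_succ]

@[simp] theorem coord_cons_succ {R : Type*} [AddCommMonoid R] (a : R) (u : Fin m → R)
    (i : Fin (m + 1)) : coord (Fin.cons a u : Fin (m + 1) → R) i.succ = coord u i := by
  simp only [coord, Fin.sum_univ_succ, Fin.cons_succ, Fin.val_succ, add_le_add_iff_right]
  simp

theorem coord_castSucc {R : Type*} [AddCommMonoid R] (u : Fin m → R) (k : Fin m) :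
    coord u k.castSucc = u k + coord u k.succ := by
  have h : ∀ l : Fin m, (if k.castSucc.val ≤ l.val then u l else 0)
      = (if l = k then u k else 0) + (if k.succ.val ≤ l.val then u l else 0) := by
    intro l
    rcases lt_trichotomy l k with h | h | h
    · have h1 : ¬ k.val ≤ l.val := by simpa using h
      have h2 : ¬ k.val + 1 ≤ l.val := by omega
      simp [h1, h2, h.ne]
    · subst h; simp
    · have h1 : k.val ≤ l.val := by simpa using h.le
      have h2 : k.val + 1 ≤ l.val := h
      simp [h1, h2, h.ne']
  simp only [coord, h, Finset.sum_add_distrib, Finset.sum_ite_eq', Finset.mem_univ, if_true]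

theorem coord_add {R : Type*} [AddCommMonoid R] (u v : Fin m → R) (i : Fin (m + 1)) :
    coord (u + v) i = coord u i + coord v i := by
  simp only [coord, ← Finset.sum_add_distrib]
  refine Finset.sum_congr rfl fun k _ => ?_
  split_ifs <;> simp

theorem coord_smul {R : Type*} [Semiring R] (c : R) (u : Fin m → R) (i : Fin (m + 1)) :
    coord (c • u) i = c * coord u i := by
  simp [coord, Finset.mul_sum]

theorem coord_intCast (p : Fin m → ℤ) (i : Fin (m + 1)) :
    coord (fun k => (p k : ℝ)) i = ((coord p i : ℤ) : ℝ) := by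
  simp [coord]

/-- The consecutive differences `x_k - x_{k+1}`. -/
def diff {R : Type*} [AddGroup R] (x : Fin (m + 1) → R) (k : Fin m) : R :=
  x k.castSucc - x k.succ

theorem coord_diff {R : Type*} [AddCommGroup R] (x : Fin (m + 1) → R) (i : Fin (m + 1)) :
    coord (diff x) i = x i - x (Fin.last m) := by
  induction i using Fin.reverseInduction with
  | last => simp
  | cast k ih => rw [coord_castSucc, ih, diff]; abel

theorem diff_coord {R : Type*} [AddCommGroup R] (u : Fin m → R) : diff (coord u) = u := by
  ext k
  rw [diff, coord_castSucc]
  abel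

theorem diff_add_const {R : Type*} [AddCommGroup R] (x : Fin (m + 1) → R) (c : R) :
    diff (fun i => x i + c) = diff x := by
  ext k
  simp [diff]

theorem gap_eq (u : Fin m → ℝ) {i j : Fin (m + 1)} (h : i ≤ j) :
    gap (m + 1) u i j = coord u i - coord u j := by
  have h' : i.val ≤ j.val := h
  unfold gap coord
  rw [← Finset.sum_sub_distrib]
  refine Finset.sum_congr rfl fun k _ => ?_
  by_cases h1 : i.val ≤ k.val <;> by_cases h2 : j.val ≤ k.val
  · simp [h1, h2]
  · simp [h1, h2, not_le.mp h2]
  · omega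
  · simp [h1, h2]

theorem deltaTilde_eq (u : Fin m → ℝ) : deltaTilde (m + 1) u = vand (coord u) := by
  refine Finset.prod_congr rfl fun i _ => Finset.prod_congr rfl fun j hj => ?_
  exact gap_eq u (Finset.mem_Ioi.mp hj).le

theorem sum_coord (u : Fin m → ℝ) :
    ∑ i, coord u i = ∑ k : Fin m, ((k.val : ℝ) + 1) * u k := by
  simp only [coord]
  rw [Finset.sum_comm]
  refine Finset.sum_congr rfl fun k _ => ?_
  rw [← Finset.sum_filter, Finset.sum_const, nsmul_eq_mul]
  congr 1
  have : (Finset.univ.filter fun i : Fin (m + 1) => i.val ≤ k.val) = Finset.Iic k.castSucc := by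
    ext i; simp [Fin.le_def]
  rw [this, Fin.card_Iic]
  simp

/-- The mean of the `coord u i`. -/
def mean (u : Fin m → ℝ) : ℝ := (∑ i, coord u i) / (m + 1)

theorem angle_eq (u : Fin m → ℝ) (i : Fin (m + 1)) :
    angle (m + 1) u i = coord u i - mean u := by
  rw [mean, sum_coord]
  unfold angle coord
  push_cast
  rfl

theorem sum_angle (u : Fin m → ℝ) : ∑ i, angle (m + 1) u i = 0 := by
  simp only [angle_eq, Finset.sum_sub_distrib, Finset.sum_const, mean]
  simp
  field_simp
  simp

theorem diff_angle (u : Fin m → ℝ) : diff (angle (m + 1) u) = u := by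
  have : angle (m + 1) u = fun i => coord u i + - mean u := by
    ext i; rw [angle_eq, sub_eq_add_neg]
  rw [this, diff_add_const, diff_coord]

theorem angle_eq_of_sum_eq_zero {x : Fin (m + 1) → ℝ} {u : Fin m → ℝ} (hs : ∑ i, x i = 0)
    (hd : diff x = u) : angle (m + 1) u = x := by
  subst hd
  ext i
  rw [angle_eq, mean]
  simp only [coord_diff, Finset.sum_sub_distrib, hs]
  simp
  field_simp
  ring

theorem prod_torusEntry (u : Fin m → ℝ) : ∏ i, torusEntry (m + 1) u i = 1 := by
  simp only [torusEntry]
  rw [← Complex.exp_sum, ← Finset.mul_sum]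
  have := sum_angle u
  rw [← Complex.ofReal_sum, this]
  simp

theorem deltaExp_eq (u : Fin m → ℝ) : deltaExp (m + 1) u = vand (torusEntry (m + 1) u) := rfl

theorem norm_torusEntry (u : Fin m → ℝ) (i : Fin (m + 1)) : ‖torusEntry (m + 1) u i‖ = 1 := by
  rw [torusEntry, mul_comm, Complex.norm_exp_ofReal_mul_I]

theorem torusEntry_ne_zero (u : Fin m → ℝ) (i : Fin (m + 1)) : torusEntry (m + 1) u i ≠ 0 :=
  Complex.exp_ne_zero _

/-- Action of the symmetric group on the differences of the coordinates. -/
def perm (w : Equiv.Perm (Fin (m + 1))) (u : Fin m → ℝ) : Fin m → ℝ := diff (coord u ∘ w)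

theorem coord_perm (w : Equiv.Perm (Fin (m + 1))) (u : Fin m → ℝ) (i : Fin (m + 1)) :
    coord (perm w u) i = coord u (w i) - coord u (w (Fin.last m)) := by
  rw [perm, coord_diff]; rfl

theorem angle_perm (w : Equiv.Perm (Fin (m + 1))) (u : Fin m → ℝ) :
    angle (m + 1) (perm w u) = angle (m + 1) u ∘ w := by
  refine angle_eq_of_sum_eq_zero ?_ ?_
  · rw [← sum_angle u]
    exact Equiv.sum_comp w (angle (m + 1) u)
  · have : angle (m + 1) u ∘ w = fun i => (coord u ∘ w) i + - mean u := by
      ext i; simp [angle_eq, sub_eq_add_neg]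
    rw [this, diff_add_const, perm]

theorem torusEntry_perm (w : Equiv.Perm (Fin (m + 1))) (u : Fin m → ℝ) :
    torusEntry (m + 1) (perm w u) = torusEntry (m + 1) u ∘ w := by
  ext i
  simp [torusEntry, angle_perm]

theorem perm_mul (w w' : Equiv.Perm (Fin (m + 1))) (u : Fin m → ℝ) :
    perm (w * w') u = perm w' (perm w u) := by
  have : coord (perm w u) ∘ w' = fun i => (coord u ∘ (w * w')) i + - coord u (w (Fin.last m)) := by
    ext i; simp [coord_perm, sub_eq_add_neg]
  rw [perm, perm, this, diff_add_const]

@[simp] theorem perm_one (u : Fin m → ℝ) : perm 1 u = u := by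
  simp [perm, diff_coord]

theorem deltaTilde_perm (w : Equiv.Perm (Fin (m + 1))) (u : Fin m → ℝ) :
    deltaTilde (m + 1) (perm w u) = ((Equiv.Perm.sign w : ℤˣ) : ℤ) * deltaTilde (m + 1) u := by
  rw [deltaTilde_eq, deltaTilde_eq, ← vand_comp_perm]
  have : coord (perm w u) = fun i => (coord u ∘ w) i + - coord u (w (Fin.last m)) := by
    ext i; simp [coord_perm, sub_eq_add_neg]
  rw [this, vand_add_const]

theorem deltaExp_perm (w : Equiv.Perm (Fin (m + 1))) (u : Fin m → ℝ) :
    deltaExp (m + 1) (perm w u) = ((Equiv.Perm.sign w : ℤˣ) : ℤ) * deltaExp (m + 1) u := by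
  rw [deltaExp_eq, deltaExp_eq, torusEntry_perm, vand_comp_perm]

/-- `perm` as a linear map. -/
def permLin (w : Equiv.Perm (Fin (m + 1))) : (Fin m → ℝ) →ₗ[ℝ] (Fin m → ℝ) where
  toFun := perm w
  map_add' u v := by
    ext k
    simp only [perm, diff, Function.comp, coord_add, Pi.add_apply]
    ring
  map_smul' c u := by
    ext k
    simp only [perm, diff, Function.comp, coord_smul, Pi.smul_apply, smul_eq_mul, RingHom.id_apply]
    ring

@[simp] theorem permLin_apply (w : Equiv.Perm (Fin (m + 1))) (u : Fin m → ℝ) :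
    permLin w u = perm w u := rfl

theorem permLin_pow (w : Equiv.Perm (Fin (m + 1))) (k : ℕ) : permLin w ^ k = permLin (w ^ k) := by
  refine LinearMap.ext fun u => ?_
  induction k generalizing u with
  | zero => simp
  | succ k ih => rw [pow_succ, Module.End.mul_apply, ih, pow_succ', permLin_apply, permLin_apply,
      permLin_apply, perm_mul]

/-- A permutation has finite order, so this determinant is a real root of unity. -/
theorem abs_det_permLin (w : Equiv.Perm (Fin (m + 1))) : |LinearMap.det (permLin w)| = 1 := by
  have h : LinearMap.det (permLin w) ^ orderOf w = 1 := by
    rw [← map_pow, permLin_pow, pow_orderOf_eq_one]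
    have : permLin (1 : Equiv.Perm (Fin (m + 1))) = LinearMap.id :=
      LinearMap.ext fun u => perm_one u
    rw [this, LinearMap.det_id]
  have h2 : |LinearMap.det (permLin w)| ^ orderOf w = 1 := by rw [← abs_pow, h, abs_one]
  exact (pow_eq_one_iff_of_nonneg (abs_nonneg _) (orderOf_pos w).ne').mp h2

theorem measurePreserving_perm (w : Equiv.Perm (Fin (m + 1))) :
    MeasurePreserving (perm w) (volume : Measure (Fin m → ℝ)) volume := by
  have hd := abs_det_permLin w
  have h0 : LinearMap.det (permLin w) ≠ 0 := by
    intro h; rw [h] at hd; simp at hd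
  refine ⟨(permLin w).continuous_of_finiteDimensional.measurable, ?_⟩
  have := Real.map_linearMap_volume_pi_eq_smul_volume_pi h0
  rw [abs_inv, hd, inv_one, ENNReal.ofReal_one, one_smul] at this
  exact this

theorem continuous_perm (w : Equiv.Perm (Fin (m + 1))) :
    Continuous (perm w : (Fin m → ℝ) → (Fin m → ℝ)) :=
  (permLin w).continuous_of_finiteDimensional

/-- `perm w` as a measurable equivalence. -/
def permEquiv (w : Equiv.Perm (Fin (m + 1))) : (Fin m → ℝ) ≃ᵐ (Fin m → ℝ) where
  toFun := perm w
  invFun := perm w⁻¹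
  left_inv u := by rw [← perm_mul]; simp
  right_inv u := by rw [← perm_mul]; simp
  measurable_toFun := (continuous_perm w).measurable
  measurable_invFun := (continuous_perm w⁻¹).measurable

theorem continuous_coord (i : Fin (m + 1)) : Continuous fun u : Fin m → ℝ => coord u i := by
  unfold coord
  refine continuous_finsetSum _ fun k _ => ?_
  split_ifs <;> fun_prop

theorem continuous_angle (i : Fin (m + 1)) : Continuous fun u : Fin m → ℝ => angle (m + 1) u i := by
  simp only [angle_eq, mean]
  have := fun i => continuous_coord (m := m) i
  fun_prop

theorem continuous_torusEntry (i : Fin (m + 1)) :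
    Continuous fun u : Fin m → ℝ => torusEntry (m + 1) u i := by
  have := continuous_angle i
  unfold torusEntry
  fun_prop

theorem continuous_deltaExp : Continuous fun u : Fin m → ℝ => deltaExp (m + 1) u := by
  have := fun i => continuous_torusEntry (m := m) i
  unfold deltaExp
  fun_prop

theorem continuous_deltaTilde : Continuous fun u : Fin m → ℝ => deltaTilde (m + 1) u := by
  have := fun i => continuous_coord (m := m) i
  simp only [deltaTilde_eq, vand]
  fun_prop

/-! ### The sine form of the Vandermonde product, and regular points. -/

theorem exp_sub_exp (a b : ℝ) : Complex.exp (Complex.I * a) - Complex.exp (Complex.I * b)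
    = Complex.exp (Complex.I * ((a + b) / 2)) * (Complex.I * (2 * Real.sin ((a - b) / 2) : ℝ)) := by
  push_cast
  rw [Complex.sin]
  have h1 : Complex.exp (Complex.I * a) = Complex.exp (Complex.I * ((a + b) / 2))
      * Complex.exp (((a - b) / 2) * Complex.I) := by
    rw [← Complex.exp_add]; congr 1; ring
  have h2 : Complex.exp (Complex.I * b) = Complex.exp (Complex.I * ((a + b) / 2))
      * Complex.exp (-((a - b) / 2) * Complex.I) := by
    rw [← Complex.exp_add]; congr 1; ring
  rw [h1, h2]
  linear_combination (Complex.exp (Complex.I * ((a + b) / 2)) *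
    (Complex.exp (((a - b) / 2) * Complex.I) - Complex.exp (-((a - b) / 2) * Complex.I))) *
    Complex.I_mul_I

theorem norm_torusEntry_sub (u : Fin m → ℝ) (i j : Fin (m + 1)) :
    ‖torusEntry (m + 1) u i - torusEntry (m + 1) u j‖
      = |2 * Real.sin ((coord u i - coord u j) / 2)| := by
  rw [torusEntry, torusEntry, exp_sub_exp, norm_mul, norm_mul, Complex.norm_I, Complex.norm_real,
    one_mul, angle_eq, angle_eq]
  have : ‖Complex.exp (Complex.I * (((coord u i - mean u : ℝ) + (coord u j - mean u : ℝ)) / 2))‖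
      = 1 := by
    rw [mul_comm]
    have := Complex.norm_exp_ofReal_mul_I (((coord u i - mean u) + (coord u j - mean u)) / 2)
    push_cast at this ⊢
    exact this
  rw [this, one_mul, Real.norm_eq_abs]
  congr 4
  ring

theorem sum_Ioi_add {n : ℕ} (x : Fin n → ℝ) :
    ∑ i : Fin n, ∑ j ∈ Finset.Ioi i, (x i + x j) = ((n : ℝ) - 1) * ∑ i, x i := by
  induction n with
  | zero => simp
  | succ n ih =>
    rw [Fin.sum_univ_succ, Fin.sum_Ioi_zero]
    simp only [Fin.sum_Ioi_succ]
    have := ih (fun i => x i.succ)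
    rw [this, Fin.sum_univ_succ, Finset.sum_add_distrib]
    simp
    ring

theorem sum_card_Ioi : ∑ i : Fin (m + 1), (Finset.Ioi i).card = (m + 1) * m / 2 := by
  have := Finset.sum_range_id_mul_two (m + 1)
  simp only [Fin.card_Ioi]
  have h2 : ∑ i : Fin (m + 1), (m + 1 - 1 - i.val) = ∑ i ∈ Finset.range (m + 1), i := by
    rw [← Finset.sum_range_reflect, Finset.sum_range]
  rw [h2]
  simp at this
  omega

/-- On all of the torus of `U(n)`, the Vandermonde product in terms of sines. -/
theorem vand_exp (x : Fin (m + 1) → ℝ) :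
    vand (fun i => Complex.exp (Complex.I * x i)) =
      Complex.I ^ ((m + 1) * m / 2) * Complex.exp (Complex.I * (m / 2 * ∑ i, x i : ℝ))
        * (varpi (m + 1) (diff (m := m) x) : ℝ) := by
  unfold vand varpi
  have h : ∀ i : Fin (m + 1), ∀ j ∈ Finset.Ioi i,
      Complex.exp (Complex.I * x i) - Complex.exp (Complex.I * x j)
        = Complex.exp (Complex.I * ((x i + x j) / 2)) *
          (Complex.I * (2 * Real.sin (gap (m + 1) (diff (m := m) x) i j / 2) : ℝ)) := by
    intro i j hj
    rw [exp_sub_exp, gap_eq _ (Finset.mem_Ioi.mp hj).le, coord_diff, coord_diff]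
    congr 6
    ring
  rw [Finset.prod_congr rfl fun i _ => Finset.prod_congr rfl (h i)]
  simp only [Finset.prod_mul_distrib, Finset.prod_const]
  rw [Finset.prod_pow_eq_pow_sum, sum_card_Ioi]
  simp only [← Complex.exp_sum, ← Finset.mul_sum]
  have h3 : ∑ i : Fin (m + 1), ∑ j ∈ Finset.Ioi i, ((x i : ℂ) + x j) / 2
      = ((m / 2 * ∑ i, x i : ℝ) : ℂ) := by
    have := sum_Ioi_add x
    rw [← Complex.ofReal_inj] at this
    push_cast at this ⊢
    simp only [← Finset.sum_div]
    rw [this]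
    ring
  rw [h3]
  push_cast
  simp only [Finset.prod_mul_distrib, Finset.prod_const]
  ring

theorem deltaExp_eq_varpi (u : Fin m → ℝ) : deltaExp (m + 1) u =
    Complex.I ^ ((m + 1) * m / 2) * (varpi (m + 1) u : ℝ) := by
  have := vand_exp (angle (m + 1) u)
  rw [sum_angle, diff_angle] at this
  rw [deltaExp_eq]
  change vand (fun i => Complex.exp (Complex.I * (angle (m + 1) u i : ℂ))) = _
  simpa using this

theorem mem_regular_iff (u : Fin m → ℝ) : u ∈ regular (m + 1) ↔ varpi (m + 1) u ≠ 0 := by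
  change deltaExp (m + 1) u ≠ 0 ↔ _
  rw [deltaExp_eq_varpi]
  simp

theorem varpi_eq (u : Fin m → ℝ) : varpi (m + 1) u =
    ∏ i, ∏ j ∈ Finset.Ioi i, 2 * Real.sin ((coord u i - coord u j) / 2) := by
  refine Finset.prod_congr rfl fun i _ => Finset.prod_congr rfl fun j hj => ?_
  rw [gap_eq u (Finset.mem_Ioi.mp hj).le]

theorem mem_regular_iff_sin (u : Fin m → ℝ) : u ∈ regular (m + 1) ↔
    ∀ i j, i ≠ j → Real.sin ((coord u i - coord u j) / 2) ≠ 0 := by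
  rw [mem_regular_iff, varpi_eq]
  simp only [Finset.prod_ne_zero_iff, Finset.mem_Ioi, Finset.mem_univ, forall_const, ne_eq,
    mul_eq_zero, not_or]
  constructor
  · intro h i j hij hs
    rcases lt_or_gt_of_ne hij with h' | h'
    · exact (h i j h').2 hs
    · refine (h j i h').2 ?_
      rw [← neg_sub, neg_div, Real.sin_neg, hs, neg_zero]
  · intro h i j hij
    exact ⟨two_ne_zero, h i j hij.ne⟩

theorem mem_regular_iff_int (u : Fin m → ℝ) : u ∈ regular (m + 1) ↔
    ∀ i j, i ≠ j → ∀ k : ℤ, coord u i - coord u j ≠ 2 * Real.pi * k := by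
  rw [mem_regular_iff_sin]
  refine forall_congr' fun i => forall_congr' fun j => forall_congr' fun _ => ?_
  rw [ne_eq, Real.sin_eq_zero_iff, not_exists]
  refine forall_congr' fun k => not_congr ⟨fun h => by linarith, fun h => by linarith⟩

theorem regular_perm (w : Equiv.Perm (Fin (m + 1))) {u : Fin m → ℝ} (hu : u ∈ regular (m + 1)) :
    perm w u ∈ regular (m + 1) := by
  change deltaExp (m + 1) _ ≠ 0
  rw [deltaExp_perm]
  refine mul_ne_zero ?_ hu
  simp

/-- Hyperplanes of equal coordinates are negligible, with all their translates. -/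
theorem volume_coord_sub_eq (i j : Fin (m + 1)) (hij : i ≠ j) (c : ℝ) :
    volume {u : Fin m → ℝ | coord u i - coord u j = c} = 0 := by
  let f : (Fin m → ℝ) →ₗ[ℝ] ℝ :=
    { toFun := fun u => coord u i - coord u j
      map_add' := fun u v => by simp only [coord_add]; ring
      map_smul' := fun a u => by simp only [coord_smul, RingHom.id_apply, smul_eq_mul]; ring }
  have hf : f ≠ 0 := by
    intro h
    have := LinearMap.congr_fun h (diff fun k => if k = i then (1 : ℝ) else 0)
    simp [f, coord_diff, hij.symm] at this
  have hsurj : Function.Surjective f := LinearMap.surjective hf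
  obtain ⟨v, hv⟩ := hsurj 1
  have hker : LinearMap.ker f ≠ ⊤ := fun h => hf (LinearMap.ker_eq_top.mp h)
  have h0 := Measure.addHaar_submodule (volume : Measure (Fin m → ℝ)) (LinearMap.ker f) hker
  have : {u : Fin m → ℝ | coord u i - coord u j = c}
      = (fun u => (-(c • v)) + u) ⁻¹' (LinearMap.ker f : Set (Fin m → ℝ)) := by
    ext u
    change f u = c ↔ -(c • v) + u ∈ LinearMap.ker f
    rw [LinearMap.mem_ker, map_add, map_neg, map_smul, hv]
    simp only [smul_eq_mul, mul_one]
    constructor <;> intro h <;> linarith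
  rw [this, measure_preimage_add, h0]

theorem ae_regular : ∀ᵐ u : Fin m → ℝ, u ∈ regular (m + 1) := by
  simp only [mem_regular_iff_int]
  simp only [ae_all_iff]
  intro i j hij k
  have := volume_coord_sub_eq (m := m) i j hij (2 * Real.pi * k)
  rw [ae_iff]
  simpa using this

theorem dense_regular : Dense (regular (m + 1) : Set (Fin m → ℝ)) :=
  Measure.dense_of_ae ae_regular

theorem deltaTilde_ne_zero {u : Fin m → ℝ} (hu : u ∈ regular (m + 1)) :
    deltaTilde (m + 1) u ≠ 0 := by
  rw [deltaTilde_eq, vand_ne_zero_iff]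
  intro i j h
  by_contra hij
  exact (mem_regular_iff_int u).mp hu i j hij 0 (by simp [h])

theorem coord_shift (u : Fin m → ℝ) (p : Fin m → ℤ) (i : Fin (m + 1)) :
    coord (shift (m + 1) u p) i = coord u i + 2 * Real.pi * (coord p i : ℤ) := by
  rw [← coord_intCast, ← coord_smul, ← coord_add]
  congr 1
  ext k
  change u k + (p k : ℝ) * (2 * Real.pi) = u k + 2 * Real.pi * p k
  ring

end coord

/-! ### Summability of the product of inverse gaps over the lattice. -/

/-- The weight `1 / (1 + |k|)`. -/
def wt (k : ℤ) : ℝ := (1 + |(k : ℝ)|)⁻¹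

theorem one_add_abs_pos (k : ℤ) : 0 < 1 + |(k : ℝ)| := by positivity

theorem wt_pos (k : ℤ) : 0 < wt k := inv_pos.mpr (one_add_abs_pos k)

theorem wt_le_one (k : ℤ) : wt k ≤ 1 :=
  inv_le_one_of_one_le₀ (by linarith [abs_nonneg (k : ℝ)])

theorem summable_wt_rpow {b : ℝ} (hb : 1 < b) : Summable fun k : ℤ => wt k ^ b := by
  have h : Summable fun n : ℕ => (((n + 1 : ℕ) : ℝ) ^ b)⁻¹ :=
    (summable_nat_add_iff 1).mpr (Real.summable_nat_rpow_inv.mpr hb)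
  have e : ∀ n : ℕ, (((n + 1 : ℕ) : ℝ) ^ b)⁻¹ = ((1 + (n : ℝ))⁻¹) ^ b := by
    intro n
    rw [Real.inv_rpow (by positivity)]
    push_cast
    rw [add_comm]
  simp only [e] at h
  refine Summable.of_nat_of_neg ?_ ?_
  · simpa [wt] using h
  · simpa [wt] using h

/-- The shear `(a, q) ↦ (a + φ q, q)` permutes the index set, so this is a rearranged product of two
summable families. -/
theorem summable_shear {β : Type*} {g : β → ℝ} {h : ℤ → ℝ} (hg : Summable g) (hh : Summable h)
    (hg0 : 0 ≤ g) (hh0 : 0 ≤ h) (φ : β → ℤ) :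
    Summable fun x : ℤ × β => h (x.1 + φ x.2) * g x.2 := by
  let e : ℤ × β ≃ ℤ × β :=
    { toFun := fun x => (x.1 + φ x.2, x.2)
      invFun := fun x => (x.1 - φ x.2, x.2)
      left_inv := fun x => by simp
      right_inv := fun x => by simp }
  exact e.summable_iff.mpr (hh.mul_of_nonneg hg hh0 hg0)

/-- These are the three gaps for m = 2, where one-dimensional summation fails at the critical
exponent 1. From |b| ≤ |a| + |a + b| follows `wt a * wt (a + b) ≤ wt b`. A quarter of the left side
is spent to raise the exponent of `wt b` to 5/4; the arithmetic-geometric mean inequality splits the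
other three quarters into powers 3/2. All exponents now exceed 1. -/
theorem wt_mul_le (a b : ℤ) : wt a * wt (a + b) * wt b ≤
    wt a ^ (3 / 2 : ℝ) * wt b ^ (5 / 4 : ℝ) + wt (a + b) ^ (3 / 2 : ℝ) * wt b ^ (5 / 4 : ℝ) := by
  have ha := wt_pos a
  have hab := wt_pos (a + b)
  have hb := wt_pos b
  have h1 : wt a * wt (a + b) ≤ wt b := by
    unfold wt
    rw [← mul_inv]
    refine inv_anti₀ (one_add_abs_pos b) ?_
    have : |(b : ℝ)| ≤ |(a : ℝ)| + |((a + b : ℤ) : ℝ)| := by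
      have := abs_sub ((a + b : ℤ) : ℝ) (a : ℝ)
      push_cast at this ⊢
      rw [add_sub_cancel_left] at this
      linarith
    nlinarith [mul_nonneg (abs_nonneg (a : ℝ)) (abs_nonneg ((a + b : ℤ) : ℝ))]
  have h2 : (wt a * wt (a + b)) ^ (1 / 4 : ℝ) ≤ wt b ^ (1 / 4 : ℝ) :=
    Real.rpow_le_rpow (by positivity) h1 (by norm_num)
  have h3 : wt a * wt (a + b) = (wt a * wt (a + b)) ^ (3 / 4 : ℝ)
      * (wt a * wt (a + b)) ^ (1 / 4 : ℝ) := by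
    rw [← Real.rpow_add (by positivity)]
    norm_num
  have h4 : (wt a * wt (a + b)) ^ (3 / 4 : ℝ) ≤
      wt a ^ (3 / 2 : ℝ) + wt (a + b) ^ (3 / 2 : ℝ) := by
    have e : ∀ x : ℝ, 0 < x → x ^ (3 / 2 : ℝ) = (x ^ (3 / 4 : ℝ)) ^ 2 := by
      intro x hx
      rw [← Real.rpow_natCast, ← Real.rpow_mul hx.le]
      norm_num
    rw [Real.mul_rpow ha.le hab.le, e _ ha, e _ hab]
    nlinarith [sq_nonneg (wt a ^ (3 / 4 : ℝ) - wt (a + b) ^ (3 / 4 : ℝ)),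
      sq_nonneg (wt a ^ (3 / 4 : ℝ)), sq_nonneg (wt (a + b) ^ (3 / 4 : ℝ))]
  have h5 : wt b ^ (5 / 4 : ℝ) = wt b ^ (1 / 4 : ℝ) * wt b := by
    have := Real.rpow_add hb (1 / 4) 1
    rw [Real.rpow_one] at this
    rw [← this]
    norm_num
  calc wt a * wt (a + b) * wt b
      ≤ ((wt a ^ (3 / 2 : ℝ) + wt (a + b) ^ (3 / 2 : ℝ)) * wt b ^ (1 / 4 : ℝ)) * wt b := by
        refine mul_le_mul_of_nonneg_right ?_ hb.le
        rw [h3]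
        exact mul_le_mul h4 h2 (by positivity) (by positivity)
    _ = _ := by rw [h5]; ring

/-- The product of the weights of all the integral gaps. -/
def wtProd {m : ℕ} (p : Fin m → ℤ) : ℝ :=
  ∏ i, ∏ j ∈ Finset.Ioi i, wt (coord p i - coord p j)

theorem wtProd_nonneg {m : ℕ} (p : Fin m → ℤ) : 0 ≤ wtProd p :=
  Finset.prod_nonneg fun _ _ => Finset.prod_nonneg fun _ _ => (wt_pos _).le

/-- Of the gaps that involve the new first coordinate, only those to the second and to the last one
are kept; the others have weight at most 1. -/
theorem wtProd_cons_le {m : ℕ} (a : ℤ) (q : Fin (m + 1) → ℤ) :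
    wtProd (Fin.cons a q : Fin (m + 2) → ℤ) ≤ wt a * wt (a + coord q 0) * wtProd q := by
  unfold wtProd
  rw [Fin.prod_univ_succ, Fin.prod_Ioi_zero]
  simp only [Fin.prod_Ioi_succ, coord_cons_zero, coord_cons_succ]
  refine mul_le_mul_of_nonneg_right ?_ (wtProd_nonneg q)
  rw [Fin.prod_univ_succ, Fin.prod_univ_castSucc]
  simp only [Fin.succ_last, coord_last, sub_zero, add_sub_cancel_right]
  refine mul_le_mul_of_nonneg_left ?_ (wt_pos a).le
  exact mul_le_of_le_one_left (wt_pos _).le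
    (Finset.prod_le_one (fun _ _ => (wt_pos _).le) fun _ _ => wt_le_one _)

/-- Coordinates are added in front. The two retained factors are at most `wt a ^ 2 + wt (a + s) ^
2`, whose sum over `a` does not depend on `s`. The induction starts at m = 2, by `wt_mul_le`, since
for m = 1 the harmonic series diverges. -/
theorem summable_wtProd {m : ℕ} (hm : 2 ≤ m) : Summable fun p : Fin m → ℤ => wtProd p := by
  have step : ∀ (k : ℕ) (G : (Fin (k + 1) → ℤ) → ℝ) (h : ℤ → ℝ), Summable G → Summable h →
      0 ≤ G → 0 ≤ h → (∀ a q, wt a * wt (a + coord q 0) * wtProd q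
        ≤ h a * G q + h (a + coord q 0) * G q) →
      Summable fun p : Fin (k + 2) → ℤ => wtProd p := by
    intro k G h hG hh hG0 hh0 hle
    refine (Fin.consEquiv fun _ : Fin (k + 2) => ℤ).summable_iff.mp ?_
    refine Summable.of_nonneg_of_le (fun x => wtProd_nonneg _) (fun x => ?_)
      ((summable_shear hG hh hG0 hh0 fun _ => 0).add
        (summable_shear hG hh hG0 hh0 fun q => coord q 0))
    refine (wtProd_cons_le x.1 x.2).trans ?_
    simpa using hle x.1 x.2
  induction m, hm using Nat.le_induction with
  | base =>
    refine step 0 (fun q => wt (q 0) ^ (5 / 4 : ℝ)) (fun a => wt a ^ (3 / 2 : ℝ)) ?_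
      (summable_wt_rpow (by norm_num)) (fun q => (Real.rpow_pos_of_pos (wt_pos _) _).le)
      (fun q => (Real.rpow_pos_of_pos (wt_pos _) _).le) ?_
    · exact (Equiv.funUnique (Fin 1) ℤ).summable_iff.mpr
        (summable_wt_rpow (by norm_num : (1 : ℝ) < 5 / 4))
    · intro a q
      have h0 : coord q 0 = q 0 := by simp [coord]
      have h1 : wtProd q = wt (q 0) := by
        have e : (1 : Fin 2) = Fin.last 1 := rfl
        rw [wtProd, Fin.prod_univ_two]
        have i0 : Finset.Ioi (0 : Fin 2) = {1} := by decide
        have i1 : Finset.Ioi (1 : Fin 2) = ∅ := by decide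
        rw [i0, i1, Finset.prod_singleton, Finset.prod_empty, e, coord_last, h0]
        simp
      rw [h0, h1]
      exact wt_mul_le a (q 0)
  | succ m hm ih =>
    obtain ⟨k, rfl⟩ : ∃ k, m = k + 1 := ⟨m - 1, by omega⟩
    refine step k wtProd (fun a => wt a ^ (2 : ℝ)) ih (summable_wt_rpow (by norm_num))
      (fun q => wtProd_nonneg q) (fun a => (Real.rpow_pos_of_pos (wt_pos _) _).le) ?_
    intro a q
    rw [← add_mul]
    refine mul_le_mul_of_nonneg_right ?_ (wtProd_nonneg q)
    simp only [Real.rpow_two]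
    nlinarith [sq_nonneg (wt a - wt (a + coord q 0)), sq_nonneg (wt a),
      sq_nonneg (wt (a + coord q 0))]

/-! ### The sinc product and the continuous extension of D̂ϖ. -/

/-- A bound of an integral translate of `sinc`, uniform for bounded arguments. -/
theorem abs_sinc_le_wt {x B : ℝ} (hx : |x| ≤ B) (k : ℤ) :
    |Real.sinc ((x + 2 * Real.pi * k) / 2)| ≤ (2 + B) * wt k := by
  have hB : 0 ≤ B := (abs_nonneg x).trans hx
  rw [wt, ← div_eq_mul_inv, le_div_iff₀ (one_add_abs_pos k)]
  obtain ⟨y, hy⟩ : ∃ y, y = (x + 2 * Real.pi * k) / 2 := ⟨_, rfl⟩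
  rw [← hy]
  have h1 : |y| * |Real.sinc y| ≤ 1 := by
    by_cases h : y = 0
    · simp [h]
    · rw [Real.sinc_of_ne_zero h, ← abs_mul, mul_div_cancel₀ _ h]
      exact Real.abs_sin_le_one y
  have h2 := Real.abs_sinc_le_one y
  have h3 : |(k : ℝ)| ≤ |y| + B := by
    have e : Real.pi * k = y - x / 2 := by rw [hy]; ring
    have h4 : Real.pi * |(k : ℝ)| ≤ |y| + B / 2 := by
      calc Real.pi * |(k : ℝ)| = |Real.pi * k| := by rw [abs_mul, abs_of_pos Real.pi_pos]
        _ ≤ |y| + |x / 2| := by rw [e]; exact abs_sub y (x / 2)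
        _ ≤ |y| + B / 2 := by rw [abs_div x, abs_two]; linarith
    nlinarith [Real.pi_gt_three, abs_nonneg (k : ℝ)]
  calc |Real.sinc y| * (1 + |(k : ℝ)|) ≤ |Real.sinc y| * (1 + (|y| + B)) := by gcongr
    _ = |Real.sinc y| + |y| * |Real.sinc y| + |Real.sinc y| * B := by ring
    _ ≤ 1 + 1 + 1 * B := by gcongr
    _ = 2 + B := by ring

/-- `∏_{i<j} sinc((u_i + ⋯ + u_{j-1}) / 2)`. -/
def sincProd {m : ℕ} (u : Fin m → ℝ) : ℝ :=
  ∏ i, ∏ j ∈ Finset.Ioi i, Real.sinc ((coord u i - coord u j) / 2)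

section

variable {m : ℕ}

theorem continuous_sincProd : Continuous (sincProd : (Fin m → ℝ) → ℝ) := by
  unfold sincProd
  have := fun i => continuous_coord (m := m) i
  have := Real.continuous_sinc
  refine continuous_finsetProd _ fun i _ => continuous_finsetProd _ fun j _ => ?_
  fun_prop

theorem abs_coord_sub_le {u : Fin m → ℝ} {B : ℝ} (hu : ∀ k, |u k| ≤ B) (i j : Fin (m + 1)) :
    |coord u i - coord u j| ≤ 2 * (m * B) := by
  have h : ∀ i, |coord u i| ≤ m * B := by
    intro i
    refine (Finset.abs_sum_le_sum_abs _ _).trans ?_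
    have : ∀ k ∈ Finset.univ, |if i.val ≤ k.val then u k else 0| ≤ B := by
      intro k _
      split_ifs
      · exact hu k
      · rw [abs_zero]; exact (abs_nonneg _).trans (hu k)
    refine (Finset.sum_le_card_nsmul _ _ _ this).trans ?_
    simp
  linarith [abs_sub (coord u i) (coord u j), h i, h j]

theorem abs_sincProd_shift_le (B : ℝ) : ∃ C : ℝ, ∀ u : Fin m → ℝ, (∀ k, |u k| ≤ B) →
    ∀ p : Fin m → ℤ, |sincProd (m := m) (shift (m + 1) u p)| ≤ C * wtProd p := by
  refine ⟨∏ i : Fin (m + 1), ∏ j ∈ Finset.Ioi i, (2 + 2 * (m * B)), fun u hu p => ?_⟩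
  rw [sincProd, wtProd, Finset.abs_prod, ← Finset.prod_mul_distrib]
  refine Finset.prod_le_prod (fun _ _ => abs_nonneg _) fun i _ => ?_
  rw [Finset.abs_prod, ← Finset.prod_mul_distrib]
  refine Finset.prod_le_prod (fun _ _ => abs_nonneg _) fun j _ => ?_
  have := abs_sinc_le_wt (abs_coord_sub_le hu i j) (coord p i - coord p j)
  have e : coord (shift (m + 1) u p : Fin m → ℝ) i - coord (shift (m + 1) u p : Fin m → ℝ) j
      = coord u i - coord u j + 2 * Real.pi * ((coord p i - coord p j : ℤ) : ℝ) := by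
    rw [coord_shift, coord_shift]
    push_cast
    ring
  rw [e]
  exact this

/-- The sign by which `varpi` changes under a translation. -/
def latticeSign (p : Fin m → ℤ) : ℝ :=
  ∏ i, ∏ j ∈ Finset.Ioi i, (-1 : ℝ) ^ (coord p i - coord p j)

theorem varpi_shift (u : Fin m → ℝ) (p : Fin m → ℤ) :
    varpi (m + 1) (shift (m + 1) u p) = latticeSign p * varpi (m + 1) u := by
  rw [varpi_eq, varpi_eq, latticeSign, ← Finset.prod_mul_distrib]
  refine Finset.prod_congr rfl fun i _ => ?_
  rw [← Finset.prod_mul_distrib]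
  refine Finset.prod_congr rfl fun j _ => ?_
  have : (coord (shift (m + 1) u p) i - coord (shift (m + 1) u p) j) / 2
      = (coord u i - coord u j) / 2 + ((coord p i - coord p j : ℤ) : ℝ) * Real.pi := by
    rw [coord_shift, coord_shift]
    push_cast
    ring
  rw [this, Real.sin_add_int_mul_pi]
  ring

theorem latticeSign_mul_self (p : Fin m → ℤ) : latticeSign p * latticeSign p = 1 := by
  rw [latticeSign, ← Finset.prod_mul_distrib]
  refine Finset.prod_eq_one fun i _ => ?_
  rw [← Finset.prod_mul_distrib]
  refine Finset.prod_eq_one fun j _ => ?_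
  rw [← mul_zpow]
  simp

theorem abs_latticeSign (p : Fin m → ℤ) : |latticeSign p| = 1 := by
  have := latticeSign_mul_self p
  rcases mul_self_eq_one_iff.mp this with h | h <;> simp [h]

theorem shift_mem_regular {u : Fin m → ℝ} (hu : u ∈ regular (m + 1)) (p : Fin m → ℤ) :
    shift (m + 1) u p ∈ regular (m + 1) := by
  have h := (mem_regular_iff u).mp hu
  refine (mem_regular_iff (m := m) _).mpr ?_
  rw [varpi_shift]
  refine mul_ne_zero ?_ h
  intro h0
  have := abs_latticeSign p
  simp [h0] at this

theorem sincProd_mul_deltaTilde (u : Fin m → ℝ) :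
    sincProd u * deltaTilde (m + 1) u = varpi (m + 1) u := by
  rw [deltaTilde_eq, varpi_eq, vand, sincProd, ← Finset.prod_mul_distrib]
  refine Finset.prod_congr rfl fun i _ => ?_
  rw [← Finset.prod_mul_distrib]
  refine Finset.prod_congr rfl fun j _ => ?_
  by_cases h : (coord u i - coord u j) / 2 = 0
  · have h' : coord u i - coord u j = 0 := by linarith
    simp [h']
  · have h' : coord u i - coord u j ≠ 0 := fun h' => h (by rw [h']; simp)
    rw [Real.sinc_of_ne_zero h]
    field_simp

/-- ϖ(u) equals ±ϖ(u + 2πp), whose zeros cancel the poles of the translated term; this is what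
removes the singularities term by term. -/
theorem one_div_deltaTilde_shift {u : Fin m → ℝ} (hu : u ∈ regular (m + 1)) (p : Fin m → ℤ) :
    1 / deltaTilde (m + 1) (shift (m + 1) u p)
      = latticeSign p * sincProd (m := m) (shift (m + 1) u p) / varpi (m + 1) u := by
  have h1 := deltaTilde_ne_zero (m := m) (shift_mem_regular hu p)
  have h2 := (mem_regular_iff u).mp hu
  have h3 := sincProd_mul_deltaTilde (m := m) (shift (m + 1) u p)
  rw [varpi_shift] at h3
  rw [div_eq_div_iff h1 h2, mul_assoc, h3, ← mul_assoc, latticeSign_mul_self]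

/-- `R̂_n` for `n > 2`, as a sum that converges everywhere. -/
def sincSum (u : Fin m → ℝ) : ℝ :=
  ∑' p : Fin m → ℤ, latticeSign p * sincProd (m := m) (shift (m + 1) u p)

theorem continuous_shift (p : Fin m → ℤ) :
    Continuous (fun u : Fin m → ℝ => (shift (m + 1) u p : Fin m → ℝ)) :=
  continuous_pi fun k => (continuous_apply k).add continuous_const

theorem summable_sincProd_shift (hm : 2 ≤ m) (u : Fin m → ℝ) :
    Summable fun p : Fin m → ℤ => latticeSign p * sincProd (m := m) (shift (m + 1) u p) := by
  obtain ⟨C, hC⟩ := abs_sincProd_shift_le (m := m) ‖u‖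
  refine Summable.of_norm_bounded ((summable_wtProd hm).mul_left C) fun p => ?_
  rw [norm_mul, Real.norm_eq_abs, Real.norm_eq_abs, abs_latticeSign, one_mul]
  exact hC u (fun k => norm_le_pi_norm u k) p

/-- The Weierstrass test on balls: the constant in the domination depends only on the radius. -/
theorem continuous_sincSum (hm : 2 ≤ m) : Continuous (sincSum : (Fin m → ℝ) → ℝ) := by
  rw [continuous_iff_continuousAt]
  intro u
  obtain ⟨C, hC⟩ := abs_sincProd_shift_le (m := m) (‖u‖ + 1)
  have h : ContinuousOn (sincSum : (Fin m → ℝ) → ℝ) (Metric.closedBall 0 (‖u‖ + 1)) := by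
    refine continuousOn_tsum (u := fun p => C * wtProd p) (fun p => ?_)
      ((summable_wtProd hm).mul_left C) fun p v hv => ?_
    · exact (continuous_const.mul (continuous_sincProd.comp (continuous_shift p))).continuousOn
    · rw [norm_mul, Real.norm_eq_abs, Real.norm_eq_abs, abs_latticeSign, one_mul]
      refine hC v (fun k => (norm_le_pi_norm v k).trans ?_) p
      simpa using hv
  refine h.continuousAt (Metric.closedBall_mem_nhds_of_mem ?_)
  simp

theorem summable_one_div_deltaTilde (hm : 2 ≤ m) {u : Fin m → ℝ} (hu : u ∈ regular (m + 1)) :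
    Summable fun p : Fin m → ℤ => 1 / deltaTilde (m + 1) (shift (m + 1) u p) := by
  simp only [one_div_deltaTilde_shift hu]
  exact (summable_sincProd_shift hm u).div_const _

theorem tendsto_box : Tendsto (fun N => (box (m + 1) N : Finset (Fin m → ℤ))) atTop atTop := by
  refine tendsto_atTop_finset_of_monotone ?_ ?_
  · intro a b hab
    refine Fintype.piFinset_subset _ _ fun _ => Finset.Icc_subset_Icc ?_ ?_ <;> simpa using hab
  · intro p
    refine ⟨∑ k, (p k).natAbs, Fintype.mem_piFinset.mpr fun k => ?_⟩
    have h : (p k).natAbs ≤ ∑ k, (p k).natAbs :=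
      Finset.single_le_sum (f := fun k => (p k).natAbs) (fun _ _ => Nat.zero_le _)
        (Finset.mem_univ k)
    rw [Finset.mem_Icc]
    omega

theorem hasSum_Dhat (hm : 2 ≤ m) {u : Fin m → ℝ} (hu : u ∈ regular (m + 1)) :
    HasSum (fun p : Fin m → ℤ => 1 / deltaTilde (m + 1) (shift (m + 1) u p)) (Dhat (m + 1) u) := by
  have h := (summable_one_div_deltaTilde hm hu).hasSum
  have h2 : Tendsto (DhatPartial (m + 1) u) atTop
      (𝓝 (∑' p : Fin m → ℤ, 1 / deltaTilde (m + 1) (shift (m + 1) u p))) := h.comp tendsto_box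
  have : Dhat (m + 1) u = ∑' p : Fin m → ℤ, 1 / deltaTilde (m + 1) (shift (m + 1) u p) :=
    h2.limUnder_eq
  rw [this]
  exact h

theorem Dhat_mul_varpi (hm : 2 ≤ m) {u : Fin m → ℝ} (hu : u ∈ regular (m + 1)) :
    Dhat (m + 1) u * varpi (m + 1) u = sincSum u := by
  have h := (hasSum_Dhat hm hu).mul_right (varpi (m + 1) u)
  refine h.unique ?_
  have := (summable_sincProd_shift hm u).hasSum
  convert! this using 2 with p
  rw [one_div_deltaTilde_shift hu, div_mul_cancel₀ _ ((mem_regular_iff u).mp hu)]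

theorem extendFrom_eq_of_continuous {Y : Type*} [TopologicalSpace Y] [T2Space Y]
    {f g : (Fin m → ℝ) → Y}
    (hg : Continuous g) (h : ∀ u ∈ regular (m + 1), f u = g u) :
    extendFrom (regular (m + 1)) f = g := by
  ext u
  refine extendFrom_eq (dense_regular u) ?_
  refine (hg.continuousAt.tendsto.mono_left nhdsWithin_le_nhds).congr' ?_
  filter_upwards [self_mem_nhdsWithin] with v hv
  exact (h v hv).symm

theorem shift_zero (u : Fin m → ℝ) : (shift (m + 1) u (0 : Fin m → ℤ) : Fin m → ℝ) = u := by
  ext k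
  change u k + ((0 : ℤ) : ℝ) * (2 * Real.pi) = u k
  simp

/-- If p_k ≠ 0, the term of p contains the factor sinc(π p_k) = 0, which belongs to the adjacent
pair k, k + 1. -/
theorem sincSum_zero : sincSum (0 : Fin m → ℝ) = 1 := by
  rw [sincSum, tsum_eq_single (0 : Fin m → ℤ)]
  · have h1 : latticeSign (0 : Fin m → ℤ) = 1 := by simp [latticeSign, coord]
    rw [shift_zero, h1]
    simp [sincProd, coord]
  · intro p hp
    obtain ⟨k, hk⟩ := Function.ne_iff.mp hp
    have hk' : p k ≠ 0 := hk
    refine mul_eq_zero_of_right _ ?_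
    refine Finset.prod_eq_zero (Finset.mem_univ k.castSucc) ?_
    refine Finset.prod_eq_zero (Finset.mem_Ioi.mpr (Fin.castSucc_lt_succ (i := k))) ?_
    have h0 : ∀ i, coord (0 : Fin m → ℝ) i = 0 := fun i => by simp [coord]
    have : (coord (shift (m + 1) (0 : Fin m → ℝ) p) k.castSucc
        - coord (shift (m + 1) (0 : Fin m → ℝ) p) k.succ) / 2 = p k * Real.pi := by
      rw [coord_shift (m := m), coord_shift (m := m), coord_castSucc p]
      push_cast
      simp only [h0]
      ring
    rw [this, Real.sinc_of_ne_zero, Real.sin_int_mul_pi, zero_div]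
    exact mul_ne_zero (by exact_mod_cast hk') Real.pi_ne_zero

end

/-! ### The cotangent series and its derivatives. -/

/-- `(e^{iy} + 1) / (2 (e^{iy} - 1))`, that is `cot(y / 2) / (2i)`. -/
def dcot (y : ℝ) : ℂ :=
  (Complex.exp (Complex.I * y) + 1) / (2 * (Complex.exp (Complex.I * y) - 1))

/-- The real numbers that are not integral multiples of `2π`. -/
def offLattice : Set ℝ := {y | ∀ k : ℤ, y ≠ 2 * Real.pi * k}

theorem mem_offLattice_iff_sin {y : ℝ} : y ∈ offLattice ↔ Real.sin (y / 2) ≠ 0 := by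
  rw [ne_eq, Real.sin_eq_zero_iff, not_exists]
  exact forall_congr' fun k => not_congr ⟨fun h => by linarith, fun h => by linarith⟩

theorem exp_ne_one {y : ℝ} (hy : y ∈ offLattice) : Complex.exp (Complex.I * y) ≠ 1 := by
  rw [ne_eq, Complex.exp_eq_one_iff, not_exists]
  intro k hk
  refine hy k ?_
  have : (y : ℂ) = 2 * Real.pi * k :=
    mul_left_cancel₀ Complex.I_ne_zero (by rw [hk]; ring)
  exact_mod_cast this

theorem add_mem_offLattice {y : ℝ} (hy : y ∈ offLattice) (k : ℤ) :
    y + 2 * Real.pi * k ∈ offLattice := by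
  intro l hl
  refine hy (l - k) ?_
  push_cast
  linarith

theorem add_ne_zero_of_offLattice {y : ℝ} (hy : y ∈ offLattice) (k : ℤ) :
    y + 2 * Real.pi * k ≠ 0 := by
  simpa using add_mem_offLattice hy k 0

theorem dcot_add (y : ℝ) (k : ℤ) : dcot (y + 2 * Real.pi * k) = dcot y := by
  have : Complex.exp (Complex.I * ((y + 2 * Real.pi * k : ℝ) : ℂ))
      = Complex.exp (Complex.I * y) := by
    rw [Complex.exp_eq_exp_iff_exists_int]
    refine ⟨k, ?_⟩
    push_cast
    ring
  rw [dcot, this, dcot]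

/-- The Riccati equation of the cotangent. Because of it, differentiation preserves polynomials in
`dcot`. -/
theorem hasDerivAt_dcot {y : ℝ} (hy : y ∈ offLattice) :
    HasDerivAt dcot (Complex.I * (1 / 4 - dcot y ^ 2)) y := by
  have h1 : HasDerivAt (fun y : ℝ => Complex.exp (Complex.I * y))
      (Complex.exp (Complex.I * y) * Complex.I) y := by
    have h0 : HasDerivAt (fun y : ℝ => Complex.I * (y : ℂ)) Complex.I y := by
      simpa using (Complex.ofRealCLM.hasDerivAt (x := y)).const_mul Complex.I
    exact h0.cexp
  have h2 := sub_ne_zero.mpr (exp_ne_one hy)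
  have h3 := (h1.add_const 1).div ((h1.sub_const 1).const_mul 2) (by simpa using h2)
  convert! h3 using 1
  simp only [dcot]
  field_simp
  ring

/-- The symmetric partial sums of `1 / (y + 2πs)^a`. -/
def powSum (a N : ℕ) (y : ℝ) : ℂ :=
  ∑ s ∈ Finset.Icc (-(N : ℤ)) N, (((y + 2 * Real.pi * s : ℝ) : ℂ) ^ a)⁻¹

theorem sum_Icc_neg_int {M : Type*} [AddCommGroup M] (f : ℤ → M) (N : ℕ) :
    ∑ s ∈ Finset.Icc (-(N : ℤ)) N, f s
      = f 0 + ∑ j ∈ Finset.range N, (f (-((j : ℤ) + 1)) + f ((j : ℤ) + 1)) := by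
  induction N with
  | zero => simp
  | succ N ih =>
    have : Finset.Icc (-((N + 1 : ℕ) : ℤ)) ((N + 1 : ℕ) : ℤ)
        = insert (-((N : ℤ) + 1)) (insert ((N : ℤ) + 1) (Finset.Icc (-(N : ℤ)) N)) := by
      ext x
      simp only [Finset.mem_Icc, Finset.mem_insert]
      push_cast
      omega
    rw [this, Finset.sum_insert, Finset.sum_insert, ih, Finset.sum_range_succ]
    · abel
    · simp
    · simp only [Finset.mem_insert, Finset.mem_Icc]
      omega

/-- The Mittag-Leffler expansion of the cotangent at y / 2π, rescaled by 1 / 2π. -/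
theorem tendsto_powSum_one {y : ℝ} (hy : y ∈ offLattice) :
    Tendsto (fun N => powSum 1 N y) atTop (𝓝 (Complex.I * dcot y)) := by
  have hpi : (Real.pi : ℂ) ≠ 0 := by exact_mod_cast Real.pi_ne_zero
  have hx : (y : ℂ) / (2 * Real.pi) ∈ Complex.integerComplement := by
    rw [Complex.mem_integerComplement_iff]
    rintro ⟨k, hk⟩
    refine hy k ?_
    rw [eq_div_iff (by simp)] at hk
    have : (y : ℂ) = 2 * Real.pi * k := by rw [← hk]; ring
    exact_mod_cast this
  have h1 := ((tendsto_logDeriv_euler_cot_sub hx).const_add (1 / ((y : ℂ) / (2 * Real.pi)))).const_mul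
    ((2 * Real.pi : ℂ)⁻¹)
  have hlim : (2 * Real.pi : ℂ)⁻¹ * (1 / ((y : ℂ) / (2 * Real.pi)) + (Real.pi *
      Complex.cot (Real.pi * ((y : ℂ) / (2 * Real.pi))) - 1 / ((y : ℂ) / (2 * Real.pi))))
      = Complex.I * dcot y := by
    rw [add_sub_cancel, Complex.cot_pi_eq_exp_ratio, dcot]
    have e : 2 * (Real.pi : ℂ) * Complex.I * ((y : ℂ) / (2 * Real.pi)) = Complex.I * y := by
      field_simp
    rw [e]
    have h2 := sub_ne_zero.mpr (exp_ne_one hy)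
    have h3 : 1 - Complex.exp (Complex.I * y) ≠ 0 := by
      rw [← neg_sub]; exact neg_ne_zero.mpr h2
    field_simp
    rw [Complex.I_sq]
    ring
  rw [hlim] at h1
  refine h1.congr fun N => ?_
  rw [powSum, sum_Icc_neg_int, mul_add, Finset.mul_sum]
  have h0 := add_ne_zero_of_offLattice hy
  have h0' : ∀ k : ℤ, (y : ℂ) + 2 * Real.pi * k ≠ 0 := fun k => by exact_mod_cast h0 k
  have key : ∀ k : ℤ, (2 * Real.pi : ℂ)⁻¹ * (1 / ((y : ℂ) / (2 * Real.pi) + k))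
      = (((y + 2 * Real.pi * k : ℝ) : ℂ) ^ 1)⁻¹ := by
    intro k
    have e : (y : ℂ) / (2 * Real.pi) + k = (y + 2 * Real.pi * k) / (2 * Real.pi) := by
      field_simp
    rw [e, pow_one, one_div_div]
    push_cast
    have := h0' k
    field_simp
  congr 1
  · have := key 0
    rw [Int.cast_zero, add_zero] at this
    rw [this]
  · refine Finset.sum_congr rfl fun j _ => ?_
    rw [← key, ← key, ← mul_add]
    push_cast
    rw [← sub_eq_add_neg]

/-- The sinc bound divided by |sin(y/2)|, which is unchanged by y ↦ y + 2πk. -/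
theorem inv_add_le {y B η : ℝ} (hB : |y| ≤ B) (hη : 0 < η) (h : η ≤ |Real.sin (y / 2)|) (k : ℤ) :
    |(y + 2 * Real.pi * k)⁻¹| ≤ (2 + B) / (2 * η) * wt k := by
  have hy : y ∈ offLattice := mem_offLattice_iff_sin.mpr fun h0 => by
    rw [h0, abs_zero] at h; linarith
  have h0 := add_ne_zero_of_offLattice hy k
  have h1 := abs_sinc_le_wt hB k
  have h2 : (y + 2 * Real.pi * k) / 2 ≠ 0 := by simpa using h0
  have h3 : |Real.sin ((y + 2 * Real.pi * k) / 2)| = |Real.sin (y / 2)| := by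
    have e : (y + 2 * Real.pi * k) / 2 = y / 2 + k * Real.pi := by ring
    rw [e, Real.sin_add_int_mul_pi, abs_mul, abs_zpow, abs_neg, abs_one, one_zpow, one_mul]
  rw [Real.sinc_of_ne_zero h2, abs_div, h3, abs_div, abs_two] at h1
  have h4 : |(y + 2 * Real.pi * k)⁻¹| * (2 * η)
      ≤ |Real.sin (y / 2)| / (|y + 2 * Real.pi * k| / 2) := by
    rw [abs_inv, div_div_eq_mul_div, ← div_eq_inv_mul]
    exact div_le_div_of_nonneg_right (by linarith) (abs_nonneg _)
  rw [div_mul_eq_mul_div, le_div_iff₀ (by positivity)]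
  exact h4.trans h1

theorem tendsto_Icc_neg : Tendsto (fun N : ℕ => Finset.Icc (-(N : ℤ)) N) atTop atTop := by
  refine tendsto_atTop_finset_of_monotone ?_ ?_
  · intro a b hab
    exact Finset.Icc_subset_Icc (by simpa using hab) (by simpa using hab)
  · intro p
    exact ⟨p.natAbs, Finset.mem_Icc.mpr (by omega)⟩

/-- Term-by-term differentiation. The derived series has exponent at least 2 and converges uniformly
near `x`; the original sums need only converge pointwise, so a = 1 with its symmetric partial sums
is allowed. -/
theorem tendsto_powSum_succ {a : ℕ} (ha : 1 ≤ a) {G : ℝ → ℂ} {G' : ℂ} {x : ℝ} (hx : x ∈ offLattice)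
    (hG : ∀ y ∈ offLattice, Tendsto (fun N => powSum a N y) atTop (𝓝 (G y)))
    (hG' : HasDerivAt G G' x) :
    Tendsto (fun N => powSum (a + 1) N x) atTop (𝓝 (-(1 / (a : ℂ)) * G')) := by
  have hsin : 0 < |Real.sin (x / 2)| := abs_pos.mpr (mem_offLattice_iff_sin.mp hx)
  -- A neighbourhood on which y stays bounded and away from 2πℤ, so that `inv_add_le` applies with
  -- one constant.
  let U : Set ℝ := {y | |Real.sin (x / 2)| / 2 ≤ |Real.sin (y / 2)| ∧ |y| ≤ |x| + 1}
  have hU : U ∈ 𝓝 x := by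
    have h1 : ∀ᶠ y in 𝓝 x, |Real.sin (x / 2)| / 2 < |Real.sin (y / 2)| := by
      have : ContinuousAt (fun y : ℝ => |Real.sin (y / 2)|) x := by fun_prop
      exact this.eventually (lt_mem_nhds (by linarith))
    have h2 : ∀ᶠ y in 𝓝 x, |y| < |x| + 1 :=
      (continuous_abs.continuousAt (x := x)).eventually (gt_mem_nhds (by linarith))
    filter_upwards [h1, h2] with y hy1 hy2 using ⟨hy1.le, hy2.le⟩
  have hUoff : U ⊆ offLattice := fun y hy => mem_offLattice_iff_sin.mpr fun h0 => by
    have := hy.1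
    rw [h0, abs_zero] at this
    linarith
  let f : ℤ → ℝ → ℂ := fun s y => -(a : ℂ) * (((y + 2 * Real.pi * s : ℝ) : ℂ) ^ (a + 1))⁻¹
  let C : ℝ := (2 + (|x| + 1)) / (2 * (|Real.sin (x / 2)| / 2))
  have hsum : Summable fun s : ℤ => a * (C ^ (a + 1) * wt s ^ (2 : ℝ)) :=
    ((summable_wt_rpow (by norm_num)).mul_left _).mul_left _
  have hbound : ∀ s, ∀ y ∈ U, ‖f s y‖ ≤ a * (C ^ (a + 1) * wt s ^ (2 : ℝ)) := by
    intro s y hy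
    have h1 := inv_add_le hy.2 (half_pos hsin) hy.1 s
    have h2 : ‖f s y‖ = a * |(y + 2 * Real.pi * s)⁻¹| ^ (a + 1) := by
      simp only [f]
      rw [norm_mul, norm_neg, Complex.norm_natCast, norm_inv, norm_pow, Complex.norm_real,
        Real.norm_eq_abs, abs_inv, inv_pow]
    rw [h2]
    refine mul_le_mul_of_nonneg_left ?_ (Nat.cast_nonneg a)
    have h3 := pow_le_pow_left₀ (abs_nonneg _) h1 (a + 1)
    rw [mul_pow] at h3
    refine h3.trans ?_
    have hC : 0 ≤ C := by positivity
    refine mul_le_mul_of_nonneg_left ?_ (pow_nonneg hC _)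
    rw [Real.rpow_two]
    exact pow_le_pow_of_le_one (wt_pos s).le (wt_le_one s) (by omega)
  have hunif : TendstoUniformlyOn (fun N : ℕ => fun y => ∑ s ∈ Finset.Icc (-(N : ℤ)) N, f s y)
      (fun y => ∑' s, f s y) atTop U := fun v hv =>
    tendsto_Icc_neg.eventually (tendstoUniformlyOn_tsum hsum hbound v hv)
  have hderiv := hasDerivAt_of_tendstoUniformlyOnFilter (f := fun N y => powSum a N y) (g := G)
    (hunif.tendstoUniformlyOnFilter.mono_right (le_principal_iff.mpr hU)) ?_
    (eventually_of_mem hU fun y hy => hG y (hUoff hy))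
  · have he := hderiv.unique hG'
    have hx' : x ∈ U := mem_of_mem_nhds hU
    have h1 := (hunif.tendsto_at hx').const_mul (-(1 / (a : ℂ)))
    rw [he] at h1
    refine h1.congr fun N => ?_
    rw [powSum, Finset.mul_sum]
    refine Finset.sum_congr rfl fun s _ => ?_
    have ha' : (a : ℂ) ≠ 0 := by exact_mod_cast (by omega : a ≠ 0)
    simp only [f]
    rw [← mul_assoc]
    field_simp
  · refine (eventually_of_mem (prod_mem_prod univ_mem hU) ?_)
    rintro ⟨N, y⟩ ⟨-, hy⟩
    have hy' := hUoff hy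
    refine HasDerivAt.fun_sum fun s _ => ?_
    have h0 : (((y + 2 * Real.pi * s : ℝ) : ℂ)) ≠ 0 := by
      exact_mod_cast add_ne_zero_of_offLattice hy' s
    have h1 : HasDerivAt (fun y : ℝ => ((y + 2 * Real.pi * s : ℝ) : ℂ)) 1 y := by
      simpa using ((hasDerivAt_id y).add_const (2 * Real.pi * s)).ofReal_comp
    have h2 := (h1.pow a).inv (pow_ne_zero a h0)
    convert! h2 using 1
    simp only [f]
    obtain ⟨b, rfl⟩ : ∃ b, a = b + 1 := ⟨a - 1, by omega⟩
    simp only [Pi.pow_apply, add_tsub_cancel_right]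
    field_simp
    ring

/-- Each differentiation multiplies by i through the Riccati equation; splitting off i^a keeps the
coefficients rational. -/
theorem exists_powSum_poly {a : ℕ} (ha : 1 ≤ a) : ∃ q : Polynomial ℚ, ∀ y ∈ offLattice,
    Tendsto (fun N => powSum a N y) atTop (𝓝 (Complex.I ^ a * Polynomial.aeval (dcot y) q)) := by
  induction a, ha using Nat.le_induction with
  | base => exact ⟨Polynomial.X, fun y hy => by simpa using tendsto_powSum_one hy⟩
  | succ a ha ih =>
    obtain ⟨q, hq⟩ := ih
    refine ⟨-(Polynomial.C (1 / (a : ℚ)) * (Polynomial.C (1 / 4) - Polynomial.X ^ 2)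
      * Polynomial.derivative q), fun y hy => ?_⟩
    have h1 := ((Polynomial.hasDerivAt_aeval q (dcot y)).comp y (hasDerivAt_dcot hy)).const_mul
      (Complex.I ^ a)
    have h2 := tendsto_powSum_succ ha hy hq h1
    convert h2 using 2
    simp only [map_neg, map_mul, map_sub, map_pow, Polynomial.aeval_C, Polynomial.aeval_X]
    simp
    ring

/-! ### Partial fractions in one variable. -/

/-- A product of negative powers of the differences `X - y_j` and `y_i - y_j`. -/
def invProd {n : ℕ} (f : Fin n → ℕ) (b : Fin n → Fin n → ℕ) (X : ℝ) (y : Fin n → ℝ) : ℂ :=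
  (∏ j, (((X - y j : ℝ) : ℂ) ^ f j)⁻¹) *
    ∏ i, ∏ j ∈ Finset.Ioi i, (((y i - y j : ℝ) : ℂ) ^ b i j)⁻¹

/-- The exponents `b` with the one of `y_j - y_k` increased. -/
def bump {n : ℕ} (b : Fin n → Fin n → ℕ) (j k : Fin n) : Fin n → Fin n → ℕ :=
  fun i l => b i l + if i = j ∧ l = k then 1 else 0

/-- The total exponent over the pairs `i < j`. -/
def pairDeg {n : ℕ} (b : Fin n → Fin n → ℕ) : ℕ := ∑ i, ∑ j ∈ Finset.Ioi i, b i j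

theorem pairDeg_bump {n : ℕ} (b : Fin n → Fin n → ℕ) {j k : Fin n} (hjk : j < k) :
    pairDeg (bump b j k) = pairDeg b + 1 := by
  simp only [pairDeg, bump, Finset.sum_add_distrib, ite_and]
  congr 1
  rw [Finset.sum_eq_single j]
  · simp [hjk]
  · intro i _ hi; simp [hi]
  · simp

theorem prod_bump {n : ℕ} (b : Fin n → Fin n → ℕ) {j k : Fin n} (hjk : j < k) (y : Fin n → ℝ) :
    ∏ i, ∏ l ∈ Finset.Ioi i, (((y i - y l : ℝ) : ℂ) ^ bump b j k i l)⁻¹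
      = (∏ i, ∏ l ∈ Finset.Ioi i, (((y i - y l : ℝ) : ℂ) ^ b i l)⁻¹)
        * ((y j - y k : ℝ) : ℂ)⁻¹ := by
  simp only [bump, pow_add, mul_inv, Finset.prod_mul_distrib]
  congr 1
  rw [Finset.prod_eq_single j]
  · rw [Finset.prod_eq_single k]
    · simp
    · intro l _ hl; simp [hl]
    · simp [hjk]
  · intro i _ hi; simp [hi]
  · simp

theorem prod_add_single {n : ℕ} (g : Fin n → ℕ) (j : Fin n) (X : ℝ) (y : Fin n → ℝ) :
    ∏ l, (((X - y l : ℝ) : ℂ) ^ (g + Pi.single j 1 : Fin n → ℕ) l)⁻¹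
      = (∏ l, (((X - y l : ℝ) : ℂ) ^ g l)⁻¹) * ((X - y j : ℝ) : ℂ)⁻¹ := by
  simp only [Pi.add_apply, pow_add, mul_inv, Finset.prod_mul_distrib]
  congr 1
  rw [Finset.prod_eq_single j]
  · simp
  · intro l _ hl; simp [hl]
  · simp

/-- From 1/((X - y_j)(X - y_k)) = (1/(X - y_j) - 1/(X - y_k)) / (y_j - y_k). One pole order in X is
traded for one in y_j - y_k, and the total exponent is conserved. -/
theorem invProd_eq_sub {n : ℕ} (g : Fin n → ℕ) (b : Fin n → Fin n → ℕ) {j k : Fin n} (hjk : j < k)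
    {X : ℝ} {y : Fin n → ℝ} (hy : Function.Injective y) (hX : ∀ j, X ≠ y j) :
    invProd (g + Pi.single j 1 + Pi.single k 1) b X y
      = invProd (g + Pi.single j 1) (bump b j k) X y
        - invProd (g + Pi.single k 1) (bump b j k) X y := by
  have h1 : ((X - y j : ℝ) : ℂ) ≠ 0 := by exact_mod_cast sub_ne_zero.mpr (hX j)
  have h2 : ((X - y k : ℝ) : ℂ) ≠ 0 := by exact_mod_cast sub_ne_zero.mpr (hX k)
  have h3 : ((y j - y k : ℝ) : ℂ) ≠ 0 := by
    exact_mod_cast sub_ne_zero.mpr (hy.ne hjk.ne)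
  simp only [invProd, prod_bump b hjk, prod_add_single]
  have key : ((X - y j : ℝ) : ℂ)⁻¹ * ((X - y k : ℝ) : ℂ)⁻¹
      = (((X - y j : ℝ) : ℂ)⁻¹ - ((X - y k : ℝ) : ℂ)⁻¹) * ((y j - y k : ℝ) : ℂ)⁻¹ := by
    field_simp
    push_cast
    ring
  rw [mul_assoc (∏ l, _), key]
  ring

/-- Partial fractions: a property of functions of `X` and `y` that is stable under differences holds
for products of negative powers if it holds for those with one single pole in `X`. -/
theorem invProd_induction {n : ℕ} (Φ : (ℝ → (Fin n → ℝ) → ℂ) → Prop) (K : ℕ)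
    (hcongr : ∀ F F' : ℝ → (Fin n → ℝ) → ℂ, (∀ X y, Function.Injective y → (∀ j, X ≠ y j) →
      F X y = F' X y) → Φ F → Φ F')
    (hsub : ∀ F F' : ℝ → (Fin n → ℝ) → ℂ, Φ F → Φ F' → Φ fun X y => F X y - F' X y)
    (hgen : ∀ (j : Fin n) (a : ℕ) (b : Fin n → Fin n → ℕ), a + 1 + pairDeg b = K →
      (n = 2 → ∃ i j, i < j ∧ 1 ≤ b i j) → Φ (invProd (Pi.single j (a + 1)) b))
    (N : ℕ) (f : Fin n → ℕ) (b : Fin n → Fin n → ℕ) (hN : ∑ j, f j = N + 1)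
    (hK : ∑ j, f j + pairDeg b = K)
    (hc : n = 2 → (∃ i j, i < j ∧ 1 ≤ b i j) ∨ ∀ j, 1 ≤ f j) : Φ (invProd f b) := by
  -- `N + 1` is the total pole order in X, which each reduction lowers by one.
  induction N generalizing f b with
  | zero =>
    obtain ⟨j, hj⟩ : ∃ j, f j ≠ 0 := by
      by_contra! h
      simp [h] at hN
    have hk : ∀ k, k ≠ j → f k = 0 := by
      intro k hk
      by_contra h
      have : f j + f k ≤ ∑ j, f j := by
        rw [← Finset.sum_pair hk.symm]
        exact Finset.sum_le_sum_of_subset (Finset.subset_univ _)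
      omega
    have hf : f = Pi.single j (f j) := by
      ext k
      by_cases h : k = j
      · subst h; simp
      · simp [h, hk k h]
    have hs : ∑ k, f k = f j := by
      rw [hf]; simp
    obtain ⟨a, ha⟩ : ∃ a, f j = a + 1 := ⟨f j - 1, by omega⟩
    rw [ha] at hf hs
    rw [hf]
    refine hgen j a b (by omega) fun h2 => (hc h2).resolve_right fun hall => ?_
    subst h2
    have h0 := hall 0
    have h1 := hall 1
    rw [Fin.sum_univ_two] at hN
    omega
  | succ N ih =>
    by_cases hone : ∃ j, ∀ k, k ≠ j → f k = 0
    · obtain ⟨j, hk⟩ := hone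
      have hf : f = Pi.single j (f j) := by
        ext k
        by_cases h : k = j
        · subst h; simp
        · simp [h, hk k h]
      have hs : ∑ k, f k = f j := by
        rw [hf]; simp
      obtain ⟨a, ha⟩ : ∃ a, f j = a + 1 := ⟨f j - 1, by omega⟩
      rw [ha] at hf hs
      rw [hf]
      refine hgen j a b (by omega) fun h2 => (hc h2).resolve_right fun hall => ?_
      subst h2
      rcases (by omega : j = 0 ∨ j = 1) with rfl | rfl
      · have := hall 1; have := hk 1 (by simp); omega
      · have := hall 0; have := hk 0 (by simp); omega
    · push Not at hone
      obtain ⟨j₀, hj₀⟩ : ∃ j, f j ≠ 0 := by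
        by_contra! h
        simp [h] at hN
      obtain ⟨j, k, hjk, hj, hk⟩ : ∃ j k, j < k ∧ f j ≠ 0 ∧ f k ≠ 0 := by
        obtain ⟨k, hk, hk0⟩ := hone j₀
        rcases lt_or_gt_of_ne hk with h | h
        · exact ⟨k, j₀, h, hk0, hj₀⟩
        · exact ⟨j₀, k, h, hj₀, hk0⟩
      obtain ⟨g, rfl⟩ : ∃ g : Fin n → ℕ, f = g + Pi.single j 1 + Pi.single k 1 := by
        refine ⟨fun l => f l - (Pi.single j 1 : Fin n → ℕ) l - (Pi.single k 1 : Fin n → ℕ) l, ?_⟩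
        ext l
        simp only [Pi.add_apply, Pi.single_apply]
        by_cases h1 : l = j
        · subst h1
          have : l ≠ k := hjk.ne
          simp [this]; omega
        · by_cases h2 : l = k
          · subst h2; simp [h1]; omega
          · simp [h1, h2]
      have hsum : ∀ (g : Fin n → ℕ) (j : Fin n), ∑ l, (g + Pi.single j 1 : Fin n → ℕ) l = ∑ l, g l + 1 := by
        intro g j
        simp [Finset.sum_add_distrib]
      rw [hsum, hsum] at hN hK
      -- The raised exponent is the extra decay that the remaining one-dimensional sum needs when n
      -- = 2.
      have hb : ∃ i l, i < l ∧ 1 ≤ bump b j k i l := ⟨j, k, hjk, by simp [bump]⟩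
      refine hcongr _ _ (fun X y hy hX => (invProd_eq_sub g b hjk hy hX).symm) (hsub _ _ ?_ ?_)
      · exact ih _ _ (by rw [hsum]; omega) (by rw [hsum, pairDeg_bump b hjk]; omega)
          fun _ => Or.inl hb
      · exact ih _ _ (by rw [hsum]; omega) (by rw [hsum, pairDeg_bump b hjk]; omega)
          fun _ => Or.inl hb

/-! ### Periodization of products of negative powers of the gaps. -/

/-- `∏_{i<j} (u_i + ⋯ + u_{j-1})^{-(e_{ij} + 1)}`. -/
def gapTerm {m : ℕ} (e : Fin (m + 1) → Fin (m + 1) → ℕ) (u : Fin m → ℝ) : ℂ :=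
  ∏ i, ∏ j ∈ Finset.Ioi i, (((coord u i - coord u j : ℝ) : ℂ) ^ (e i j + 1))⁻¹

/-- The values of `dcot` at the differences of the coordinates. -/
def dval {m : ℕ} (u : Fin m → ℝ) (q : Fin (m + 1) × Fin (m + 1)) : ℂ :=
  dcot (coord u q.1 - coord u q.2)

theorem sub_mem_offLattice {m : ℕ} {u : Fin m → ℝ} (hu : u ∈ regular (m + 1)) {i j : Fin (m + 1)}
    (hij : i ≠ j) : coord u i - coord u j ∈ offLattice :=
  (mem_regular_iff_int u).mp hu i j hij

theorem norm_gapTerm_shift_le {m : ℕ} (e : Fin (m + 1) → Fin (m + 1) → ℕ) {u : Fin m → ℝ}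
    (hu : u ∈ regular (m + 1)) : ∃ C : ℝ, ∀ p : Fin m → ℤ,
      ‖gapTerm (m := m) e (shift (m + 1) u p)‖ ≤
        C * ∏ i, ∏ j ∈ Finset.Ioi i, wt (coord p i - coord p j) ^ (e i j + 1) := by
  let c : Fin (m + 1) → Fin (m + 1) → ℝ := fun i j =>
    (2 + |coord u i - coord u j|) / (2 * |Real.sin ((coord u i - coord u j) / 2)|)
  refine ⟨∏ i, ∏ j ∈ Finset.Ioi i, c i j ^ (e i j + 1), fun p => ?_⟩
  rw [gapTerm, norm_prod, ← Finset.prod_mul_distrib]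
  refine Finset.prod_le_prod (fun _ _ => norm_nonneg _) fun i _ => ?_
  rw [norm_prod, ← Finset.prod_mul_distrib]
  refine Finset.prod_le_prod (fun _ _ => norm_nonneg _) fun j hj => ?_
  have hij : i ≠ j := (Finset.mem_Ioi.mp hj).ne
  have h := inv_add_le le_rfl (abs_pos.mpr ((mem_regular_iff_sin u).mp hu i j hij)) le_rfl
    (coord p i - coord p j)
  have e1 : coord (shift (m + 1) u p : Fin m → ℝ) i - coord (shift (m + 1) u p : Fin m → ℝ) j
      = coord u i - coord u j + 2 * Real.pi * ((coord p i - coord p j : ℤ) : ℝ) := by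
    rw [coord_shift, coord_shift]
    push_cast
    ring
  rw [e1, norm_inv, norm_pow, Complex.norm_real, Real.norm_eq_abs, ← inv_pow, ← mul_pow, ← abs_inv]
  exact pow_le_pow_left₀ (abs_nonneg _) h _

/-- For m ≥ 2 simple poles already suffice, by `summable_wtProd`. For m = 1 a single gap remains,
and its exponent must be at least 2. -/
theorem summable_gapTerm {m : ℕ} (hm : 1 ≤ m) (e : Fin (m + 1) → Fin (m + 1) → ℕ)
    (he : m = 1 → ∃ i j, i < j ∧ 1 ≤ e i j) {u : Fin m → ℝ} (hu : u ∈ regular (m + 1)) :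
    Summable fun p : Fin m → ℤ => gapTerm (m := m) e (shift (m + 1) u p) := by
  obtain ⟨C, hC⟩ := norm_gapTerm_shift_le e hu
  refine Summable.of_norm_bounded (Summable.mul_left C ?_) hC
  rcases (by omega : m = 1 ∨ 2 ≤ m) with rfl | hm
  · obtain ⟨i, j, hij, h⟩ := he rfl
    have hij' : i.val < j.val := hij
    obtain rfl : i = 0 := Fin.ext (by rw [Fin.val_zero]; omega)
    obtain rfl : j = 1 := Fin.ext (by rw [Fin.val_one]; omega)
    have h2 : Summable fun p : Fin 1 → ℤ => wt (p 0) ^ (2 : ℝ) :=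
      (Equiv.funUnique (Fin 1) ℤ).summable_iff.mpr
        (summable_wt_rpow (by norm_num : (1 : ℝ) < 2))
    refine Summable.of_nonneg_of_le (fun p => Finset.prod_nonneg fun _ _ =>
      Finset.prod_nonneg fun _ _ => (pow_pos (wt_pos _) _).le) (fun p => ?_) h2
    have i0 : Finset.Ioi (0 : Fin 2) = {1} := by decide
    have i1 : Finset.Ioi (1 : Fin 2) = ∅ := by decide
    have e1 : coord p (1 : Fin 2) = 0 := coord_last p
    have e0 : coord p (0 : Fin 2) = p 0 := by simp [coord]
    rw [Fin.prod_univ_two, i0, i1, Finset.prod_singleton, Finset.prod_empty, mul_one, e1, e0,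
      sub_zero, Real.rpow_two]
    exact pow_le_pow_of_le_one (wt_pos _).le (wt_le_one _) (by omega)
  · refine Summable.of_nonneg_of_le (fun p => Finset.prod_nonneg fun _ _ =>
      Finset.prod_nonneg fun _ _ => (pow_pos (wt_pos _) _).le) (fun p => ?_) (summable_wtProd hm)
    refine Finset.prod_le_prod (fun _ _ => Finset.prod_nonneg fun _ _ =>
      (pow_pos (wt_pos _) _).le) fun i _ => ?_
    refine Finset.prod_le_prod (fun _ _ => (pow_pos (wt_pos _) _).le) fun j _ => ?_
    exact pow_le_of_le_one (wt_pos _).le (wt_le_one _) (Nat.succ_ne_zero _)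

theorem coord_eq_tail {R : Type*} [AddCommMonoid R] {m : ℕ} (u : Fin (m + 1) → R) :
    coord u 0 = u 0 + coord (Fin.tail u) 0 ∧ ∀ j, coord u (Fin.succ j) = coord (Fin.tail u) j := by
  conv => enter [1, 1, 1]; rw [← Fin.cons_self_tail u]
  refine ⟨coord_cons_zero _ _, fun j => ?_⟩
  conv_lhs => rw [← Fin.cons_self_tail u]
  exact coord_cons_succ _ _ _

theorem tail_mem_regular {m : ℕ} {u : Fin (m + 1) → ℝ} (hu : u ∈ regular (m + 2)) :
    (Fin.tail u : Fin m → ℝ) ∈ regular (m + 1) := by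
  refine (mem_regular_iff_int (m := m) _).mpr fun i j hij k => ?_
  rw [← (coord_eq_tail u).2, ← (coord_eq_tail u).2]
  exact (mem_regular_iff_int (m := m + 1) u).mp hu _ _ ((Fin.succ_injective _).ne hij) k

theorem coord_injective {m : ℕ} {u : Fin m → ℝ} (hu : u ∈ regular (m + 1)) :
    Function.Injective (coord u) := by
  have := deltaTilde_ne_zero hu
  rwa [deltaTilde_eq, vand_ne_zero_iff] at this

/-- Isolates the first lattice coordinate `s`, which enters only through X. One power of every
remaining gap is set aside in `gapTerm 0`, so that whatever exponents partial fractions produce, the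
rest is again a `gapTerm`. -/
theorem gapTerm_shift_cons {m : ℕ} (e : Fin (m + 2) → Fin (m + 2) → ℕ) (u : Fin (m + 1) → ℝ)
    (s : ℤ) (q : Fin m → ℤ) :
    gapTerm (m := m + 1) e (shift (m + 2) u (Fin.cons s q : Fin (m + 1) → ℤ))
      = invProd (fun j => e 0 j.succ + 1) (fun i j => e i.succ j.succ)
          (u 0 + coord (shift (m + 1) (Fin.tail u : Fin m → ℝ) q : Fin m → ℝ) 0 + 2 * Real.pi * s)
          (coord (shift (m + 1) (Fin.tail u : Fin m → ℝ) q : Fin m → ℝ))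
        * gapTerm (m := m) 0 (shift (m + 1) (Fin.tail u : Fin m → ℝ) q) := by
  obtain ⟨w, hw⟩ : ∃ w : Fin (m + 1) → ℝ,
      w = shift (m + 2) u (Fin.cons s q : Fin (m + 1) → ℤ) := ⟨_, rfl⟩
  obtain ⟨h0, h1⟩ := coord_eq_tail w
  have ht : (Fin.tail w : Fin m → ℝ) = shift (m + 1) (Fin.tail u : Fin m → ℝ) q := by
    rw [hw]; rfl
  rw [ht] at h0
  simp only [ht] at h1
  have h2 : w 0 = u 0 + 2 * Real.pi * s := by
    rw [hw]
    change u 0 + (s : ℝ) * (2 * Real.pi) = _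
    ring
  rw [← hw]
  rw [h2, add_right_comm (u 0)] at h0
  obtain ⟨v, hv⟩ : ∃ v : Fin m → ℝ, v = shift (m + 1) (Fin.tail u : Fin m → ℝ) q := ⟨_, rfl⟩
  rw [← hv] at h0 ⊢
  simp only [← hv] at h1
  have hc : (∏ i, ∏ j ∈ Finset.Ioi i, (((coord v i - coord v j : ℝ) : ℂ) ^ e i.succ j.succ)⁻¹)
      * gapTerm 0 v = gapTerm (fun i j => e i.succ j.succ) v := by
    unfold gapTerm
    rw [← Finset.prod_mul_distrib]
    refine Finset.prod_congr rfl fun i _ => ?_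
    rw [← Finset.prod_mul_distrib]
    refine Finset.prod_congr rfl fun j _ => ?_
    simp [pow_succ, mul_comm]
  rw [invProd, mul_assoc, hc]
  unfold gapTerm
  rw [Fin.prod_univ_succ, Fin.prod_Ioi_zero]
  simp only [Fin.prod_Ioi_succ, h1, h0]

/-- The periodization of a product of negative powers of all the gaps is, up to a power of `i`, a
polynomial with rational coefficients in the `dcot (x_i - x_j)`. -/
theorem hasSum_gapTerm (m : ℕ) (e : Fin (m + 1) → Fin (m + 1) → ℕ)
    (he : m = 1 → ∃ i j, i < j ∧ 1 ≤ e i j) :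
    ∃ P : MvPolynomial (Fin (m + 1) × Fin (m + 1)) ℚ, ∀ u : Fin m → ℝ, u ∈ regular (m + 1) →
      HasSum (fun p : Fin m → ℤ => gapTerm (m := m) e (shift (m + 1) u p))
        (Complex.I ^ (pairDeg fun i j => e i j + 1) * MvPolynomial.aeval (dval u) P) := by
  induction m with
  | zero =>
    refine ⟨1, fun u _ => ?_⟩
    have h : (Complex.I ^ (pairDeg fun i j => e i j + 1) * MvPolynomial.aeval (dval u)
        (1 : MvPolynomial (Fin 1 × Fin 1) ℚ)) = ∑ p : Fin 0 → ℤ,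
          gapTerm (m := 0) e (shift (0 + 1) u p) := by
      simp [pairDeg, gapTerm]
    rw [h]
    exact hasSum_fintype _
  | succ m ih =>
    let K := pairDeg (fun i j => e i j + 1)
    let d := pairDeg (fun _ _ : Fin (m + 1) => 1)
    let f₀ : Fin (m + 1) → ℕ := fun j => e 0 j.succ + 1
    let b₀ : Fin (m + 1) → Fin (m + 1) → ℕ := fun i j => e i.succ j.succ
    have hdeg : ∀ b : Fin (m + 1) → Fin (m + 1) → ℕ,
        pairDeg (fun i j => b i j + 1) = pairDeg b + d := by
      intro b; simp only [pairDeg, d, Finset.sum_add_distrib]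
    have hK : K = ∑ j, f₀ j + pairDeg b₀ + d := by
      rw [add_assoc, ← hdeg]
      simp only [K, pairDeg, f₀, b₀]
      rw [Fin.sum_univ_succ, Fin.sum_Ioi_zero]
      simp only [Fin.sum_Ioi_succ]
    let V : (Fin (m + 1) → ℝ) → (Fin m → ℤ) → (Fin m → ℝ) := fun u q =>
      shift (m + 1) (Fin.tail u : Fin m → ℝ) q
    have hV : ∀ u ∈ regular (m + 2), ∀ q, V u q ∈ regular (m + 1) := fun u hu q =>
      shift_mem_regular (tail_mem_regular hu) q
    have hX : ∀ (u : Fin (m + 1) → ℝ) (q : Fin m → ℤ) (j : Fin (m + 1)), ∃ k : ℤ,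
        u 0 + coord (V u q) 0 - coord (V u q) j
          = coord u 0 - coord u j.succ + 2 * Real.pi * k := by
      intro u q j
      refine ⟨coord q 0 - coord q j, ?_⟩
      rw [(coord_eq_tail u).1, (coord_eq_tail u).2]
      simp only [V]
      rw [coord_shift (m := m), coord_shift (m := m)]
      push_cast
      ring
    -- Symmetric sums over X give a function G, and summing G against the remaining gaps gives the
    -- required polynomial. Symmetric limits are used because the simple poles created by partial
    -- fractions are not absolutely summable one at a time.
    let Φ : (ℝ → (Fin (m + 1) → ℝ) → ℂ) → Prop := fun F =>
      ∃ G : ℝ → (Fin (m + 1) → ℝ) → ℂ,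
        (∀ X y, Function.Injective y → (∀ j, X - y j ∈ offLattice) →
          Tendsto (fun N : ℕ => ∑ s ∈ Finset.Icc (-(N : ℤ)) N, F (X + 2 * Real.pi * s) y) atTop
            (𝓝 (G X y))) ∧
        ∃ P : MvPolynomial (Fin (m + 2) × Fin (m + 2)) ℚ, ∀ u : Fin (m + 1) → ℝ,
          u ∈ regular (m + 2) →
          HasSum (fun q : Fin m → ℤ =>
            G (u 0 + coord (V u q) 0) (coord (V u q)) * gapTerm 0 (V u q))
            (Complex.I ^ K * MvPolynomial.aeval (dval u) P)
    have hΦ : Φ (invProd f₀ b₀) := by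
      refine invProd_induction Φ (∑ j, f₀ j + pairDeg b₀) ?_ ?_ ?_ (∑ j, f₀ j - 1) f₀ b₀ ?_ rfl ?_
      · rintro F F' h ⟨G, hG, hP⟩
        refine ⟨G, fun X y hy hXy => (hG X y hy hXy).congr fun N => ?_, hP⟩
        refine Finset.sum_congr rfl fun s _ => h _ _ hy fun j hj => ?_
        refine add_ne_zero_of_offLattice (hXy j) s ?_
        linarith
      · rintro F F' ⟨G, hG, P, hP⟩ ⟨G', hG', P', hP'⟩
        refine ⟨fun X y => G X y - G' X y, fun X y hy hXy => ?_, P - P', fun u hu => ?_⟩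
        · simp only [Finset.sum_sub_distrib]
          exact (hG X y hy hXy).sub (hG' X y hy hXy)
        · simp only [sub_mul, map_sub, mul_sub]
          exact (hP u hu).sub (hP' u hu)
      · intro j a b hab hb
        -- For a single pole the sum over X is a polynomial in a `dcot` that, by periodicity, does
        -- not depend on the other lattice coordinates. It factors out, and the rest is the
        -- statement in one dimension less.
        obtain ⟨Q, hQ⟩ := ih b (fun h => hb (by omega))
        obtain ⟨q, hq⟩ := exists_powSum_poly (Nat.le_add_left 1 a)
        refine ⟨fun X y => Complex.I ^ (a + 1) * Polynomial.aeval (dcot (X - y j)) q *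
          ∏ i, ∏ l ∈ Finset.Ioi i, (((y i - y l : ℝ) : ℂ) ^ b i l)⁻¹, fun X y hy hXy => ?_,
          Polynomial.aeval (MvPolynomial.X (0, j.succ)) q *
            MvPolynomial.rename (Prod.map Fin.succ Fin.succ) Q, fun u hu => ?_⟩
        · refine ((hq _ (hXy j)).mul_const _).congr fun N => ?_
          rw [powSum, Finset.sum_mul]
          refine Finset.sum_congr rfl fun s _ => ?_
          rw [invProd]
          congr 1
          rw [Finset.prod_eq_single j]
          · rw [Pi.single_eq_same, add_sub_right_comm]
          · intro l _ hl; simp [hl]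
          · simp
        · have h := (hQ _ (tail_mem_regular hu)).mul_left
            (Complex.I ^ (a + 1) * Polynomial.aeval (dcot (coord u 0 - coord u j.succ)) q)
          have h1 : MvPolynomial.aeval (dval u) (MvPolynomial.rename (Prod.map Fin.succ Fin.succ) Q)
              = MvPolynomial.aeval (dval (Fin.tail u)) Q := by
            rw [MvPolynomial.aeval_rename]
            congr 2
            ext p
            simp [dval, (coord_eq_tail u).2]
          have h2 : MvPolynomial.aeval (dval u) (Polynomial.aeval
              (MvPolynomial.X (0, j.succ) : MvPolynomial (Fin (m + 2) × Fin (m + 2)) ℚ) q)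
              = Polynomial.aeval (dcot (coord u 0 - coord u j.succ)) q := by
            rw [← Polynomial.aeval_algHom_apply, MvPolynomial.aeval_X]
            rfl
          have h3 : Complex.I ^ K = Complex.I ^ (a + 1)
              * Complex.I ^ (pairDeg fun i j => b i j + 1) := by
            rw [← pow_add, hdeg, hK, ← hab]
            ring
          rw [map_mul, h1, h2, h3, mul_mul_mul_comm]
          refine Eq.subst (motive := fun F => HasSum F _) (funext fun p => Eq.symm ?_) h
          obtain ⟨k, hk⟩ := hX u p j
          dsimp only
          rw [hk, dcot_add, mul_assoc]
          congr 1
          unfold gapTerm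
          rw [← Finset.prod_mul_distrib]
          refine Finset.prod_congr rfl fun i _ => ?_
          rw [← Finset.prod_mul_distrib]
          refine Finset.prod_congr rfl fun j _ => ?_
          simp [pow_succ, mul_comm, V]
      · have : 1 ≤ f₀ 0 := Nat.le_add_left 1 _
        have := Finset.single_le_sum (f := f₀) (fun _ _ => Nat.zero_le _) (Finset.mem_univ 0)
        omega
      · exact fun _ => Or.inr fun j => Nat.le_add_left 1 _
    obtain ⟨G, hG, P, hP⟩ := hΦ
    refine ⟨P, fun u hu => ?_⟩
    have hs := summable_gapTerm (Nat.le_add_left 1 m) e he hu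
    let E : (Fin m → ℤ) × ℤ ≃ (Fin (m + 1) → ℤ) :=
      (Equiv.prodComm _ _).trans (Fin.consEquiv fun _ : Fin (m + 1) => ℤ)
    have hs' := E.summable_iff.mpr hs
    -- The whole family is absolutely summable, so its fibre sums exist and must agree with the
    -- symmetric limits G.
    have hfib : ∀ q, HasSum (fun s : ℤ => gapTerm (m := m + 1) e (shift (m + 2) u (E (q, s))))
        (G (u 0 + coord (V u q) 0) (coord (V u q)) * gapTerm 0 (V u q)) := by
      intro q
      have h1 : Summable fun s : ℤ => gapTerm (m := m + 1) e (shift (m + 2) u (E (q, s))) :=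
        hs'.prod_factor q
      have h2 := (h1.hasSum).comp tendsto_Icc_neg
      have h3 := (hG (u 0 + coord (V u q) 0) (coord (V u q)) (coord_injective (hV u hu q))
        (fun j => by
          obtain ⟨k, hk⟩ := hX u q j
          rw [hk]
          exact add_mem_offLattice (sub_mem_offLattice hu (Fin.succ_ne_zero j).symm) k)).mul_const
        (gapTerm 0 (V u q))
      have h4 := tendsto_nhds_unique h2 (h3.congr fun N => by
        rw [Finset.sum_mul]
        exact Finset.sum_congr rfl fun s _ => (gapTerm_shift_cons e u s q).symm)
      rw [← h4]
      exact h1.hasSum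
    have h5 := (hs'.hasSum.prod_fiberwise hfib).unique (hP u hu)
    have h6 : ∑' c, ((fun p => gapTerm (m := m + 1) e (shift (m + 2) u p)) ∘ E) c
        = ∑' p : Fin (m + 1) → ℤ, gapTerm (m := m + 1) e (shift (m + 2) u p) :=
      E.tsum_eq fun p : Fin (m + 1) → ℤ => gapTerm (m := m + 1) e (shift (m + 2) u p)
    rw [← h5]
    exact (congrArg (HasSum _) h6).mpr hs.hasSum

/-! ### D̂ as a polynomial in cotangents, and R̂ on regular points. -/

section

variable {m : ℕ}

theorem gapTerm_zero (u : Fin m → ℝ) : gapTerm 0 u = ((1 / deltaTilde (m + 1) u : ℝ) : ℂ) := by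
  rw [deltaTilde_eq, gapTerm, vand]
  simp

theorem deltaTilde_two (v : Fin 1 → ℝ) : deltaTilde (1 + 1) v = v 0 := by
  have i0 : Finset.Ioi (0 : Fin 2) = {1} := by decide
  have i1 : Finset.Ioi (1 : Fin 2) = ∅ := by decide
  have e0 : coord v 0 = v 0 := by simp [coord]
  have e1 : coord v 1 = 0 := coord_last v
  rw [deltaTilde_eq, vand, Fin.prod_univ_two, i0, i1, Finset.prod_singleton, Finset.prod_empty,
    mul_one, e0, e1, sub_zero]

theorem DhatPartial_two (u : Fin 1 → ℝ) (N : ℕ) :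
    ((DhatPartial (1 + 1) u N : ℝ) : ℂ) = powSum 1 N (u 0) := by
  symm
  rw [powSum, DhatPartial]
  push_cast
  refine Finset.sum_bij' (fun s _ => (fun _ => s : Fin 1 → ℤ)) (fun p _ => p 0) ?_ ?_ ?_ ?_ ?_
  · intro s hs
    exact Fintype.mem_piFinset.mpr fun _ => hs
  · intro p hp
    exact Fintype.mem_piFinset.mp hp 0
  · intro s _; rfl
  · intro p _
    ext k
    obtain rfl : k = 0 := Subsingleton.elim (α := Fin 1) _ _
    rfl
  · intro s _
    have e : (shift (1 + 1) u (fun _ => s : Fin 1 → ℤ) : Fin 1 → ℝ) 0 = u 0 + s * (2 * Real.pi) := rfl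
    rw [deltaTilde_two, e, pow_one]
    push_cast
    rw [one_div]
    congr 2
    ring

theorem tendsto_DhatPartial_two {u : Fin 1 → ℝ} (hu : u ∈ regular (1 + 1)) :
    Tendsto (fun N => ((DhatPartial (1 + 1) u N : ℝ) : ℂ)) atTop (𝓝 (Complex.I * dcot (u 0))) := by
  have h0 : u 0 ∈ offLattice := by
    have := sub_mem_offLattice hu (i := 0) (j := 1) (by simp)
    have e0 : coord u 0 = u 0 := by simp [coord]
    have e1 : coord u 1 = 0 := coord_last u
    rwa [e0, e1, sub_zero] at this
  exact (tendsto_powSum_one h0).congr fun N => (DhatPartial_two u N).symm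

/-- For m ≥ 2 this is the case of simple poles in `hasSum_gapTerm`. For m = 1 the series is only a
principal value, and the cotangent expansion is used directly. -/
theorem exists_Dhat_poly (hm : 1 ≤ m) :
    ∃ P : MvPolynomial (Fin (m + 1) × Fin (m + 1)) ℚ, ∀ u : Fin m → ℝ, u ∈ regular (m + 1) →
      Tendsto (DhatPartial (m + 1) u) atTop (𝓝 (Dhat (m + 1) u)) ∧
      (Dhat (m + 1) u : ℂ) = Complex.I ^ ((m + 1) * m / 2) * MvPolynomial.aeval (dval u) P := by
  rcases (by omega : m = 1 ∨ 2 ≤ m) with rfl | hm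
  · refine ⟨MvPolynomial.X (0, 1), fun u hu => ?_⟩
    have h := tendsto_DhatPartial_two hu
    have h1 : Tendsto (DhatPartial (1 + 1) u) atTop (𝓝 (Complex.I * dcot (u 0)).re) :=
      (Complex.continuous_re.tendsto _).comp h
    have h2 : Dhat (1 + 1) u = (Complex.I * dcot (u 0)).re := h1.limUnder_eq
    rw [h2]
    refine ⟨h1, ?_⟩
    have h3 := tendsto_nhds_unique ((Complex.continuous_ofReal.tendsto _).comp h1) h
    have e0 : coord u 0 = u 0 := by simp [coord]
    have e1 : coord u 1 = 0 := coord_last u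
    rw [h3]
    simp [dval, e0, e1]
  · obtain ⟨P, hP⟩ := hasSum_gapTerm m 0 (fun h => by omega)
    refine ⟨P, fun u hu => ⟨?_, ?_⟩⟩
    · exact (hasSum_Dhat hm hu).comp tendsto_box
    · have h1 := Complex.hasSum_ofReal.mpr (hasSum_Dhat hm hu)
      have h2 := hP u hu
      simp only [gapTerm_zero] at h2
      rw [h1.unique h2]
      congr 2
      rw [pairDeg, ← sum_card_Ioi]
      simp

/-- Here D̂ = cot(u/2)/2 and ϖ = 2 sin(u/2). -/
theorem Dhat_mul_varpi_two {u : Fin 1 → ℝ} (hu : u ∈ regular (1 + 1)) :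
    Dhat (1 + 1) u * varpi (1 + 1) u = Real.cos (u 0 / 2) := by
  have h1 : Tendsto (DhatPartial (1 + 1) u) atTop (𝓝 (Complex.I * dcot (u 0)).re) :=
    (Complex.continuous_re.tendsto _).comp (tendsto_DhatPartial_two hu)
  have h2 : Dhat (1 + 1) u = (Complex.I * dcot (u 0)).re := h1.limUnder_eq
  have h3 := tendsto_nhds_unique ((Complex.continuous_ofReal.tendsto _).comp h1)
    (tendsto_DhatPartial_two hu)
  have e0 : coord u 0 = u 0 := by simp [coord]
  have e1 : coord u 1 = 0 := coord_last u
  have i0 : Finset.Ioi (0 : Fin 2) = {1} := by decide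
  have i1 : Finset.Ioi (1 : Fin 2) = ∅ := by decide
  have h4 : varpi (1 + 1) u = 2 * Real.sin (u 0 / 2) := by
    rw [varpi_eq, Fin.prod_univ_two, i0, i1, Finset.prod_singleton, Finset.prod_empty, mul_one, e0,
      e1, sub_zero]
  have h5 : Real.sin (u 0 / 2) ≠ 0 := by
    have := (mem_regular_iff u).mp hu
    rw [h4] at this
    exact right_ne_zero_of_mul this
  have h6 := mem_offLattice_iff_sin.mpr h5
  rw [← Complex.ofReal_inj, Complex.ofReal_mul, h2]
  refine (congrArg (· * ((varpi (1 + 1) u : ℝ) : ℂ)) h3).trans ?_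
  rw [h4, dcot]
  have h7 := sub_ne_zero.mpr (exp_ne_one h6)
  have h8 : Complex.exp (Complex.I * u 0) = Complex.exp (u 0 / 2 * Complex.I) ^ 2 := by
    rw [← Complex.exp_nat_mul]; congr 1; push_cast; ring
  have h9 : Complex.exp (-(u 0 / 2) * Complex.I) = (Complex.exp (u 0 / 2 * Complex.I))⁻¹ := by
    rw [← Complex.exp_neg]; congr 1; ring
  push_cast
  rw [Complex.sin, Complex.cos, h9]
  have h10 := Complex.exp_ne_zero (u 0 / 2 * Complex.I)
  rw [h8] at h7 ⊢
  generalize Complex.exp (u 0 / 2 * Complex.I) = w at *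
  field_simp
  linear_combination (1 - w ^ 2) * (w ^ 2 + 1) * Complex.I_sq

theorem exists_continuous_eq_Dhat_mul_varpi (hm : 1 ≤ m) : ∃ g : (Fin m → ℝ) → ℝ,
    Continuous g ∧ g 0 = 1 ∧ ∀ u ∈ regular (m + 1), Dhat (m + 1) u * varpi (m + 1) u = g u := by
  rcases (by omega : m = 1 ∨ 2 ≤ m) with rfl | hm
  · exact ⟨fun u => Real.cos (u 0 / 2), by fun_prop, by simp, fun u hu => Dhat_mul_varpi_two hu⟩
  · exact ⟨sincSum, continuous_sincSum hm, sincSum_zero, fun u hu => Dhat_mul_varpi hm hu⟩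

theorem Rhat_spec (hm : 1 ≤ m) : Continuous (Rhat (m + 1) : (Fin m → ℝ) → ℝ) ∧
    Rhat (m + 1) (0 : Fin m → ℝ) = 1 ∧ ∀ u : Fin m → ℝ, u ∈ regular (m + 1) →
      Rhat (m + 1) u = Dhat (m + 1) u * varpi (m + 1) u := by
  obtain ⟨g, hg, h0, h⟩ := exists_continuous_eq_Dhat_mul_varpi hm
  have : Rhat (m + 1) = g := extendFrom_eq_of_continuous hg h
  rw [this]
  exact ⟨hg, h0, fun u hu => (h u hu).symm⟩

/-! ### From rational functions of the eigenvalues to polynomials. -/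

/-- The point of the torus with the given angles. -/
def zexp {n : ℕ} (x : Fin n → ℝ) (i : Fin n) : ℂ := Complex.exp (Complex.I * x i)

theorem continuous_zexp {n : ℕ} (i : Fin n) : Continuous fun x : Fin n → ℝ => zexp x i := by
  unfold zexp; fun_prop

theorem continuous_aeval_zexp {n : ℕ} (P : MvPolynomial (Fin n) ℚ) :
    Continuous fun x : Fin n → ℝ => MvPolynomial.aeval (zexp x) P := by
  have := fun i => continuous_zexp (n := n) i
  simp only [MvPolynomial.aeval_def, MvPolynomial.eval₂_eq']
  fun_prop

theorem zexp_angle (u : Fin m → ℝ) : zexp (angle (m + 1) u) = torusEntry (m + 1) u := rfl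

theorem vand_zexp (x : Fin (m + 1) → ℝ) : vand (zexp x) =
    Complex.I ^ ((m + 1) * m / 2) * Complex.exp (Complex.I * (m / 2 * ∑ i, x i : ℝ))
      * (varpi (m + 1) (diff (m := m) x) : ℝ) := vand_exp x

theorem vand_zexp_ne_zero_iff (x : Fin (m + 1) → ℝ) :
    vand (zexp x) ≠ 0 ↔ (diff x : Fin m → ℝ) ∈ regular (m + 1) := by
  have := mem_regular_iff (diff x : Fin m → ℝ)
  rw [this, vand_zexp]
  simp

theorem isOpenMap_diff : IsOpenMap (diff : (Fin (m + 1) → ℝ) → (Fin m → ℝ)) := by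
  let f : (Fin (m + 1) → ℝ) →ₗ[ℝ] (Fin m → ℝ) :=
    { toFun := diff
      map_add' := fun x y => by ext k; simp only [diff, Pi.add_apply]; ring
      map_smul' := fun c x => by ext k; simp [diff, mul_sub] }
  exact f.isOpenMap_of_finiteDimensional fun u => ⟨coord u, diff_coord u⟩

theorem continuous_diff : Continuous (diff : (Fin (m + 1) → ℝ) → (Fin m → ℝ)) := by
  unfold diff; fun_prop

theorem dense_vand_zexp_ne_zero : Dense {x : Fin (m + 1) → ℝ | vand (zexp x) ≠ 0} := by
  simp only [vand_zexp_ne_zero_iff]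
  exact dense_regular.preimage isOpenMap_diff

theorem eq_of_eq_of_vand_ne_zero {f g : (Fin (m + 1) → ℝ) → ℂ} (hf : Continuous f)
    (hg : Continuous g) (h : ∀ x, vand (zexp x) ≠ 0 → f x = g x) : f = g :=
  hf.ext_on dense_vand_zexp_ne_zero hg h

theorem infinite_range_exp : (Set.range fun t : ℝ => Complex.exp (Complex.I * t)).Infinite := by
  refine IsPreconnected.infinite_of_nontrivial (isPreconnected_range (by fun_prop)) ?_
  refine ⟨1, ⟨0, by simp⟩, -1, ⟨Real.pi, ?_⟩, by norm_num⟩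
  dsimp only
  rw [mul_comm, Complex.exp_pi_mul_I]

/-- The unit circle is infinite. The angles must be independent here, which is why the torus of U(n)
is used instead of that of SU(n). -/
theorem eq_zero_of_aeval_zexp {n : ℕ} {P : MvPolynomial (Fin n) ℚ}
    (h : ∀ x, MvPolynomial.aeval (zexp x) P = 0) : P = 0 := by
  refine MvPolynomial.map_injective (algebraMap ℚ ℂ) (algebraMap ℚ ℂ).injective ?_
  rw [map_zero]
  refine MvPolynomial.funext_set (fun _ => Set.range fun t : ℝ => Complex.exp (Complex.I * t))
    (fun _ => infinite_range_exp) fun z hz => ?_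
  have hz' : ∀ i, ∃ t : ℝ, Complex.exp (Complex.I * t) = z i := fun i => hz i (Set.mem_univ i)
  choose x hx using hz'
  have : z = zexp x := by ext i; exact (hx i).symm
  rw [this, map_zero, MvPolynomial.eval_map, ← MvPolynomial.aeval_def]
  exact h x

/-- Modulo X_i - X_j the substitution X_i ↦ X_j is the identity. -/
theorem X_sub_X_dvd_sub_aeval {σ R : Type*} [CommRing R] [DecidableEq σ] (P : MvPolynomial σ R)
    (i j : σ) : (MvPolynomial.X i - MvPolynomial.X j : MvPolynomial σ R) ∣
      P - MvPolynomial.aeval (fun k => MvPolynomial.X (if k = i then j else k)) P := by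
  induction P using MvPolynomial.induction_on with
  | C a => simp
  | add p q hp hq =>
    rw [map_add, add_sub_add_comm]
    exact dvd_add hp hq
  | mul_X p k hp =>
    rw [map_mul, MvPolynomial.aeval_X]
    have : p * MvPolynomial.X k - MvPolynomial.aeval
        (fun k => (MvPolynomial.X (if k = i then j else k) : MvPolynomial σ R)) p
          * MvPolynomial.X (if k = i then j else k)
        = (p - MvPolynomial.aeval
            (fun k => (MvPolynomial.X (if k = i then j else k) : MvPolynomial σ R)) p)
              * MvPolynomial.X k + MvPolynomial.aeval
            (fun k => (MvPolynomial.X (if k = i then j else k) : MvPolynomial σ R)) p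
          * (MvPolynomial.X k - MvPolynomial.X (if k = i then j else k)) := by ring
    rw [this]
    refine dvd_add (hp.mul_right _) (Dvd.dvd.mul_left ?_ _)
    split_ifs with h
    · rw [h]
    · simp

/-- The polynomials by which a polynomial function on the torus can be divided as soon as the
quotient is continuous. -/
def Divides (B : MvPolynomial (Fin (m + 1)) ℚ) : Prop :=
  ∀ (E : (Fin (m + 1) → ℝ) → ℂ) (P : MvPolynomial (Fin (m + 1)) ℚ), Continuous E →
    (∀ x, E x * MvPolynomial.aeval (zexp x) B = MvPolynomial.aeval (zexp x) P) →
      ∃ Q : MvPolynomial (Fin (m + 1)) ℚ, ∀ x, E x = MvPolynomial.aeval (zexp x) Q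

theorem divides_one : Divides (1 : MvPolynomial (Fin (m + 1)) ℚ) := fun E P _ h =>
  ⟨P, fun x => by simpa using h x⟩

theorem Divides.mul {B B' : MvPolynomial (Fin (m + 1)) ℚ} (h : Divides B) (h' : Divides B') :
    Divides (B * B') := by
  intro E P hE hP
  obtain ⟨Q, hQ⟩ := h' (fun x => E x * MvPolynomial.aeval (zexp x) B) P
    (hE.mul (continuous_aeval_zexp B)) fun x => by rw [← hP x, map_mul, mul_assoc]
  exact h E Q hE hQ

/-- Where x_i = x_j the relation forces P to vanish, as E is finite there. So P dies under X_i ↦ X_j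
and is divisible by X_i - X_j. The quotient equals E off the diagonals, hence everywhere by
continuity. -/
theorem divides_X_sub_X {i j : Fin (m + 1)} (hij : i ≠ j) :
    Divides (MvPolynomial.X i - MvPolynomial.X j : MvPolynomial (Fin (m + 1)) ℚ) := by
  intro E P hE hP
  have h0 : MvPolynomial.aeval (fun k => (MvPolynomial.X (if k = i then j else k) :
      MvPolynomial (Fin (m + 1)) ℚ)) P = 0 := by
    refine eq_zero_of_aeval_zexp fun x => ?_
    have h1 := hP fun k => x (if k = i then j else k)
    have h2 : MvPolynomial.aeval (zexp fun k => x (if k = i then j else k))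
        (MvPolynomial.X i - MvPolynomial.X j : MvPolynomial (Fin (m + 1)) ℚ) = 0 := by
      simp [zexp, hij.symm]
    rw [h2, mul_zero] at h1
    have h3 := MvPolynomial.comp_aeval_apply (fun k => (MvPolynomial.X (if k = i then j else k) :
      MvPolynomial (Fin (m + 1)) ℚ)) (MvPolynomial.aeval (zexp x)) P
    rw [h3, h1]
    congr 2
    ext k
    simp [zexp]
  obtain ⟨Q, hQ⟩ := X_sub_X_dvd_sub_aeval P i j
  rw [h0, sub_zero] at hQ
  refine ⟨Q, fun x => ?_⟩
  refine congrFun (eq_of_eq_of_vand_ne_zero hE (continuous_aeval_zexp Q) fun x hx => ?_) x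
  have h4 := hP x
  rw [hQ, map_mul, mul_comm] at h4
  refine mul_left_cancel₀ ?_ h4
  rw [map_sub, MvPolynomial.aeval_X, MvPolynomial.aeval_X, sub_ne_zero]
  exact fun h => hij (vand_ne_zero_iff.mp hx h)

theorem divides_vand_pow (K : ℕ) :
    Divides (vand (MvPolynomial.X : Fin (m + 1) → MvPolynomial (Fin (m + 1)) ℚ) ^ K) := by
  induction K with
  | zero => rw [pow_zero]; exact divides_one
  | succ K ih =>
    rw [pow_succ]
    refine ih.mul (Finset.prod_induction _ Divides (fun _ _ => Divides.mul) divides_one fun i _ =>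
      Finset.prod_induction _ Divides (fun _ _ => Divides.mul) divides_one fun j hj => ?_)
    exact divides_X_sub_X (Finset.mem_Ioi.mp hj).ne

theorem X_sub_X_dvd_vand {R : Type*} [CommRing R] {n : ℕ} {i j : Fin n} (hij : i ≠ j) :
    (MvPolynomial.X i - MvPolynomial.X j : MvPolynomial (Fin n) R)
      ∣ vand (MvPolynomial.X : Fin n → MvPolynomial (Fin n) R) := by
  have h : ∀ i j : Fin n, i < j → (MvPolynomial.X i - MvPolynomial.X j : MvPolynomial (Fin n) R)
      ∣ vand (MvPolynomial.X : Fin n → MvPolynomial (Fin n) R) := fun i j hij =>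
    (Finset.dvd_prod_of_mem (fun j => (MvPolynomial.X i - MvPolynomial.X j : MvPolynomial (Fin n) R))
      (Finset.mem_Ioi.mpr hij)).trans (Finset.dvd_prod_of_mem _ (Finset.mem_univ i))
  rcases lt_or_gt_of_ne hij with h' | h'
  · exact h i j h'
  · rw [← neg_sub]
    exact (neg_dvd).mpr (h j i h')

theorem aeval_vand {n : ℕ} (z : Fin n → ℂ) :
    MvPolynomial.aeval z (vand (MvPolynomial.X : Fin n → MvPolynomial (Fin n) ℚ)) = vand z := by
  have := map_vand (MvPolynomial.aeval z : MvPolynomial (Fin n) ℚ →ₐ[ℚ] ℂ).toRingHom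
    (MvPolynomial.X : Fin n → MvPolynomial (Fin n) ℚ)
  refine this.trans ?_
  congr 1
  ext i
  simp

theorem dval_diff (x : Fin (m + 1) → ℝ) (i j : Fin (m + 1)) :
    dval (diff x : Fin m → ℝ) (i, j) = (zexp x i + zexp x j) / (2 * (zexp x i - zexp x j)) := by
  have h : coord (diff x : Fin m → ℝ) i - coord (diff x : Fin m → ℝ) j = x i - x j := by
    rw [coord_diff, coord_diff]; ring
  have h2 : Complex.exp (Complex.I * ((x i - x j : ℝ) : ℂ)) = zexp x i / zexp x j := by
    rw [zexp, zexp, ← Complex.exp_sub]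
    congr 1
    push_cast
    ring
  have h3 : zexp x j ≠ 0 := Complex.exp_ne_zero _
  rw [dval, h, dcot, h2, div_add_one h3, div_sub_one h3, mul_div_assoc', div_div_div_cancel_right₀ h3]

theorem exists_dval_mul_vand (q : Fin (m + 1) × Fin (m + 1)) :
    ∃ R : MvPolynomial (Fin (m + 1)) ℚ, ∀ x : Fin (m + 1) → ℝ, vand (zexp x) ≠ 0 →
      dval (diff x : Fin m → ℝ) q * vand (zexp x) = MvPolynomial.aeval (zexp x) R := by
  obtain ⟨i, j⟩ := q
  by_cases hij : i = j
  · refine ⟨0, fun x _ => ?_⟩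
    rw [dval_diff, hij]
    simp
  · obtain ⟨W, hW⟩ := X_sub_X_dvd_vand (R := ℚ) hij
    refine ⟨MvPolynomial.C (1 / 2) * (MvPolynomial.X i + MvPolynomial.X j) * W, fun x hx => ?_⟩
    have h1 : zexp x i - zexp x j ≠ 0 := sub_ne_zero.mpr fun h => hij (vand_ne_zero_iff.mp hx h)
    rw [dval_diff, ← aeval_vand, hW]
    simp only [map_mul, map_sub, map_add, MvPolynomial.aeval_X, MvPolynomial.aeval_C]
    simp
    field_simp

/-- Each generator is (z_i + z_j) / (2(z_i - z_j)), so one Vandermonde factor per generator clears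
the denominators. -/
theorem exists_aeval_dval_mul_vand_pow (P : MvPolynomial (Fin (m + 1) × Fin (m + 1)) ℚ) :
    ∃ (K : ℕ) (Q : MvPolynomial (Fin (m + 1)) ℚ), ∀ x : Fin (m + 1) → ℝ, vand (zexp x) ≠ 0 →
      MvPolynomial.aeval (dval (diff x : Fin m → ℝ)) P * vand (zexp x) ^ K
        = MvPolynomial.aeval (zexp x) Q := by
  induction P using MvPolynomial.induction_on with
  | C a => exact ⟨0, MvPolynomial.C a, fun x _ => by simp⟩
  | add p q hp hq =>
    obtain ⟨K, Q, h⟩ := hp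
    obtain ⟨K', Q', h'⟩ := hq
    refine ⟨K + K', Q * vand MvPolynomial.X ^ K' + Q' * vand MvPolynomial.X ^ K, fun x hx => ?_⟩
    rw [map_add, map_add, map_mul, map_mul, map_pow, map_pow, aeval_vand, ← h x hx, ← h' x hx]
    ring
  | mul_X p q hp =>
    obtain ⟨K, Q, h⟩ := hp
    obtain ⟨R, hR⟩ := exists_dval_mul_vand q
    refine ⟨K + 1, Q * R, fun x hx => ?_⟩
    rw [map_mul, map_mul, MvPolynomial.aeval_X, ← h x hx, ← hR x hx]
    ring

/-- `R̂_n` is a polynomial with rational coefficients in the eigenvalues. -/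
theorem exists_Rhat_eq_aeval (hm : 1 ≤ m) : ∃ Q : MvPolynomial (Fin (m + 1)) ℚ, ∀ u : Fin m → ℝ,
    (Rhat (m + 1) u : ℂ) = MvPolynomial.aeval (torusEntry (m + 1) u) Q := by
  obtain ⟨hc, -, hR⟩ := Rhat_spec hm
  obtain ⟨P, hP⟩ := exists_Dhat_poly hm
  obtain ⟨K, Q, hQ⟩ := exists_aeval_dval_mul_vand_pow P
  -- The lift of R̂ to arbitrary angles. The phase is the one of `vand_zexp`, so that E is the
  -- polynomial in `dcot` times Δ on regular points; it equals 1 when the angles sum to zero.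
  let E : (Fin (m + 1) → ℝ) → ℂ := fun x =>
    (Rhat (m + 1) (diff x : Fin m → ℝ) : ℂ) * Complex.exp (Complex.I * (m / 2 * ∑ i, x i : ℝ))
  have hE : Continuous E := by
    have h1 : Continuous fun x : Fin (m + 1) → ℝ => Rhat (m + 1) (diff x : Fin m → ℝ) :=
      hc.comp continuous_diff
    fun_prop
  obtain ⟨Q', hQ'⟩ := divides_vand_pow K E (Q * vand MvPolynomial.X) hE (by
    refine congrFun (eq_of_eq_of_vand_ne_zero (hE.mul (continuous_aeval_zexp _))
      (continuous_aeval_zexp _) fun x hx => ?_)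
    have hreg := (vand_zexp_ne_zero_iff x).mp hx
    have hE' : E x = MvPolynomial.aeval (dval (diff x : Fin m → ℝ)) P * vand (zexp x) := by
      rw [vand_zexp]
      simp only [E]
      rw [hR _ hreg, Complex.ofReal_mul, (hP _ hreg).2]
      ring
    rw [hE', map_mul, map_pow, aeval_vand, ← hQ x hx]
    ring)
  refine ⟨Q', fun u => ?_⟩
  rw [← zexp_angle, ← hQ']
  simp only [E]
  rw [diff_angle, sum_angle]
  simp

end

/-! ### Schur polynomials and characters. -/

/-- The matrix of the powers `z_i ^ ℓ_j`. -/
def powMatrix {R : Type*} [CommRing R] {n : ℕ} (z : Fin n → R) (l : Fin n → ℕ) :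
    Matrix (Fin n) (Fin n) R := Matrix.of fun i j => z i ^ l j

/-- The polynomial with the given roots. -/
def rootPoly {R : Type*} [CommRing R] {n : ℕ} (z : Fin n → R) : Polynomial R :=
  ∏ k, (Polynomial.X - Polynomial.C (z k))

/-- The coefficients of the remainders of the `X ^ ℓ_j` modulo `rootPoly`. -/
def remMatrix {R : Type*} [CommRing R] {n : ℕ} (z : Fin n → R) (l : Fin n → ℕ) :
    Matrix (Fin n) (Fin n) R :=
  Matrix.of fun k j => (Polynomial.X ^ l j %ₘ rootPoly z).coeff k

/-- At a root z_i, the power X^ℓ and its remainder modulo `rootPoly` agree, and the remainder has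
degree below n. This exhibits the Vandermonde factor of an alternant without any division. -/
theorem powMatrix_eq {R : Type*} [CommRing R] [Nontrivial R] {n : ℕ} (z : Fin n → R)
    (l : Fin n → ℕ) : powMatrix z l = Matrix.vandermonde z * remMatrix z l := by
  ext i j
  have hmonic : (rootPoly z).Monic := Polynomial.monic_prod_of_monic _ _ fun k _ =>
    Polynomial.monic_X_sub_C _
  have hroot : (rootPoly z).eval (z i) = 0 := by
    rw [rootPoly, Polynomial.eval_prod]
    exact Finset.prod_eq_zero (Finset.mem_univ i) (by simp)
  have hdeg : (Polynomial.X ^ l j %ₘ rootPoly z).degree < n := by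
    have h := Polynomial.degree_modByMonic_lt (Polynomial.X ^ l j) hmonic
    have h2 : (rootPoly z).natDegree = n := by
      rw [rootPoly, Polynomial.natDegree_prod_of_monic _ _ fun k _ => Polynomial.monic_X_sub_C _]
      simp
    rwa [Polynomial.degree_eq_natDegree hmonic.ne_zero, h2] at h
  have h := congrArg (Polynomial.eval (z i))
    (Polynomial.modByMonic_add_div (Polynomial.X ^ l j) (rootPoly z))
  rw [Polynomial.eval_add, Polynomial.eval_mul, hroot, zero_mul, add_zero, Polynomial.eval_pow,
    Polynomial.eval_X] at h
  rw [powMatrix, Matrix.of_apply, ← h, Matrix.mul_apply]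
  by_cases h0 : (Polynomial.X ^ l j %ₘ rootPoly z) = 0
  · simp [remMatrix, h0]
  · rw [Polynomial.eval_eq_sum_range' (n := n), Finset.sum_range]
    · refine Finset.sum_congr rfl fun k _ => ?_
      rw [Matrix.vandermonde_apply, remMatrix, Matrix.of_apply, mul_comm]
    · exact (Polynomial.natDegree_lt_iff_degree_lt h0).mpr hdeg

section

variable {m : ℕ}

theorem det_vandermonde_eq_vand {R : Type*} [CommRing R] (z : Fin (m + 1) → R) :
    (Matrix.vandermonde z).det = (-1) ^ ((m + 1) * m / 2) * vand z := by
  rw [Matrix.det_vandermonde, vand, ← sum_card_Ioi, ← Finset.prod_pow_eq_pow_sum,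
    ← Finset.prod_mul_distrib]
  refine Finset.prod_congr rfl fun i _ => ?_
  rw [← Finset.prod_const, ← Finset.prod_mul_distrib]
  refine Finset.prod_congr rfl fun j _ => ?_
  ring

/-- The quotient of the alternant of exponents `ℓ` by the Vandermonde product. -/
def schur (l : Fin (m + 1) → ℕ) : MvPolynomial (Fin (m + 1)) ℤ :=
  (-1) ^ ((m + 1) * m / 2) * (remMatrix MvPolynomial.X l).det

theorem det_powMatrix_X (l : Fin (m + 1) → ℕ) :
    (powMatrix (MvPolynomial.X : Fin (m + 1) → MvPolynomial (Fin (m + 1)) ℤ) l).det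
      = vand MvPolynomial.X * schur l := by
  rw [powMatrix_eq, Matrix.det_mul, det_vandermonde_eq_vand, schur]
  ring

theorem map_powMatrix {R S : Type*} [CommRing R] [CommRing S] {n : ℕ} (f : R →+* S) (z : Fin n → R)
    (l : Fin n → ℕ) : f (powMatrix z l).det = (powMatrix (f ∘ z) l).det := by
  rw [RingHom.map_det]
  congr 1
  ext i j
  simp [powMatrix]

theorem det_powMatrix {R : Type*} [CommRing R] (z : Fin (m + 1) → R) (l : Fin (m + 1) → ℕ) :
    (powMatrix z l).det = vand z * MvPolynomial.aeval z (schur l) := by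
  let f : MvPolynomial (Fin (m + 1)) ℤ →+* R := (MvPolynomial.aeval z).toRingHom
  have hf : f ∘ MvPolynomial.X = z := by ext i; simp [f]
  have h := congrArg f (det_powMatrix_X l)
  rw [map_mul, map_powMatrix, map_vand, hf] at h
  exact h

/-- `rootPoly` is symmetric in its roots, hence so are the coefficients of all remainders modulo it.
-/
theorem schur_isSymmetric (l : Fin (m + 1) → ℕ) : (schur l).IsSymmetric := by
  intro w
  let f : MvPolynomial (Fin (m + 1)) ℤ →+* MvPolynomial (Fin (m + 1)) ℤ :=
    (MvPolynomial.rename w).toRingHom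
  change f (schur l) = schur l
  rw [schur, map_mul, map_pow, map_neg, map_one, RingHom.map_det]
  congr 2
  have hroot : (rootPoly (MvPolynomial.X : Fin (m + 1) → MvPolynomial (Fin (m + 1)) ℤ)).map f
      = rootPoly MvPolynomial.X := by
    rw [rootPoly, Polynomial.map_prod]
    rw [← Equiv.prod_comp w fun k => (Polynomial.X - Polynomial.C
      (MvPolynomial.X k : MvPolynomial (Fin (m + 1)) ℤ))]
    refine Finset.prod_congr rfl fun k _ => ?_
    simp [f]
  ext1 k j
  rw [RingHom.mapMatrix_apply, Matrix.map_apply, remMatrix, Matrix.of_apply, ← Polynomial.coeff_map,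
    Polynomial.map_modByMonic _ (Polynomial.monic_prod_of_monic _ _ fun k _ =>
      Polynomial.monic_X_sub_C _), hroot, Polynomial.map_pow, Polynomial.map_X]

theorem continuous_aeval_torusEntry {R : Type*} [CommRing R] [Algebra R ℂ]
    (P : MvPolynomial (Fin (m + 1)) R) :
    Continuous fun u : Fin m → ℝ => MvPolynomial.aeval (torusEntry (m + 1) u) P := by
  have := fun i => continuous_torusEntry (m := m) i
  simp only [MvPolynomial.aeval_def, MvPolynomial.eval₂_eq']
  fun_prop

theorem character_eq (κ : Fin m → ℕ) : character (m + 1) κ = fun u : Fin m → ℝ =>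
    MvPolynomial.aeval (torusEntry (m + 1) u) (schur (shiftedEll (m + 1) κ)) := by
  refine extendFrom_eq_of_continuous (continuous_aeval_torusEntry _) fun u hu => ?_
  have h := det_powMatrix (torusEntry (m + 1) u) (shiftedEll (m + 1) κ)
  rw [← deltaExp_eq] at h
  exact (div_eq_iff hu).mpr (h.trans (mul_comm _ _))

theorem continuous_character (κ : Fin m → ℕ) :
    Continuous (character (m + 1) κ : (Fin m → ℝ) → ℂ) := by
  rw [character_eq]; exact continuous_aeval_torusEntry _

theorem deltaExp_mul_character (κ : Fin m → ℕ) (u : Fin m → ℝ) :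
    deltaExp (m + 1) u * character (m + 1) κ u
      = (powMatrix (torusEntry (m + 1) u) (shiftedEll (m + 1) κ)).det := by
  rw [det_powMatrix, deltaExp_eq, character_eq]

theorem shiftedEll_eq (κ : Fin m → ℕ) (j : Fin (m + 1)) :
    shiftedEll (m + 1) κ j = coord κ j + (m - j.val) := rfl

theorem shiftedEll_castSucc (κ : Fin m → ℕ) (k : Fin m) :
    shiftedEll (m + 1) κ k.castSucc = κ k + shiftedEll (m + 1) κ k.succ + 1 := by
  rw [shiftedEll_eq, shiftedEll_eq, coord_castSucc, Fin.val_castSucc, Fin.val_succ]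
  have := k.2
  omega

theorem shiftedEll_last (κ : Fin m → ℕ) : shiftedEll (m + 1) κ (Fin.last m) = 0 := by
  rw [shiftedEll_eq]; simp

theorem shiftedEll_strictAnti (κ : Fin m → ℕ) : StrictAnti (shiftedEll (m + 1) κ) := by
  refine Fin.strictAnti_iff_succ_lt.mpr fun k => ?_
  have := shiftedEll_castSucc κ k
  omega

theorem det_powMatrix_comp {R : Type*} [CommRing R] {n : ℕ} (z : Fin n → R) (l : Fin n → ℕ)
    (w : Equiv.Perm (Fin n)) :
    (powMatrix z (l ∘ w)).det = ((Equiv.Perm.sign w : ℤˣ) : ℤ) * (powMatrix z l).det := by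
  rw [← Matrix.det_permute']
  rfl

/-- Every alternant is, up to a sign, zero or the numerator of a character. -/
theorem exists_det_powMatrix_eq (e : Fin (m + 1) → ℕ) : ∃ (c : ℚ) (κ : Fin m → ℕ),
    ∀ u : Fin m → ℝ, (powMatrix (torusEntry (m + 1) u) e).det
      = (c : ℂ) * (deltaExp (m + 1) u * character (m + 1) κ u) := by
  by_cases he : Function.Injective e
  · obtain ⟨w, hw⟩ : ∃ w : Equiv.Perm (Fin (m + 1)), StrictAnti (e ∘ w) := by
      refine ⟨Fin.revPerm.trans (Tuple.sort e), fun i j hij => ?_⟩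
      have h1 : StrictMono (e ∘ Tuple.sort e) :=
        (Tuple.monotone_sort e).strictMono_of_injective (he.comp (Tuple.sort e).injective)
      exact h1 (Fin.rev_lt_rev.mpr hij)
    -- The smallest exponent. Subtracting it from all exponents changes nothing, as the eigenvalues
    -- have product 1.
    let c := e (w (Fin.last m))
    let κ : Fin m → ℕ := fun k => e (w k.castSucc) - e (w k.succ) - 1
    have hl : ∀ j, e (w j) = c + shiftedEll (m + 1) κ j := by
      intro j
      induction j using Fin.reverseInduction with
      | last => rw [shiftedEll_last]; rfl
      | cast k ih =>
        rw [shiftedEll_castSucc]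
        have : e (w k.succ) < e (w k.castSucc) := hw (Fin.castSucc_lt_succ (i := k))
        have hκ : κ k = e (w k.castSucc) - e (w k.succ) - 1 := rfl
        omega
    refine ⟨(((Equiv.Perm.sign w : ℤˣ) : ℤ) : ℚ), κ, fun u => ?_⟩
    have h1 := det_powMatrix_comp (torusEntry (m + 1) u) e w
    have h2 : (powMatrix (torusEntry (m + 1) u) (e ∘ w)).det
        = deltaExp (m + 1) u * character (m + 1) κ u := by
      rw [deltaExp_mul_character]
      have h3 : powMatrix (torusEntry (m + 1) u) (e ∘ w) = Matrix.of fun i j =>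
          torusEntry (m + 1) u i ^ c
            * powMatrix (torusEntry (m + 1) u) (shiftedEll (m + 1) κ) i j := by
        ext i j
        simp [powMatrix, hl, pow_add]
      rw [h3, Matrix.det_mul_column, Finset.prod_pow, prod_torusEntry, one_pow, one_mul]
    rw [← h2, h1]
    push_cast
    rw [← mul_assoc]
    have h4 : ((((Equiv.Perm.sign w : ℤˣ) : ℤ) : ℂ)) * (((Equiv.Perm.sign w : ℤˣ) : ℤ) : ℂ) = 1 := by
      rw [← Int.cast_mul, ← Units.val_mul, Int.units_mul_self]; simp
    rw [h4, one_mul]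
  · refine ⟨0, 0, fun u => ?_⟩
    simp only [Function.Injective, not_forall] at he
    obtain ⟨i, j, hij, hne⟩ := he
    rw [Matrix.det_zero_of_column_eq hne fun k => by simp [powMatrix, hij]]
    simp

/-! ### Symmetry of R̂. -/

/-- The action of the symmetric group on the lattice. -/
def permInt (w : Equiv.Perm (Fin (m + 1))) : (Fin m → ℤ) ≃ (Fin m → ℤ) where
  toFun p := diff (coord p ∘ w)
  invFun p := diff (coord p ∘ w.symm)
  left_inv p := by
    have : coord (diff (coord p ∘ w)) ∘ w.symm
        = fun i => coord p i + - coord p (w (Fin.last m)) := by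
      ext i; simp [coord_diff, sub_eq_add_neg]
    dsimp only
    rw [this, diff_add_const, diff_coord]
  right_inv p := by
    have : coord (diff (coord p ∘ w.symm)) ∘ w
        = fun i => coord p i + - coord p (w.symm (Fin.last m)) := by
      ext i; simp [coord_diff, sub_eq_add_neg]
    dsimp only
    rw [this, diff_add_const, diff_coord]

theorem perm_shift (w : Equiv.Perm (Fin (m + 1))) (u : Fin m → ℝ) (p : Fin m → ℤ) :
    perm w (shift (m + 1) u p) = (shift (m + 1) (perm w u) (permInt w p) : Fin m → ℝ) := by
  ext k
  have h : (shift (m + 1) (perm w u) (permInt w p) : Fin m → ℝ) k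
      = perm w u k + (permInt w p k : ℝ) * (2 * Real.pi) := rfl
  rw [h]
  simp only [perm, permInt, Equiv.coe_fn_mk, diff, Function.comp]
  rw [coord_shift (m := m), coord_shift (m := m)]
  push_cast
  ring

theorem sign_mul_self {w : Equiv.Perm (Fin (m + 1))} :
    ((((Equiv.Perm.sign w : ℤˣ) : ℤ) : ℝ)) * (((Equiv.Perm.sign w : ℤˣ) : ℤ) : ℝ) = 1 := by
  rw [← Int.cast_mul, ← Units.val_mul, Int.units_mul_self]; simp

theorem varpi_perm (w : Equiv.Perm (Fin (m + 1))) (u : Fin m → ℝ) :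
    varpi (m + 1) (perm w u) = ((Equiv.Perm.sign w : ℤˣ) : ℤ) * varpi (m + 1) u := by
  have h := deltaExp_perm w u
  have h2 := deltaExp_eq_varpi u
  have h3 := deltaExp_eq_varpi (perm w u)
  rw [h2, h3] at h
  have h4 : (Complex.I ^ ((m + 1) * m / 2)) ≠ 0 := pow_ne_zero _ Complex.I_ne_zero
  rw [mul_left_comm] at h
  have := mul_left_cancel₀ h4 h
  exact_mod_cast this

/-- Reindexing by `permInt` need not respect the boxes, so this rests on absolute convergence. -/
theorem Dhat_perm (hm : 2 ≤ m) (w : Equiv.Perm (Fin (m + 1))) {u : Fin m → ℝ}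
    (hu : u ∈ regular (m + 1)) :
    Dhat (m + 1) (perm w u) = ((Equiv.Perm.sign w : ℤˣ) : ℤ) * Dhat (m + 1) u := by
  have h1 := (permInt w).hasSum_iff.mpr (hasSum_Dhat hm (regular_perm w hu))
  have h2 := (hasSum_Dhat hm hu).mul_left ((((Equiv.Perm.sign w : ℤˣ) : ℤ) : ℝ))
  refine h1.unique ?_
  convert! h2 using 2 with p
  dsimp only [Function.comp]
  rw [← perm_shift, deltaTilde_perm]
  have h3 := sign_mul_self (w := w)
  have h4 : ((((Equiv.Perm.sign w : ℤˣ) : ℤ) : ℝ)) ≠ 0 := left_ne_zero_of_mul_eq_one h3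
  rw [one_div, mul_inv, inv_eq_of_mul_eq_one_right h3, one_div]

theorem Rhat_two : Rhat (1 + 1) = fun u : Fin 1 → ℝ => Real.cos (u 0 / 2) :=
  extendFrom_eq_of_continuous (m := 1) (by fun_prop) fun _ hu => Dhat_mul_varpi_two hu

theorem Rhat_perm (hm : 1 ≤ m) (w : Equiv.Perm (Fin (m + 1))) (u : Fin m → ℝ) :
    Rhat (m + 1) (perm w u) = Rhat (m + 1) u := by
  obtain ⟨hc, -, hR⟩ := Rhat_spec hm
  rcases (by omega : m = 1 ∨ 2 ≤ m) with rfl | hm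
  · rw [Rhat_two]
    have h := deltaTilde_perm w u
    rw [deltaTilde_two, deltaTilde_two] at h
    dsimp only
    rw [h]
    rcases Int.units_eq_one_or (Equiv.Perm.sign w) with h' | h' <;> simp [h', neg_div]
  · have h1 : Continuous fun u : Fin m → ℝ => Rhat (m + 1) (perm w u) :=
      hc.comp (continuous_perm w)
    refine congrFun (h1.ext_on dense_regular hc fun u hu => ?_) u
    dsimp only
    rw [hR u hu, hR _ (regular_perm w hu), Dhat_perm hm w hu, varpi_perm, mul_mul_mul_comm,
      sign_mul_self, one_mul]

/-! ### Expansion on characters and its uniqueness. -/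

/-- The characters, as elements of a vector space over `ℚ`. -/
def char (κ : Fin m → ℕ) : (Fin m → ℝ) → ℂ := character (m + 1) κ

theorem linearCombination_char_apply (r : (Fin m → ℕ) →₀ ℚ) (u : Fin m → ℝ) :
    Finsupp.linearCombination ℚ char r u
      = ∑ κ ∈ r.support, (r κ : ℂ) * character (m + 1) κ u := by
  rw [Finsupp.linearCombination_apply, Finsupp.sum, Finset.sum_apply]
  refine Finset.sum_congr rfl fun κ _ => ?_
  rw [Pi.smul_apply, Rat.smul_def]
  rfl

theorem continuous_linearCombination_char (r : (Fin m → ℕ) →₀ ℚ) :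
    Continuous (Finsupp.linearCombination ℚ char r) := by
  have : Finsupp.linearCombination ℚ char r
      = fun u : Fin m → ℝ => ∑ κ ∈ r.support, (r κ : ℂ) * character (m + 1) κ u :=
    funext (linearCombination_char_apply r)
  rw [this]
  exact continuous_finsetSum _ fun κ _ => continuous_const.mul (continuous_character κ)

/-- The polynomial Q representing R̂ need not be symmetric, although its values are. Averaging QΔ
over the group with signs therefore reproduces R̂Δ, and it turns every monomial into an alternant.
-/
theorem exists_expansion (hm : 1 ≤ m) : ∃ r : (Fin m → ℕ) →₀ ℚ,
    Finsupp.linearCombination ℚ char r = fun u : Fin m → ℝ => (Rhat (m + 1) u : ℂ) := by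
  obtain ⟨hc, -, -⟩ := Rhat_spec hm
  obtain ⟨Q, hQ⟩ := exists_Rhat_eq_aeval hm
  choose c κ hκ using fun e : Fin (m + 1) → ℕ => exists_det_powMatrix_eq e
  let G : MvPolynomial (Fin (m + 1)) ℚ := Q * vand MvPolynomial.X
  let f : ℚ := ((Nat.factorial (m + 1) : ℕ) : ℚ)⁻¹
  let r : (Fin m → ℕ) →₀ ℚ := ∑ e ∈ G.support, Finsupp.single (κ e) (f * (G.coeff e * c e))
  refine ⟨r, (continuous_linearCombination_char r).ext_on dense_regular (by fun_prop)
    fun u hu => ?_⟩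
  have h1 : ∀ w : Equiv.Perm (Fin (m + 1)),
      (Rhat (m + 1) u : ℂ) * deltaExp (m + 1) u = ((Equiv.Perm.sign w : ℤˣ) : ℤ)
        * MvPolynomial.aeval (torusEntry (m + 1) u ∘ w) G := by
    intro w
    rw [map_mul, aeval_vand, ← torusEntry_perm, ← hQ, Rhat_perm hm, ← deltaExp_eq, deltaExp_perm]
    have := sign_mul_self (w := w)
    have h2 : ((((Equiv.Perm.sign w : ℤˣ) : ℤ) : ℂ)) * (((Equiv.Perm.sign w : ℤˣ) : ℤ) : ℂ) = 1 := by
      exact_mod_cast this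
    linear_combination (- (Rhat (m + 1) u : ℂ) * deltaExp (m + 1) u) * h2
  have h2 : (Nat.factorial (m + 1) : ℂ) * ((Rhat (m + 1) u : ℂ) * deltaExp (m + 1) u)
      = ∑ e ∈ G.support, ((G.coeff e : ℚ) : ℂ) * (powMatrix (torusEntry (m + 1) u) e).det := by
    have h3 : (Nat.factorial (m + 1) : ℂ) * ((Rhat (m + 1) u : ℂ) * deltaExp (m + 1) u)
        = ∑ w : Equiv.Perm (Fin (m + 1)), (((Equiv.Perm.sign w : ℤˣ) : ℤ) : ℂ)
          * MvPolynomial.aeval (torusEntry (m + 1) u ∘ w) G := by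
      rw [← Finset.sum_congr rfl fun w _ => h1 w, Finset.sum_const, Finset.card_univ,
        Fintype.card_perm, Fintype.card_fin, nsmul_eq_mul]
    rw [h3]
    simp only [MvPolynomial.aeval_def, MvPolynomial.eval₂_eq', Finset.mul_sum]
    rw [Finset.sum_comm]
    refine Finset.sum_congr rfl fun e _ => ?_
    rw [Matrix.det_apply', Finset.mul_sum]
    refine Finset.sum_congr rfl fun w _ => ?_
    simp only [powMatrix, Matrix.of_apply, Function.comp, eq_ratCast]
    ring
  have hD : deltaExp (m + 1) u ≠ 0 := hu
  have hfac : (Nat.factorial (m + 1) : ℂ) ≠ 0 := by exact_mod_cast Nat.factorial_ne_zero _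
  refine mul_right_cancel₀ hD (mul_left_cancel₀ hfac ?_)
  rw [h2]
  simp only [r, map_sum, Finset.sum_apply, Finsupp.linearCombination_single, Pi.smul_apply,
    Finset.sum_mul, Finset.mul_sum]
  refine Finset.sum_congr rfl fun e _ => ?_
  rw [hκ, Rat.smul_def]
  simp only [f, char]
  push_cast
  field_simp

theorem torusEntry_add (u v : Fin m → ℝ) (i : Fin (m + 1)) :
    torusEntry (m + 1) (u + v : Fin m → ℝ) i
      = torusEntry (m + 1) u i * torusEntry (m + 1) v i := by
  have : angle (m + 1) (u + v : Fin m → ℝ) i = angle (m + 1) u i + angle (m + 1) v i := by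
    simp only [angle_eq, mean, coord_add, Finset.sum_add_distrib]
    ring
  rw [torusEntry, torusEntry, torusEntry, this, ← Complex.exp_add]
  congr 1
  push_cast
  ring

/-- The monomial of exponents `e` as a homomorphism. -/
def monoHom (e : Fin (m + 1) → ℕ) : Multiplicative (Fin m → ℝ) →* ℂ where
  toFun u := ∏ i, torusEntry (m + 1) u.toAdd i ^ e i
  map_one' := by
    refine Finset.prod_eq_one fun i _ => ?_
    have : angle (m + 1) (0 : Fin m → ℝ) i = 0 := by simp [angle_eq, mean, coord]
    rw [toAdd_one, torusEntry, this]
    simp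
  map_mul' u v := by
    rw [toAdd_mul, ← Finset.prod_mul_distrib]
    refine Finset.prod_congr rfl fun i _ => ?_
    rw [torusEntry_add, mul_pow]

theorem monoHom_apply_diff (e : Fin (m + 1) → ℕ) {x : Fin (m + 1) → ℝ} (hx : ∑ i, x i = 0) :
    monoHom e (Multiplicative.ofAdd (diff x)) = Complex.exp (Complex.I * (∑ i, e i * x i : ℝ)) := by
  have h : angle (m + 1) (diff x : Fin m → ℝ) = x := angle_eq_of_sum_eq_zero hx rfl
  change ∏ i, torusEntry (m + 1) (diff x : Fin m → ℝ) i ^ e i = _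
  simp only [torusEntry, h]
  push_cast
  rw [Finset.mul_sum, Complex.exp_sum]
  refine Finset.prod_congr rfl fun i _ => ?_
  rw [← Complex.exp_nat_mul]
  congr 1
  ring

/-- On the torus of SU(n) a monomial determines its exponents only up to a common constant. -/
theorem sub_eq_sub_of_monoHom_eq {e e' : Fin (m + 1) → ℕ} (h : monoHom e = monoHom e')
    (i j : Fin (m + 1)) : (e i : ℤ) - e j = e' i - e' j := by
  by_contra hne
  have hij : i ≠ j := fun h => hne (by rw [h]; simp)
  have hne' : (e i : ℝ) - e j - (e' i - e' j) ≠ 0 := by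
    have := sub_ne_zero.mpr hne
    exact_mod_cast this
  -- Rotating the eigenvalues i and j by opposite angles t makes the two monomials differ by the
  -- factor e^(iπ) = -1.
  let t : ℝ := Real.pi / ((e i : ℝ) - e j - (e' i - e' j))
  let x : Fin (m + 1) → ℝ := Pi.single i t - Pi.single j t
  have hx : ∑ k, x k = 0 := by simp [x]
  have hs : ∀ e : Fin (m + 1) → ℕ, ∑ k, (e k : ℝ) * x k = (e i - e j) * t := by
    intro e
    simp [x, mul_sub, Finset.sum_sub_distrib, Pi.single_apply, sub_mul]
  have h1 := DFunLike.congr_fun h (Multiplicative.ofAdd (diff x))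
  rw [monoHom_apply_diff e hx, monoHom_apply_diff e' hx, hs, hs] at h1
  have h2 : (e i - e j : ℝ) * t = (e' i - e' j) * t + Real.pi := by
    simp only [t]
    field_simp
    ring
  rw [h2] at h1
  push_cast at h1
  rw [mul_add, Complex.exp_add, mul_comm Complex.I (Real.pi : ℂ), Complex.exp_pi_mul_I] at h1
  have h3 := Complex.exp_ne_zero (Complex.I * (((e' i : ℂ) - e' j) * t))
  have h4 : (2 : ℂ) * Complex.exp (Complex.I * (((e' i : ℂ) - e' j) * t)) = 0 := by
    linear_combination -h1
  exact h3 ((mul_eq_zero.mp h4).resolve_left two_ne_zero)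

/-- The minimum of either exponent vector is 0, so the common constant vanishes. Strict decrease
then determines the permutation, and the consecutive differences determine κ. -/
theorem monoHom_shiftedEll_injective : Function.Injective
    fun q : (Fin m → ℕ) × Equiv.Perm (Fin (m + 1)) =>
      monoHom (shiftedEll (m + 1) q.1 ∘ q.2.symm) := by
  rintro ⟨κ, w⟩ ⟨κ', w'⟩ h
  have h1 := fun i j => sub_eq_sub_of_monoHom_eq h i j
  simp only [Function.comp] at h1
  have h2 := h1 (w' (Fin.last m)) (w (Fin.last m))
  rw [Equiv.symm_apply_apply, Equiv.symm_apply_apply, shiftedEll_last, shiftedEll_last] at h2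
  have h3 : ∀ i, shiftedEll (m + 1) κ (w.symm i) = shiftedEll (m + 1) κ' (w'.symm i) := by
    intro i
    have h4 := h1 i (w (Fin.last m))
    rw [Equiv.symm_apply_apply, shiftedEll_last] at h4
    omega
  have hmono : StrictMono fun i => w'.symm (w i) := by
    intro i j hij
    have h5 := shiftedEll_strictAnti κ hij
    have h6 := h3 (w i)
    have h7 := h3 (w j)
    rw [Equiv.symm_apply_apply] at h6 h7
    rw [h6, h7] at h5
    exact (shiftedEll_strictAnti κ').lt_iff_gt.mp h5
  have h8 : (fun i => w'.symm (w i)) = id := by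
    refine (hmono.range_inj strictMono_id).mp ?_
    rw [Set.range_id]
    exact (w.trans w'.symm).surjective.range_eq
  have hw : w = w' := by
    ext1 i
    have := congrFun h8 i
    exact (Equiv.symm_apply_eq w').mp this
  subst hw
  have h9 : ∀ i, shiftedEll (m + 1) κ i = shiftedEll (m + 1) κ' i := by
    intro i
    have := h3 (w i)
    rwa [Equiv.symm_apply_apply] at this
  have : κ = κ' := by
    ext k
    have a := shiftedEll_castSucc κ k
    have b := shiftedEll_castSucc κ' k
    have c := h9 k.castSucc
    have d := h9 k.succ
    omega
  rw [this]

/-- Multiplied by Δ, a relation between characters becomes one between distinct homomorphisms into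
ℂ, which are independent by Dedekind's theorem. The coefficient at the identity permutation is that
of the character. -/
theorem linearIndependent_char : LinearIndependent ℚ (char : (Fin m → ℕ) → (Fin m → ℝ) → ℂ) := by
  rw [linearIndependent_iff]
  intro r hr
  have hind := (linearIndependent_monoidHom (Multiplicative (Fin m → ℝ)) ℂ).comp _
    (monoHom_shiftedEll_injective (m := m))
  rw [linearIndependent_iff'] at hind
  ext κ
  by_contra hκ
  have h := hind (r.support ×ˢ Finset.univ)
    (fun q => (r q.1 : ℂ) * (((Equiv.Perm.sign q.2 : ℤˣ) : ℤ) : ℂ)) ?_ (κ, 1)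
    (Finset.mem_product.mpr ⟨Finsupp.mem_support_iff.mpr hκ, Finset.mem_univ _⟩)
  · simp at h
    exact hκ h
  · ext u
    rw [Finset.sum_apply, Finset.sum_product, Pi.zero_apply]
    have h1 := congrFun hr u.toAdd
    rw [linearCombination_char_apply, Pi.zero_apply] at h1
    have h2 := congrArg (fun x => deltaExp (m + 1) u.toAdd * x) h1
    rw [mul_zero, Finset.mul_sum] at h2
    rw [← h2]
    refine Finset.sum_congr rfl fun κ _ => ?_
    rw [mul_left_comm, deltaExp_mul_character, Matrix.det_apply', Finset.mul_sum]
    refine Finset.sum_congr rfl fun w _ => ?_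
    rw [Pi.smul_apply, smul_eq_mul, mul_assoc]
    congr 2
    simp only [Function.comp]
    change ∏ i, torusEntry (m + 1) u.toAdd i ^ (shiftedEll (m + 1) κ (w.symm i)) = _
    rw [← Equiv.prod_comp w]
    simp [powMatrix]

/-! ### Complex conjugation of characters. -/

theorem shiftedEll_comp_rev (κ : Fin m → ℕ) (j : Fin (m + 1)) :
    shiftedEll (m + 1) (κ ∘ Fin.rev) j + shiftedEll (m + 1) κ j.rev = shiftedEll (m + 1) κ 0 := by
  induction j using Fin.reverseInduction with
  | last => rw [shiftedEll_last, Fin.rev_last, zero_add]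
  | cast k ih =>
    have h1 := shiftedEll_castSucc (κ ∘ Fin.rev) k
    have h2 := shiftedEll_castSucc κ k.rev
    rw [Fin.rev_castSucc]
    rw [Fin.rev_succ] at ih
    simp only [Function.comp] at h1
    omega

/-- Conjugation inverts the eigenvalues. Multiplying row i by z_i^(ℓ_0), with total factor 1,
replaces the exponents ℓ_j by ℓ_0 - ℓ_j, which are those of the reversed weight in the opposite
order. The sign of the order reversal also appears in the conjugate of Δ and cancels. -/
theorem char_comp_rev (κ : Fin m → ℕ) :
    char (κ ∘ Fin.rev) = fun u => (starRingEnd ℂ) (char κ u) := by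
  have hc : Continuous fun u => (starRingEnd ℂ) (char κ u) :=
    Complex.continuous_conj.comp (continuous_character κ)
  refine (continuous_character (κ ∘ Fin.rev)).ext_on dense_regular hc fun u hu => ?_
  have hconj : ∀ i, (starRingEnd ℂ) (torusEntry (m + 1) u i) = (torusEntry (m + 1) u i)⁻¹ := by
    intro i
    rw [Complex.inv_def, Complex.normSq_eq_norm_sq, norm_torusEntry]
    simp
  have key : ∀ κ : Fin m → ℕ,
      (powMatrix (torusEntry (m + 1) u) (shiftedEll (m + 1) (κ ∘ Fin.rev))).det
        = (((Equiv.Perm.sign (Fin.revPerm : Equiv.Perm (Fin (m + 1))) : ℤˣ) : ℤ) : ℂ)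
          * (starRingEnd ℂ) (powMatrix (torusEntry (m + 1) u) (shiftedEll (m + 1) κ)).det := by
    intro κ
    rw [map_powMatrix, ← det_powMatrix_comp]
    have h3 : powMatrix (torusEntry (m + 1) u) (shiftedEll (m + 1) (κ ∘ Fin.rev))
        = Matrix.of fun i j => torusEntry (m + 1) u i ^ shiftedEll (m + 1) κ 0
          * powMatrix (starRingEnd ℂ ∘ torusEntry (m + 1) u)
            (shiftedEll (m + 1) κ ∘ Fin.revPerm) i j := by
      ext i j
      simp only [powMatrix, Matrix.of_apply, Function.comp, hconj, Fin.revPerm_apply]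
      have := shiftedEll_comp_rev κ j
      have hu1 : torusEntry (m + 1) u i * (torusEntry (m + 1) u i)⁻¹ = 1 :=
        mul_inv_cancel₀ (torusEntry_ne_zero (m := m) u i)
      rw [← this, pow_add, mul_assoc, ← mul_pow, hu1, one_pow, mul_one]
    rw [h3, Matrix.det_mul_column, Finset.prod_pow, prod_torusEntry, one_pow, one_mul]
  -- With the trivial character, the identity `key` at weight 0 becomes the conjugation rule for Δ
  -- itself.
  have hone : char (0 : Fin m → ℕ) u = 1 := by
    have hz : shiftedEll (m + 1) (0 : Fin m → ℕ) = fun j => m - j.val := by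
      ext j; rw [shiftedEll_eq]; simp [coord]
    have h1 := deltaExp_mul_character (0 : Fin m → ℕ) u
    have h2 : (powMatrix (torusEntry (m + 1) u) (shiftedEll (m + 1) (0 : Fin m → ℕ))).det
        = deltaExp (m + 1) u := by
      have h3 := Matrix.det_projVandermonde (fun _ => 1) (torusEntry (m + 1) u)
      simp only [one_mul] at h3
      rw [deltaExp_eq, vand, ← h3]
      congr 1
      ext i j
      have hj : m - j.val = j.rev.val := by rw [Fin.val_rev]; omega
      rw [Matrix.projVandermonde_apply, one_pow, one_mul, ← hj, powMatrix, Matrix.of_apply, hz]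
    rw [h2] at h1
    exact mul_left_cancel₀ hu (h1.trans (mul_one _).symm)
  have hD : deltaExp (m + 1) u = (((Equiv.Perm.sign (Fin.revPerm : Equiv.Perm (Fin (m + 1))) :
      ℤˣ) : ℤ) : ℂ) * (starRingEnd ℂ) (deltaExp (m + 1) u) := by
    have h0 := key 0
    have hz : ((0 : Fin m → ℕ) ∘ Fin.rev) = 0 := rfl
    rw [hz, ← deltaExp_mul_character] at h0
    change _ * char 0 u = _ * (starRingEnd ℂ) (_ * char 0 u) at h0
    rwa [hone, mul_one] at h0
  have h1 := key κ
  rw [← deltaExp_mul_character, ← deltaExp_mul_character, map_mul, ← mul_assoc, ← hD] at h1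
  exact mul_left_cancel₀ hu h1

/-- R̂ is real, so the conjugate expansion is another expansion of R̂; independence identifies the
two. -/
theorem mapDomain_rev_eq_self {r : (Fin m → ℕ) →₀ ℚ}
    (h : Finsupp.linearCombination ℚ char r = fun u : Fin m → ℝ => (Rhat (m + 1) u : ℂ)) :
    Finsupp.mapDomain (fun κ : Fin m → ℕ => κ ∘ Fin.rev) r = r := by
  refine linearIndependent_char ?_
  rw [Finsupp.linearCombination_mapDomain, h]
  have h1 : (char ∘ fun κ : Fin m → ℕ => κ ∘ Fin.rev) = fun κ u => (starRingEnd ℂ) (char κ u) :=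
    funext fun κ => char_comp_rev κ
  rw [h1]
  ext u
  have h2 := congrArg (starRingEnd ℂ) (congrFun h u)
  rw [Complex.conj_ofReal, Finsupp.linearCombination_apply, Finsupp.sum, Finset.sum_apply,
    map_sum] at h2
  rw [← h2, Finsupp.linearCombination_apply, Finsupp.sum, Finset.sum_apply]
  refine Finset.sum_congr rfl fun κ _ => ?_
  simp only [Pi.smul_apply, Rat.smul_def, map_mul]
  simp

theorem apply_comp_rev {r : (Fin m → ℕ) →₀ ℚ}
    (h : Finsupp.linearCombination ℚ char r = fun u : Fin m → ℝ => (Rhat (m + 1) u : ℂ))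
    (κ : Fin m → ℕ) : r (κ ∘ Fin.rev) = r κ := by
  have hinj : Function.Injective fun κ : Fin m → ℕ => κ ∘ Fin.rev := by
    intro a b hab
    ext k
    have := congrFun hab k.rev
    simpa using this
  have := Finsupp.mapDomain_apply hinj r κ
  rwa [mapDomain_rev_eq_self h] at this

theorem R_eq_Rhat (hn : Odd (m + 1)) : R (m + 1) = Rhat (m + 1) := by
  have h : ∀ u N, DPartial (m + 1) u N = DhatPartial (m + 1) u N := by
    intro u N
    refine Finset.sum_congr rfl fun p _ => ?_
    have he : Even ((((m + 1 : ℕ) : ℤ) - 1)) := by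
      obtain ⟨k, hk⟩ := hn
      exact ⟨k, by omega⟩
    rw [(he.mul_right _).neg_one_zpow, one_mul]
  have hD : D (m + 1) = Dhat (m + 1) := by
    ext u
    unfold D Dhat
    congr 1
    ext N
    exact h u N
  unfold R Rhat
  rw [hD]

theorem exists_symmetric (hm : 1 ≤ m) : ∃ p : MvPolynomial (Fin (m + 1)) ℝ, p.IsSymmetric ∧
    ∀ u : Fin m → ℝ, (Rhat (m + 1) u : ℂ) = MvPolynomial.aeval (torusEntry (m + 1) u) p := by
  obtain ⟨r, hr⟩ := exists_expansion hm
  refine ⟨∑ κ ∈ r.support, MvPolynomial.C (r κ : ℝ)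
    * MvPolynomial.map (Int.castRingHom ℝ) (schur (shiftedEll (m + 1) κ)), ?_, fun u => ?_⟩
  · intro w
    rw [map_sum]
    refine Finset.sum_congr rfl fun κ _ => ?_
    rw [map_mul, MvPolynomial.rename_C, ← MvPolynomial.map_rename, schur_isSymmetric _ w]
  · rw [← congrFun hr u, linearCombination_char_apply, map_sum]
    refine Finset.sum_congr rfl fun κ _ => ?_
    rw [map_mul, MvPolynomial.aeval_C, character_eq]
    congr 1
    dsimp only
    rw [MvPolynomial.aeval_def, MvPolynomial.aeval_def, MvPolynomial.eval₂_map]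
    congr 1

end

/-! ### Plane waves and their antisymmetrization. -/

variable {m : ℕ}

/-- The Laurent monomial with the given exponents in the eigenvalues. -/
def mono (e : Fin (m + 1) → ℤ) (u : Fin m → ℝ) : ℂ := ∏ k, torusEntry (m + 1) u k ^ e k

theorem norm_mono (e : Fin (m + 1) → ℤ) (u : Fin m → ℝ) : ‖mono e u‖ = 1 := by
  rw [mono, norm_prod]
  exact Finset.prod_eq_one fun k _ => by rw [norm_zpow, norm_torusEntry, one_zpow]

theorem continuous_mono (e : Fin (m + 1) → ℤ) : Continuous (mono e : (Fin m → ℝ) → ℂ) :=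
  continuous_finsetProd _ fun k _ =>
    (continuous_torusEntry k).zpow₀ _ fun u => Or.inl (torusEntry_ne_zero u k)

/-- Exponents of sum zero do not see the mean of the coordinates. The resulting phase is integral in
the partial sums of u, whence the periodicity in `mono_shift`. -/
theorem mono_eq_exp {e : Fin (m + 1) → ℤ} (he : ∑ k, e k = 0) (u : Fin m → ℝ) :
    mono e u = Complex.exp (Complex.I * (∑ k, coord u k * e k : ℝ)) := by
  have h1 : mono e u = Complex.exp (Complex.I * (∑ k, angle (m + 1) u k * e k : ℝ)) := by
    simp only [mono, torusEntry, ← Complex.exp_int_mul]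
    rw [← Complex.exp_sum]
    congr 1
    push_cast
    rw [Finset.mul_sum]
    refine Finset.sum_congr rfl fun k _ => ?_
    ring
  have h2 : ∑ k, angle (m + 1) u k * (e k : ℝ) = ∑ k, coord u k * (e k : ℝ) := by
    simp only [angle_eq, sub_mul, Finset.sum_sub_distrib, ← Finset.mul_sum]
    rw [← Int.cast_sum, he]
    simp
  rw [h1, h2]

theorem mono_shift {e : Fin (m + 1) → ℤ} (he : ∑ k, e k = 0) (u : Fin m → ℝ) (p : Fin m → ℤ) :
    mono e (shift (m + 1) u p : Fin m → ℝ) = mono e u := by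
  obtain ⟨v, hv⟩ : ∃ v : Fin m → ℝ, v = shift (m + 1) u p := ⟨_, rfl⟩
  rw [← hv, mono_eq_exp he, mono_eq_exp he]
  have : ∑ k, coord v k * (e k : ℝ)
      = ∑ k, coord u k * (e k : ℝ) + ((∑ k, coord p k * e k : ℤ) : ℝ) * (2 * Real.pi) := by
    push_cast
    rw [Finset.sum_mul, ← Finset.sum_add_distrib]
    refine Finset.sum_congr rfl fun k _ => ?_
    rw [hv, coord_shift]
    ring
  rw [this, Complex.ofReal_add, mul_add, Complex.exp_add]
  have h2 : Complex.I * (((∑ k, coord p k * e k : ℤ) : ℝ) * (2 * Real.pi) : ℝ)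
      = ((∑ k, coord p k * e k : ℤ) : ℂ) * (2 * Real.pi * Complex.I) := by
    push_cast; ring
  rw [h2, Complex.exp_int_mul_two_pi_mul_I, mul_one]

theorem mono_perm (e : Fin (m + 1) → ℤ) (w : Equiv.Perm (Fin (m + 1))) (u : Fin m → ℝ) :
    mono e (perm w u) = mono (e ∘ w.symm) u := by
  simp only [mono, torusEntry_perm, Function.comp]
  rw [← Equiv.prod_comp w fun k => torusEntry (m + 1) u k ^ e (w.symm k)]
  simp

/-- The antisymmetrization of `mono e`. -/
def altMono (e : Fin (m + 1) → ℤ) (u : Fin m → ℝ) : ℂ :=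
  ∑ w : Equiv.Perm (Fin (m + 1)), ((Equiv.Perm.sign w : ℤˣ) : ℤ) * mono e (perm w u)

/-- Periodic numerators that are bounded continuous multiples of `deltaExp`. -/
def Divisible (W : (Fin m → ℝ) → ℂ) : Prop :=
  (∀ u p, W (shift (m + 1) u p : Fin m → ℝ) = W u) ∧
    ∃ S : (Fin m → ℝ) → ℂ, Continuous S ∧ (∃ C : ℝ, ∀ u, ‖S u‖ ≤ C) ∧
      ∀ u, W u = deltaExp (m + 1) u * S u

theorem Divisible.sum {ι : Type*} (s : Finset ι) {W : ι → (Fin m → ℝ) → ℂ} (c : ι → ℂ)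
    (h : ∀ i, Divisible (W i)) : Divisible fun u => ∑ i ∈ s, c i * W i u := by
  have hp := fun i => (h i).1
  choose S hS hC hW using fun i => (h i).2
  choose C hC using hC
  refine ⟨fun u p => Finset.sum_congr rfl fun i _ => by rw [hp i], fun u => ∑ i ∈ s, c i * S i u,
    continuous_finsetSum _ fun i _ => continuous_const.mul (hS i),
    ⟨∑ i ∈ s, ‖c i‖ * C i, fun u => (norm_sum_le _ _).trans (Finset.sum_le_sum fun i _ => ?_)⟩,
    fun u => ?_⟩
  · rw [norm_mul]
    exact mul_le_mul_of_nonneg_left (hC i u) (norm_nonneg _)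
  · rw [Finset.mul_sum]
    exact Finset.sum_congr rfl fun i _ => by rw [hW i]; ring

theorem exists_norm_aeval_torusEntry_le (p : MvPolynomial (Fin (m + 1)) ℤ) :
    ∃ C : ℝ, ∀ u : Fin m → ℝ, ‖MvPolynomial.aeval (torusEntry (m + 1) u) p‖ ≤ C := by
  induction p using MvPolynomial.induction_on with
  | C a => exact ⟨‖(a : ℂ)‖, fun u => by simp⟩
  | add p q hp hq =>
    obtain ⟨C, hC⟩ := hp
    obtain ⟨D, hD⟩ := hq
    exact ⟨C + D, fun u => by rw [map_add]; exact norm_add_le_of_le (hC u) (hD u)⟩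
  | mul_X p i hp =>
    obtain ⟨C, hC⟩ := hp
    exact ⟨C, fun u => by
      rw [map_mul, MvPolynomial.aeval_X, norm_mul, norm_torusEntry, mul_one]; exact hC u⟩

/-- A common shift makes the exponents nonnegative without changing the function. The result is an
alternant, that is Δ times a Schur polynomial, which is bounded on the torus. -/
theorem divisible_altMono {e : Fin (m + 1) → ℤ} (he : ∑ k, e k = 0) : Divisible (altMono e) := by
  refine ⟨fun u p => ?_, ?_⟩
  · refine Finset.sum_congr rfl fun w _ => ?_
    rw [perm_shift, mono_shift he]
  · obtain ⟨l, c, hl⟩ : ∃ (l : Fin (m + 1) → ℕ) (c : ℤ), ∀ k, (l k : ℤ) = e k + c := by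
      refine ⟨fun k => (e k + ∑ i, |e i|).toNat, ∑ i, |e i|, fun k => Int.toNat_of_nonneg ?_⟩
      have := Finset.single_le_sum (f := fun i => |e i|) (fun _ _ => abs_nonneg _)
        (Finset.mem_univ k)
      have := neg_abs_le (e k)
      linarith
    refine ⟨fun u => MvPolynomial.aeval (torusEntry (m + 1) u) (schur l),
      continuous_aeval_torusEntry _, exists_norm_aeval_torusEntry_le _, fun u => ?_⟩
    rw [deltaExp_eq, ← det_powMatrix, Matrix.det_apply, altMono]
    refine Finset.sum_congr rfl fun w _ => ?_
    rw [Units.smul_def, zsmul_eq_mul]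
    congr 1
    have h1 : ∏ k, torusEntry (m + 1) u (w k) = 1 := by
      rw [Equiv.prod_comp w]; exact prod_torusEntry u
    calc mono e (perm w u) = (∏ k, torusEntry (m + 1) u (w k) ^ e k) * 1 := by
          rw [mono, torusEntry_perm, mul_one]; rfl
      _ = (∏ k, torusEntry (m + 1) u (w k) ^ e k) * ∏ k, torusEntry (m + 1) u (w k) ^ c := by
          rw [Finset.prod_zpow, h1, one_zpow]
      _ = ∏ k, powMatrix (torusEntry (m + 1) u) l (w k) k := by
          rw [← Finset.prod_mul_distrib]
          refine Finset.prod_congr rfl fun k _ => ?_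
          rw [← zpow_add₀ (torusEntry_ne_zero u _), ← hl, zpow_natCast]
          rfl

/-- `∑_{j ≥ i} λ_j`, as an integer. -/
def ellInt (lam : Fin (m + 1) → ℤ) (i : Fin (m + 1)) : ℤ := ∑ j ∈ Finset.Ici i, lam j

theorem sum_ellInt (lam : Fin (m + 1) → ℤ) :
    ∑ i, ellInt lam i = ∑ k : Fin (m + 1), ((k.val : ℤ) + 1) * lam k := by
  simp only [ellInt]
  rw [Finset.sum_comm' (t' := Finset.univ) (s' := fun k => Finset.Iic k) (by simp)]
  refine Finset.sum_congr rfl fun k _ => ?_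
  simp

/-- The exponents of the plane wave with frequencies `A(P, P', P'')`. -/
def expo (lam mu nu : Fin (m + 1) → ℤ) (P P' P'' : Equiv.Perm (Fin (m + 1)))
    (k : Fin (m + 1)) : ℤ :=
  ellInt lam (P k) + ellInt mu (P' k) - ellInt nu (P'' k)

theorem sum_expo {lam mu nu : Fin (m + 1) → ℤ} (h : Compatible (m + 1) lam mu nu)
    (P P' P'' : Equiv.Perm (Fin (m + 1))) : ∑ k, expo lam mu nu P P' P'' k = 0 := by
  simp only [expo, Finset.sum_add_distrib, Finset.sum_sub_distrib]
  rw [Equiv.sum_comp P, Equiv.sum_comp P', Equiv.sum_comp P'', sum_ellInt, sum_ellInt, sum_ellInt,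
    ← Finset.sum_add_distrib, ← Finset.sum_sub_distrib, ← h]
  exact Finset.sum_congr rfl fun k _ => by ring

/-- Summation by parts between the u_j and the coordinates; compatibility removes the trace term
from A. -/
theorem planeWave_A {lam mu nu : Fin (m + 1) → ℤ} (h : Compatible (m + 1) lam mu nu)
    (P P' P'' : Equiv.Perm (Fin (m + 1))) (u : Fin m → ℝ) :
    planeWave (m + 1) (A (m + 1) (ell (m + 1) lam) (ell (m + 1) mu) (ell (m + 1) nu) P P' P'') u
      = mono (expo lam mu nu P P' P'') u := by
  have hs := sum_expo h P P' P''
  rw [mono_eq_exp hs, planeWave, ← Complex.exp_sum]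
  congr 1
  have hell : ∀ (l : Fin (m + 1) → ℤ) i, ell (m + 1) l i = ellInt l i := fun l i => by
    simp [ell, ellInt]
  have hA : ∀ j : Fin m, A (m + 1) (ell (m + 1) lam) (ell (m + 1) mu) (ell (m + 1) nu) P P' P'' j
      = ∑ k : Fin (m + 1), if k.val ≤ j.val then (expo lam mu nu P P' P'' k : ℝ) else 0 := by
    intro j
    have h0 : ∑ k, (ell (m + 1) lam k + ell (m + 1) mu k - ell (m + 1) nu k) = 0 := by
      have := sum_expo h 1 1 1
      simp only [hell]
      exact_mod_cast this
    rw [A, h0, mul_zero, sub_zero]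
    refine Finset.sum_congr rfl fun k _ => ?_
    simp only [hell, expo]
    push_cast
    rfl
  have h2 : ∑ k, coord u k * (expo lam mu nu P P' P'' k : ℝ) = ∑ j : Fin m, u j *
      A (m + 1) (ell (m + 1) lam) (ell (m + 1) mu) (ell (m + 1) nu) P P' P'' j := by
    simp only [coord, Finset.sum_mul]
    rw [Finset.sum_comm]
    refine Finset.sum_congr rfl fun j _ => ?_
    rw [hA, Finset.mul_sum]
    refine Finset.sum_congr rfl fun k _ => ?_
    split_ifs <;> simp
  rw [h2]
  push_cast
  rw [Finset.mul_sum]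
  exact Finset.sum_congr rfl fun j _ => by ring

/-- For fixed P' P⁻¹ and P'' P⁻¹ the sum over P is an antisymmetrization; the sign of P occurs three
times, leaving one. -/
theorem alternatingWave_eq {lam mu nu : Fin (m + 1) → ℤ} (h : Compatible (m + 1) lam mu nu)
    (u : Fin m → ℝ) :
    alternatingWave (m + 1) (ell (m + 1) lam) (ell (m + 1) mu) (ell (m + 1) nu) u
      = ∑ Q : Equiv.Perm (Fin (m + 1)) × Equiv.Perm (Fin (m + 1)),
          ((Equiv.Perm.sign Q.1 * Equiv.Perm.sign Q.2 : ℤˣ) : ℂ)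
            * altMono (expo lam mu nu 1 Q.1 Q.2) u := by
  simp only [alternatingWave, altMono, Finset.mul_sum]
  rw [Finset.sum_comm (s := (Finset.univ : Finset (Equiv.Perm (Fin (m + 1)) ×
    Equiv.Perm (Fin (m + 1))))), ← Equiv.sum_comp (Equiv.inv (Equiv.Perm (Fin (m + 1))))]
  refine Finset.sum_congr rfl fun P _ => ?_
  rw [Fintype.sum_prod_type, ← Equiv.sum_comp (Equiv.mulRight P⁻¹)]
  refine Finset.sum_congr rfl fun Q _ => ?_
  rw [← Equiv.sum_comp (Equiv.mulRight P⁻¹)]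
  refine Finset.sum_congr rfl fun Q' _ => ?_
  rw [mono_perm, planeWave_A h, ← mul_assoc]
  congr 1
  simp only [Equiv.inv_apply, Equiv.coe_mulRight, Equiv.Perm.sign_mul, Equiv.Perm.sign_inv]
  rcases Int.units_eq_one_or (Equiv.Perm.sign P) with h1 | h1 <;>
    simp [h1]

theorem divisible_alternatingWave {lam mu nu : Fin (m + 1) → ℤ}
    (h : Compatible (m + 1) lam mu nu) : Divisible (m := m)
      (alternatingWave (m + 1) (ell (m + 1) lam) (ell (m + 1) mu) (ell (m + 1) nu)) := by
  have := Divisible.sum Finset.univ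
    (fun Q : Equiv.Perm (Fin (m + 1)) × Equiv.Perm (Fin (m + 1)) =>
      ((Equiv.Perm.sign Q.1 * Equiv.Perm.sign Q.2 : ℤˣ) : ℂ))
    fun Q => divisible_altMono (sum_expo h 1 Q.1 Q.2)
  convert! this using 2 with u
  exact alternatingWave_eq h u

/-! ### The cube as a fundamental domain. -/

/-- The cube `(-π, π)^m`. -/
abbrev cell (m : ℕ) : Set (Fin m → ℝ) := cube (m + 1)

/-- Translation of `ℝ^m` by `2πℤ^m`. -/
instance latticeAction : AddAction (Fin m → ℤ) (Fin m → ℝ) where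
  vadd p u := (shift (m + 1) u p : Fin m → ℝ)
  zero_vadd u := shift_zero u
  add_vadd p q u := by
    ext k
    change u k + ((p k + q k : ℤ) : ℝ) * _ = u k + (q k : ℝ) * _ + (p k : ℝ) * _
    push_cast
    ring

theorem vadd_eq_shift (p : Fin m → ℤ) (u : Fin m → ℝ) :
    p +ᵥ u = (shift (m + 1) u p : Fin m → ℝ) := rfl

theorem measurePreserving_shift (p : Fin m → ℤ) :
    MeasurePreserving (fun u : Fin m → ℝ => (shift (m + 1) u p : Fin m → ℝ)) volume volume :=
  measurePreserving_add_right volume (fun k => (p k : ℝ) * (2 * Real.pi))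

instance : MeasurableConstVAdd (Fin m → ℤ) (Fin m → ℝ) where
  measurable_const_vadd p := (continuous_shift p).measurable

instance : VAddInvariantMeasure (Fin m → ℤ) (Fin m → ℝ) volume where
  measure_preimage_vadd p _ hs := (measurePreserving_shift p).measure_preimage hs.nullMeasurableSet

theorem isOpen_cube : IsOpen (cell m) := by
  have : cell m = Set.univ.pi fun _ => Set.Ioo (-Real.pi) Real.pi := by
    ext u
    simp [cube]
  rw [this]
  exact isOpen_set_pi Set.finite_univ fun _ _ => isOpen_Ioo

theorem cube_subset : (cell m) ⊆ Metric.closedBall 0 Real.pi := by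
  intro u hu
  rw [mem_closedBall_zero_iff, pi_norm_le_iff_of_nonneg Real.pi_pos.le]
  exact fun k => abs_le.mpr ⟨(hu k).1.le, (hu k).2.le⟩

theorem volume_cube_lt_top : volume (cell m) < ⊤ :=
  (measure_mono cube_subset).trans_lt measure_closedBall_lt_top

theorem isAddFundamentalDomain_cube :
    IsAddFundamentalDomain (Fin m → ℤ) (cell m) := by
  refine IsAddFundamentalDomain.mk'' isOpen_cube.measurableSet.nullMeasurableSet ?_ ?_
    fun p => (measurePreserving_shift p).quasiMeasurePreserving
  · have h : ∀ k : Fin m, ∀ j : ℤ, ∀ᵐ u : Fin m → ℝ, u k ≠ (2 * j + 1) * Real.pi := by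
      intro k j
      have := volume_coord_sub_eq (m := m) k.castSucc k.succ (Fin.castSucc_lt_succ).ne
        ((2 * j + 1) * Real.pi)
      rw [ae_iff]
      refine (congrArg volume ?_).trans this
      ext u
      rw [Set.mem_ofPred_eq, Set.mem_ofPred_eq, coord_castSucc, add_sub_cancel_right, not_not]
    filter_upwards [ae_all_iff.mpr fun k => ae_all_iff.mpr (h k)] with u hu
    -- This translation brings every coordinate into [-π, π); the excluded hyperplanes rule out the
    -- endpoint -π.
    refine ⟨fun k => -⌊(u k + Real.pi) / (2 * Real.pi)⌋, fun k => ?_⟩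
    have hpi := Real.pi_pos
    have h1 := Int.floor_le ((u k + Real.pi) / (2 * Real.pi))
    have h2 := Int.lt_floor_add_one ((u k + Real.pi) / (2 * Real.pi))
    have h3 := hu k (⌊(u k + Real.pi) / (2 * Real.pi)⌋ - 1)
    have e : ((fun k => -⌊(u k + Real.pi) / (2 * Real.pi)⌋ : Fin m → ℤ) +ᵥ u) k
      = u k + ((-⌊(u k + Real.pi) / (2 * Real.pi)⌋ : ℤ) : ℝ) * (2 * Real.pi) := rfl
    rw [e]
    rw [le_div_iff₀ (by positivity)] at h1
    rw [div_lt_iff₀ (by positivity)] at h2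
    push_cast at h3 ⊢
    refine ⟨lt_of_le_of_ne (by linarith) fun h => h3 (by linarith), by linarith⟩
  · intro p hp
    refine Disjoint.aedisjoint (Set.disjoint_left.mpr ?_)
    rintro _ ⟨u, hu, rfl⟩ hv
    refine hp (funext fun k => ?_)
    have h1 := hu k
    have h2 : u k + (p k : ℝ) * (2 * Real.pi) ∈ Set.Ioo (-Real.pi) Real.pi := hv k
    have hpi := Real.pi_pos
    have h3 : (p k : ℝ) < 1 := by
      by_contra! h
      nlinarith [h1.1, h2.2]
    have h4 : (-1 : ℝ) < p k := by
      by_contra! h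
      nlinarith [h1.2, h2.1]
    have h5 : p k < 1 := by exact_mod_cast h3
    have h6 : -1 < p k := by exact_mod_cast h4
    change p k = 0
    omega

/-- The cube need not be invariant, but its image is again a fundamental domain because the group
normalizes the lattice. Periodic functions have the same integral over both. -/
theorem setIntegral_cube_comp_perm (w : Equiv.Perm (Fin (m + 1))) {f : (Fin m → ℝ) → ℂ}
    (hf : ∀ u p, f (shift (m + 1) u p : Fin m → ℝ) = f u) :
    ∫ u in cell m, f (perm w u)
      = ∫ u in cell m, f u := by
  have h1 : IsAddFundamentalDomain (Fin m → ℤ) (perm w⁻¹ ⁻¹' cell m) volume :=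
    isAddFundamentalDomain_cube.preimage_of_equiv
      (measurePreserving_perm w⁻¹).quasiMeasurePreserving (permInt w⁻¹).symm.bijective
      fun p u => (perm_shift _ _ _).trans (by rw [Equiv.apply_symm_apply]; rfl)
  have h2 := (measurePreserving_perm w).setIntegral_preimage_emb (permEquiv w).measurableEmbedding f
    (perm w⁻¹ ⁻¹' cell m)
  rw [isAddFundamentalDomain_cube.setIntegral_eq h1 (f := f) fun p u => hf u p, ← h2,
    ← Set.preimage_comp]
  have : perm w⁻¹ ∘ perm w = (id : (Fin m → ℝ) → _) := by
    ext u
    simp [← perm_mul]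
  rw [this, Set.preimage_id]

/-! ### The compactified kernel and the absolutely convergent integrals. -/

/-- `R̂_n / Δ(e^{it})`. -/
def kern (u : Fin m → ℝ) : ℂ := (Rhat (m + 1) u : ℂ) / deltaExp (m + 1) u

theorem kern_of_not_regular {u : Fin m → ℝ} (hu : u ∉ regular (m + 1)) : kern u = 0 := by
  have : deltaExp (m + 1) u = 0 := not_not.mp hu
  rw [kern, this, div_zero]

theorem I_pow_mul_kern (hm : 1 ≤ m) {u : Fin m → ℝ} (hu : u ∈ regular (m + 1)) :
    Complex.I ^ ((m + 1) * m / 2) * kern u = Dhat (m + 1) u := by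
  have h := (mem_regular_iff u).mp hu
  have h' : (varpi (m + 1) u : ℂ) ≠ 0 := by exact_mod_cast h
  rw [kern, (Rhat_spec hm).2.2 u hu, deltaExp_eq_varpi]
  push_cast
  field_simp

theorem Dhat_shift (hm : 2 ≤ m) {u : Fin m → ℝ} (hu : u ∈ regular (m + 1)) (p : Fin m → ℤ) :
    Dhat (m + 1) (shift (m + 1) u p : Fin m → ℝ) = Dhat (m + 1) u := by
  have h1 := hasSum_Dhat hm (shift_mem_regular hu p)
  have h2 := (Equiv.addRight p).hasSum_iff.mpr (hasSum_Dhat hm hu)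
  refine h1.unique ?_
  convert! h2 using 2 with q
  have := add_vadd q p u
  simp only [vadd_eq_shift] at this
  rw [Function.comp, ← this]
  rfl

/-- For m ≥ 2 the kernel is D̂ up to a constant on regular points. For m = 1 numerator cos(u/2) and
denominator change by the same sign. -/
theorem kern_shift (hm : 1 ≤ m) (u : Fin m → ℝ) (p : Fin m → ℤ) :
    kern (shift (m + 1) u p : Fin m → ℝ) = kern u := by
  by_cases hu : u ∈ regular (m + 1)
  · have hv := shift_mem_regular hu p
    rcases (by omega : m = 1 ∨ 2 ≤ m) with rfl | hm
    · have h0 : latticeSign p ≠ 0 := left_ne_zero_of_mul_eq_one (latticeSign_mul_self p)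
      have i0 : Finset.Ioi (0 : Fin 2) = {1} := by decide
      have i1 : Finset.Ioi (1 : Fin 2) = ∅ := by decide
      have e0 : coord p 0 = p 0 := by simp [coord]
      have e1 : coord p 1 = 0 := coord_last p
      have h1 : latticeSign p = (-1 : ℝ) ^ (p 0) := by
        rw [latticeSign, Fin.prod_univ_two, i0, i1, Finset.prod_singleton, Finset.prod_empty,
          mul_one, e0, e1, sub_zero]
      have h2 : Rhat (1 + 1) (shift (1 + 1) u p : Fin 1 → ℝ)
          = latticeSign p * Rhat (1 + 1) u := by
        rw [Rhat_two, h1]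
        have : (shift (1 + 1) u p : Fin 1 → ℝ) 0 / 2 = u 0 / 2 + (p 0 : ℝ) * Real.pi := by
          change (u 0 + (p 0 : ℝ) * (2 * Real.pi)) / 2 = _
          ring
        dsimp only
        rw [this, Real.cos_add_int_mul_pi]
      have h0' : (latticeSign p : ℂ) ≠ 0 := by exact_mod_cast h0
      rw [kern, kern, h2, deltaExp_eq_varpi, deltaExp_eq_varpi, varpi_shift]
      push_cast
      rw [mul_left_comm, mul_div_mul_left _ _ h0']
    · have h := I_pow_mul_kern (by omega) hv
      rw [Dhat_shift hm hu, ← I_pow_mul_kern (by omega) hu] at h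
      exact mul_left_cancel₀ (pow_ne_zero _ Complex.I_ne_zero) h
  · rw [kern_of_not_regular hu, kern_of_not_regular]
    intro h
    have := shift_mem_regular (m := m) h (-p)
    have h2 := neg_vadd_vadd p u
    simp only [vadd_eq_shift] at h2
    rw [h2] at this
    exact hu this

theorem sign_inv_coe (w : Equiv.Perm (Fin (m + 1))) :
    ((((Equiv.Perm.sign w : ℤˣ) : ℤ) : ℂ))⁻¹ = ((Equiv.Perm.sign w : ℤˣ) : ℤ) := by
  rcases Int.units_eq_one_or (Equiv.Perm.sign w) with h | h <;> simp [h]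

theorem kern_perm (hm : 1 ≤ m) (w : Equiv.Perm (Fin (m + 1))) (u : Fin m → ℝ) :
    kern (perm w u) = ((Equiv.Perm.sign w : ℤˣ) : ℤ) * kern u := by
  rw [kern, kern, Rhat_perm hm, deltaExp_perm, div_eq_mul_inv, mul_inv, sign_inv_coe, mul_left_comm,
    div_eq_mul_inv]

theorem measurable_kern (hm : 1 ≤ m) : Measurable (kern : (Fin m → ℝ) → ℂ) :=
  (Complex.continuous_ofReal.comp (Rhat_spec hm).1).measurable.div continuous_deltaExp.measurable

theorem Divisible.continuous {W : (Fin m → ℝ) → ℂ} (hW : Divisible W) : Continuous W := by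
  obtain ⟨-, S, hS, -, h⟩ := hW
  rw [funext h]
  exact continuous_deltaExp.mul hS

theorem Divisible.norm_mul_kern_le {W : (Fin m → ℝ) → ℂ} (hW : Divisible W) :
    ∃ C : ℝ, ∀ u, ‖W u * kern u‖ ≤ C * ‖Rhat (m + 1) u‖ := by
  obtain ⟨-, S, -, ⟨C, hC⟩, h⟩ := hW
  refine ⟨C, fun u => ?_⟩
  have hC0 := (norm_nonneg _).trans (hC u)
  by_cases hu : deltaExp (m + 1) u = 0
  · rw [kern, hu, div_zero, mul_zero, norm_zero]
    positivity
  · rw [h, kern, mul_right_comm, mul_div_cancel₀ _ hu, norm_mul, Complex.norm_real, mul_comm]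
    exact mul_le_mul_of_nonneg_right (hC u) (norm_nonneg _)

theorem Divisible.norm_div_deltaTilde_le {W : (Fin m → ℝ) → ℂ} (hW : Divisible W) :
    ∃ C : ℝ, ∀ u, ‖W u / deltaTilde (m + 1) u‖ ≤ C * |sincProd u| := by
  obtain ⟨-, S, -, ⟨C, hC⟩, h⟩ := hW
  refine ⟨C, fun u => ?_⟩
  have hC0 := (norm_nonneg _).trans (hC u)
  by_cases hu : deltaTilde (m + 1) u = 0
  · rw [hu, Complex.ofReal_zero, div_zero, norm_zero]
    positivity
  · rw [h, deltaExp_eq_varpi, ← sincProd_mul_deltaTilde, norm_div, norm_mul, norm_mul, norm_pow,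
      Complex.norm_I, one_pow, one_mul, Complex.norm_real, Complex.norm_real, norm_mul,
      mul_right_comm, mul_div_cancel_right₀ _ (norm_ne_zero_iff.mpr hu), mul_comm,
      Real.norm_eq_abs]
    exact mul_le_mul_of_nonneg_right (hC u) (abs_nonneg _)

theorem Divisible.integrableOn_mul_kern (hm : 1 ≤ m) {W : (Fin m → ℝ) → ℂ} (hW : Divisible W) :
    IntegrableOn (fun u => W u * kern u) (cell m) := by
  obtain ⟨C, hC⟩ := hW.norm_mul_kern_le
  have hR : IntegrableOn (fun u : Fin m → ℝ => C * ‖Rhat (m + 1) u‖) (cell m) :=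
    ((continuous_const.mul (Rhat_spec hm).1.norm).continuousOn.integrableOn_compact
      (isCompact_closedBall (0 : Fin m → ℝ) Real.pi)).mono_set cube_subset
  exact Integrable.mono' hR (hW.continuous.measurable.mul (measurable_kern hm)).aestronglyMeasurable
    (ae_of_all _ hC)

theorem Divisible.measurable_div {W : (Fin m → ℝ) → ℂ} (hW : Divisible W) :
    Measurable fun u => W u / (deltaTilde (m + 1) u : ℂ) :=
  hW.continuous.measurable.div (Complex.continuous_ofReal.comp continuous_deltaTilde).measurable

theorem Divisible.exists_norm_div_shift_le {W : (Fin m → ℝ) → ℂ} (hW : Divisible W) :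
    ∃ C : ℝ, ∀ u ∈ cell m, ∀ p : Fin m → ℤ,
      ‖W (shift (m + 1) u p : Fin m → ℝ)
        / deltaTilde (m + 1) (shift (m + 1) u p : Fin m → ℝ)‖ ≤ C * wtProd p := by
  obtain ⟨C, hC⟩ := hW.norm_div_deltaTilde_le
  obtain ⟨D, hD⟩ := abs_sincProd_shift_le (m := m) Real.pi
  refine ⟨|C| * D, fun u hu p => (hC _).trans ?_⟩
  rw [mul_assoc]
  exact mul_le_mul (le_abs_self C) (hD u (fun k => abs_le.mpr ⟨(hu k).1.le, (hu k).2.le⟩) p)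
    (abs_nonneg _) (abs_nonneg _)

/-- The translate of the cube by p contributes at most a constant times `wtProd p`. -/
theorem Divisible.integrable_div (hm : 2 ≤ m) {W : (Fin m → ℝ) → ℂ} (hW : Divisible W) :
    Integrable fun u => W u / (deltaTilde (m + 1) u : ℂ) := by
  obtain ⟨C, hC⟩ := hW.exists_norm_div_shift_le
  refine ⟨hW.measurable_div.aestronglyMeasurable, ?_⟩
  rw [HasFiniteIntegral, isAddFundamentalDomain_cube.lintegral_eq_tsum'']
  have h1 : ∀ p : Fin m → ℤ, ∫⁻ u in cell m,
      ‖W (p +ᵥ u) / (deltaTilde (m + 1) (p +ᵥ u : Fin m → ℝ) : ℂ)‖ₑ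
        ≤ ENNReal.ofReal (C * wtProd p) * volume (cell m) := by
    intro p
    rw [← setLIntegral_const]
    refine setLIntegral_mono measurable_const fun u hu => ?_
    rw [← ofReal_norm]
    exact ENNReal.ofReal_le_ofReal (hC u hu p)
  refine (ENNReal.tsum_le_tsum h1).trans_lt ?_
  rw [ENNReal.tsum_mul_right]
  exact ENNReal.mul_lt_top ((summable_wtProd hm).mul_left C).tsum_ofReal_lt_top volume_cube_lt_top

/-- Unfolding: W is periodic and factors out of the sum over translates, which then is D̂. -/
theorem Divisible.integral_div (hm : 2 ≤ m) {W : (Fin m → ℝ) → ℂ} (hW : Divisible W) :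
    ∫ u, W u / (deltaTilde (m + 1) u : ℂ)
      = Complex.I ^ ((m + 1) * m / 2) * ∫ u in cell m, W u * kern u := by
  obtain ⟨C, hC⟩ := hW.exists_norm_div_shift_le
  have hint := hW.integrable_div hm
  rw [isAddFundamentalDomain_cube.integral_eq_tsum'' _ hint]
  have hmeas : ∀ p : Fin m → ℤ, Measurable fun u : Fin m → ℝ =>
      W (p +ᵥ u) / (deltaTilde (m + 1) (p +ᵥ u : Fin m → ℝ) : ℂ) := fun p =>
    hW.measurable_div.comp (measurable_const_vadd p)
  have hfin : Fact (volume (cell m) < ⊤) := ⟨volume_cube_lt_top⟩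
  have hb : ∀ p : Fin m → ℤ, ∀ᵐ u ∂(volume.restrict (cell m)),
      ‖W (p +ᵥ u) / (deltaTilde (m + 1) (p +ᵥ u : Fin m → ℝ) : ℂ)‖ ≤ C * wtProd p := fun p =>
    (ae_restrict_mem isOpen_cube.measurableSet).mono fun u hu => hC u hu p
  have h1 : ∀ p : Fin m → ℤ, Integrable (fun u : Fin m → ℝ =>
      W (p +ᵥ u) / (deltaTilde (m + 1) (p +ᵥ u : Fin m → ℝ) : ℂ)) (volume.restrict (cell m)) :=
    fun p => Integrable.of_bound (hmeas p).aestronglyMeasurable _ (hb p)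
  have h2 : Summable fun p : Fin m → ℤ => ∫ u in cell m,
      ‖W (p +ᵥ u) / (deltaTilde (m + 1) (p +ᵥ u : Fin m → ℝ) : ℂ)‖ := by
    refine Summable.of_nonneg_of_le (fun p => integral_nonneg fun u => norm_nonneg _) (fun p => ?_)
      (((summable_wtProd hm).mul_left C).mul_right (volume.real (cell m)))
    refine (integral_mono_ae (h1 p).norm (integrable_const _) (hb p)).trans ?_
    rw [integral_const, smul_eq_mul, mul_comm, measureReal_restrict_apply_univ]
  rw [(hasSum_integral_of_summable_integral_norm h1 h2).tsum_eq, ← integral_const_mul]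
  refine integral_congr_ae ((ae_restrict_of_ae ae_regular).mono fun u hu => ?_)
  dsimp only
  rw [mul_left_comm, I_pow_mul_kern (by omega) hu]
  have h3 : HasSum (fun p : Fin m → ℤ =>
      ((1 / deltaTilde (m + 1) (shift (m + 1) u p) : ℝ) : ℂ)) (Dhat (m + 1) u : ℂ) :=
    Complex.hasSum_ofReal.mpr (hasSum_Dhat hm hu)
  rw [← (h3.mul_left (W u)).tsum_eq]
  refine tsum_congr fun p => ?_
  rw [vadd_eq_shift, hW.1]
  push_cast
  rw [div_eq_mul_one_div]

/-! ### Truncated regions and principal values. -/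

/-- The region of integration of `HasPVWhole`. -/
def gapRegion (m : ℕ) (q : ℝ × ℝ) : Set (Fin m → ℝ) :=
  {u | ∀ i j : Fin (m + 1), i < j → q.1 < |gap (m + 1) u i j| ∧ |gap (m + 1) u i j| < q.2}

/-- The region cut out of the cube in `HasPVCube`. -/
def expRegion (m : ℕ) (ε : ℝ) : Set (Fin m → ℝ) :=
  {u | ∀ i j : Fin (m + 1), i < j → ε < ‖torusEntry (m + 1) u i - torusEntry (m + 1) u j‖}

theorem mem_gapRegion {q : ℝ × ℝ} {u : Fin m → ℝ} : u ∈ gapRegion m q ↔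
    ∀ i j, i ≠ j → q.1 < |coord u i - coord u j| ∧ |coord u i - coord u j| < q.2 := by
  constructor
  · intro h i j hij
    rcases lt_or_gt_of_ne hij with hij | hij
    · rw [← gap_eq u hij.le]; exact h i j hij
    · rw [abs_sub_comm, ← gap_eq u hij.le]; exact h j i hij
  · intro h i j hij
    rw [gap_eq u hij.le]; exact h i j hij.ne

theorem mem_expRegion {ε : ℝ} {u : Fin m → ℝ} : u ∈ expRegion m ε ↔
    ∀ i j, i ≠ j → ε < ‖torusEntry (m + 1) u i - torusEntry (m + 1) u j‖ := by
  constructor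
  · intro h i j hij
    rcases lt_or_gt_of_ne hij with hij | hij
    · exact h i j hij
    · rw [norm_sub_rev]; exact h j i hij
  · exact fun h i j hij => h i j hij.ne

theorem isOpen_gapRegion (q : ℝ × ℝ) : IsOpen (gapRegion m q) := by
  have : gapRegion m q = ⋂ i, ⋂ j, ⋂ _ : i ≠ j, {u : Fin m → ℝ | q.1 < |coord u i - coord u j|}
      ∩ {u | |coord u i - coord u j| < q.2} := by
    ext u
    simp [mem_gapRegion]
  rw [this]
  refine isOpen_iInter_of_finite fun i => isOpen_iInter_of_finite fun j =>
    isOpen_iInter_of_finite fun _ => ?_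
  have h : Continuous fun u : Fin m → ℝ => |coord u i - coord u j| :=
    ((continuous_coord i).sub (continuous_coord j)).abs
  exact (isOpen_lt continuous_const h).inter (isOpen_lt h continuous_const)

theorem isOpen_expRegion (ε : ℝ) : IsOpen (expRegion m ε) := by
  have : expRegion m ε = ⋂ i, ⋂ j, ⋂ _ : i ≠ j,
      {u : Fin m → ℝ | ε < ‖torusEntry (m + 1) u i - torusEntry (m + 1) u j‖} := by
    ext u
    simp [mem_expRegion]
  rw [this]
  exact isOpen_iInter_of_finite fun i => isOpen_iInter_of_finite fun j =>
    isOpen_iInter_of_finite fun _ => isOpen_lt continuous_const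
      ((continuous_torusEntry i).sub (continuous_torusEntry j)).norm

theorem perm_mem_gapRegion {q : ℝ × ℝ} {u : Fin m → ℝ} (w : Equiv.Perm (Fin (m + 1))) :
    perm w u ∈ gapRegion m q ↔ u ∈ gapRegion m q := by
  rw [mem_gapRegion, mem_gapRegion]
  simp only [coord_perm, sub_sub_sub_cancel_right]
  constructor
  · intro h i j hij
    simpa using h (w.symm i) (w.symm j) (by simpa using hij)
  · exact fun h i j hij => h _ _ (by simpa using hij)

theorem perm_mem_expRegion {ε : ℝ} {u : Fin m → ℝ} (w : Equiv.Perm (Fin (m + 1))) :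
    perm w u ∈ expRegion m ε ↔ u ∈ expRegion m ε := by
  rw [mem_expRegion, mem_expRegion]
  simp only [torusEntry_perm, Function.comp]
  constructor
  · intro h i j hij
    simpa using h (w.symm i) (w.symm j) (by simpa using hij)
  · exact fun h i j hij => h _ _ (by simpa using hij)

theorem shift_mem_expRegion {ε : ℝ} {u : Fin m → ℝ} (p : Fin m → ℤ) :
    (shift (m + 1) u p : Fin m → ℝ) ∈ expRegion m ε ↔ u ∈ expRegion m ε := by
  rw [mem_expRegion, mem_expRegion]
  refine forall_congr' fun i => forall_congr' fun j => imp_congr_right fun _ => ?_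
  rw [norm_torusEntry_sub, norm_torusEntry_sub, coord_shift (m := m), coord_shift (m := m)]
  have : (coord u i + 2 * Real.pi * (coord p i : ℤ) - (coord u j + 2 * Real.pi * (coord p j : ℤ))) / 2
      = (coord u i - coord u j) / 2 + ((coord p i - coord p j : ℤ) : ℝ) * Real.pi := by
    push_cast; ring
  rw [this, Real.sin_add_int_mul_pi, abs_mul, abs_mul, abs_mul, abs_zpow, abs_neg, abs_one,
    one_zpow, one_mul]

theorem gapRegion_subset (q : ℝ × ℝ) : gapRegion m q ⊆ Metric.closedBall 0 |q.2| := by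
  intro u hu
  rw [mem_closedBall_zero_iff, pi_norm_le_iff_of_nonneg (abs_nonneg _)]
  intro k
  have := (mem_gapRegion.mp hu k.castSucc k.succ (Fin.castSucc_lt_succ).ne).2
  rw [coord_castSucc, add_sub_cancel_right] at this
  exact this.le.trans (le_abs_self _)

theorem integrableOn_gapRegion (e : Fin (m + 1) → ℤ) {q : ℝ × ℝ} (hq : 0 < q.1) :
    IntegrableOn (fun u => mono e u * (deltaTilde (m + 1) u : ℂ)⁻¹) (gapRegion m q) := by
  refine Measure.integrableOn_of_bounded
    (M := (∏ i : Fin (m + 1), ∏ _j ∈ Finset.Ioi i, q.1)⁻¹)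
    ((measure_mono (gapRegion_subset q)).trans_lt measure_closedBall_lt_top).ne
    ((continuous_mono e).measurable.mul
      (Complex.continuous_ofReal.comp continuous_deltaTilde).measurable.inv).aestronglyMeasurable
    ((ae_restrict_mem (isOpen_gapRegion q).measurableSet).mono fun u hu => ?_)
  rw [norm_mul, norm_mono, one_mul, norm_inv, Complex.norm_real, Real.norm_eq_abs]
  refine inv_anti₀ (Finset.prod_pos fun i _ => Finset.prod_pos fun j _ => hq) ?_
  rw [deltaTilde, Finset.abs_prod]
  refine Finset.prod_le_prod (fun i _ => Finset.prod_nonneg fun j _ => hq.le) fun i _ => ?_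
  rw [Finset.abs_prod]
  exact Finset.prod_le_prod (fun j _ => hq.le) fun j hj => (hu i j (Finset.mem_Ioi.mp hj)).1.le

theorem integrableOn_expRegion (hm : 1 ≤ m) (e : Fin (m + 1) → ℤ)  {ε : ℝ} (hε : 0 < ε) :
    IntegrableOn (fun u => mono e u * kern u) (cell m ∩ expRegion m ε) := by
  have hc := (Rhat_spec hm).1
  obtain ⟨B, hB⟩ := (isCompact_closedBall (0 : Fin m → ℝ) Real.pi).exists_bound_of_continuousOn
    hc.continuousOn
  refine Measure.integrableOn_of_bounded
    (M := B * (∏ i : Fin (m + 1), ∏ _j ∈ Finset.Ioi i, ε)⁻¹)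
    ((measure_mono Set.inter_subset_left).trans_lt volume_cube_lt_top).ne
    ((continuous_mono e).measurable.mul (measurable_kern hm)).aestronglyMeasurable
    ((ae_restrict_mem (isOpen_cube.inter (isOpen_expRegion ε)).measurableSet).mono fun u hu => ?_)
  have hb := hB u (cube_subset hu.1)
  have hB0 := (norm_nonneg _).trans hb
  rw [norm_mul, norm_mono, one_mul, kern, norm_div, Complex.norm_real, div_eq_mul_inv]
  refine mul_le_mul hb (inv_anti₀ (Finset.prod_pos fun i _ => Finset.prod_pos fun j _ => hε) ?_)
    (inv_nonneg.mpr (norm_nonneg _)) hB0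
  rw [deltaExp, norm_prod]
  refine Finset.prod_le_prod (fun i _ => Finset.prod_nonneg fun j _ => hε.le) fun i _ => ?_
  rw [norm_prod]
  exact Finset.prod_le_prod (fun j _ => hε.le) fun j hj => (hu.2 i j (Finset.mem_Ioi.mp hj)).le

/-- Averages the integral over the symmetric group; as g is alternating, its sign passes to the
wave. -/
theorem setIntegral_mono_mul (e : Fin (m + 1) → ℤ) {s : Set (Fin m → ℝ)} {g : (Fin m → ℝ) → ℂ}
    (hg : ∀ w u, g (perm w u) = ((Equiv.Perm.sign w : ℤˣ) : ℤ) * g u)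
    (hint : ∀ w, IntegrableOn (fun u => mono e (perm w u) * g (perm w u)) s)
    (heq : ∀ w, ∫ u in s, mono e (perm w u) * g (perm w u) = ∫ u in s, mono e u * g u) :
    ∫ u in s, mono e u * g u
      = ((m + 1).factorial : ℂ)⁻¹ * ∫ u in s, altMono e u * g u := by
  have h1 : ∀ u, altMono e u * g u
      = ∑ w : Equiv.Perm (Fin (m + 1)), mono e (perm w u) * g (perm w u) := by
    intro u
    rw [altMono, Finset.sum_mul]
    refine Finset.sum_congr rfl fun w _ => ?_
    rw [hg]
    ring
  simp only [h1]
  rw [integral_finsetSum _ fun w _ => hint w, Finset.sum_congr rfl fun w _ => heq w,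
    Finset.sum_const, Finset.card_univ, Fintype.card_perm, Fintype.card_fin, nsmul_eq_mul,
    inv_mul_cancel_left₀ (Nat.cast_ne_zero.mpr (Nat.factorial_ne_zero _))]

theorem setIntegral_gapRegion (e : Fin (m + 1) → ℤ) {q : ℝ × ℝ} (hq : 0 < q.1) :
    ∫ u in gapRegion m q, mono e u * (deltaTilde (m + 1) u : ℂ)⁻¹
      = ((m + 1).factorial : ℂ)⁻¹
        * ∫ u in gapRegion m q, altMono e u * (deltaTilde (m + 1) u : ℂ)⁻¹ := by
  have hpre : ∀ w, perm w ⁻¹' gapRegion m q = gapRegion m q := fun w =>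
    Set.ext fun u => perm_mem_gapRegion w
  refine setIntegral_mono_mul e (g := fun u => (deltaTilde (m + 1) u : ℂ)⁻¹) (fun w u => ?_)
    (fun w => ?_) fun w => ?_
  · rw [deltaTilde_perm]
    push_cast
    rw [mul_inv, sign_inv_coe]
  · have := ((measurePreserving_perm w).integrableOn_comp_preimage
      (permEquiv w).measurableEmbedding).mpr (integrableOn_gapRegion e hq)
    rwa [hpre] at this
  · have := (measurePreserving_perm w).setIntegral_preimage_emb (permEquiv w).measurableEmbedding
      (fun u => mono e u * (deltaTilde (m + 1) u : ℂ)⁻¹) (gapRegion m q)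
    rwa [hpre] at this

/-- The truncated cube need not be invariant. The cut-off is moved into the integrand as a periodic,
invariant indicator, and `setIntegral_cube_comp_perm` applies. -/
theorem setIntegral_expRegion (hm : 1 ≤ m) {e : Fin (m + 1) → ℤ} (he : ∑ k, e k = 0) {ε : ℝ}
    (hε : 0 < ε) :
    ∫ u in cell m ∩ expRegion m ε, mono e u * kern u
      = ((m + 1).factorial : ℂ)⁻¹
        * ∫ u in cell m ∩ expRegion m ε, altMono e u * kern u := by
  have hE := (isOpen_expRegion (m := m) ε).measurableSet
  refine setIntegral_mono_mul e (kern_perm hm) (fun w => ?_) fun w => ?_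
  · have h := (integrableOn_expRegion hm (e ∘ w.symm) hε).const_mul
      (((Equiv.Perm.sign w : ℤˣ) : ℤ) : ℂ)
    refine h.congr (ae_of_all _ fun u => ?_)
    dsimp only
    rw [mono_perm, kern_perm hm]
    ring
  · have h := setIntegral_cube_comp_perm w
      (f := (expRegion m ε).indicator fun u => mono e u * kern u) fun u p => by
        by_cases hu : u ∈ expRegion m ε
        · rw [Set.indicator_of_mem hu, Set.indicator_of_mem ((shift_mem_expRegion (m := m) p).mpr hu),
            mono_shift he, kern_shift hm]
        · rw [Set.indicator_of_notMem hu,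
            Set.indicator_of_notMem fun h => hu ((shift_mem_expRegion (m := m) p).mp h)]
    rw [setIntegral_indicator hE] at h
    rw [← h, ← setIntegral_indicator hE]
    refine integral_congr_ae (ae_of_all _ fun u => ?_)
    by_cases hu : u ∈ expRegion m ε
    · dsimp only
      rw [Set.indicator_of_mem hu, Set.indicator_of_mem ((perm_mem_expRegion w).mpr hu)]
    · dsimp only
      rw [Set.indicator_of_notMem hu,
        Set.indicator_of_notMem fun h => hu ((perm_mem_expRegion w).mp h)]

theorem ae_eventually_mem_expRegion :
    ∀ᵐ u : Fin m → ℝ, ∀ᶠ ε in 𝓝[>] (0 : ℝ), u ∈ expRegion m ε := by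
  filter_upwards [ae_regular] with u hu
  simp only [mem_expRegion]
  refine eventually_all.mpr fun i => eventually_all.mpr fun j => eventually_all.mpr fun hij => ?_
  refine eventually_nhdsWithin_of_eventually_nhds (eventually_lt_nhds ?_)
  rw [norm_pos_iff, sub_ne_zero]
  exact fun h => hij ((vand_ne_zero_iff.mp hu) h)

theorem ae_eventually_mem_gapRegion :
    ∀ᵐ u : Fin m → ℝ, ∀ᶠ q in 𝓝[>] (0 : ℝ) ×ˢ atTop, u ∈ gapRegion m q := by
  filter_upwards [ae_regular] with u hu
  simp only [mem_gapRegion]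
  refine eventually_all.mpr fun i => eventually_all.mpr fun j => eventually_all.mpr fun hij => ?_
  refine Eventually.and ?_ ?_
  · have h : ∀ᶠ ε in 𝓝[>] (0 : ℝ), ε < |coord u i - coord u j| := by
      refine eventually_nhdsWithin_of_eventually_nhds (eventually_lt_nhds ?_)
      rw [abs_pos]
      simpa using (mem_regular_iff_int u).mp hu i j hij 0
    exact tendsto_fst.eventually h
  · exact tendsto_snd.eventually (eventually_gt_atTop _)

/-- After antisymmetrization the integrand is integrable on the cube, and the regions exhaust almost
all of it, so the cut-off limit is the plain integral. -/
theorem hasPVCube_mono (hm : 1 ≤ m) {e : Fin (m + 1) → ℤ} (he : ∑ k, e k = 0) :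
    HasPVCube (m + 1) (fun u : Fin m → ℝ => mono e u * kern u)
      (((m + 1).factorial : ℂ)⁻¹ * ∫ u in cell m, altMono e u * kern u) := by
  have hcov : AECover (volume.restrict (cell m)) (𝓝[>] (0 : ℝ)) (expRegion m) :=
    ⟨ae_restrict_of_ae ae_eventually_mem_expRegion, fun ε => (isOpen_expRegion ε).measurableSet⟩
  have h := (hcov.integral_tendsto_of_countably_generated
    ((divisible_altMono he).integrableOn_mul_kern hm)).const_mul ((m + 1).factorial : ℂ)⁻¹
  refine h.congr' ?_
  filter_upwards [self_mem_nhdsWithin] with ε hε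
  rw [Measure.restrict_restrict (isOpen_expRegion ε).measurableSet, Set.inter_comm,
    ← setIntegral_expRegion hm he hε]
  rfl

theorem hasPVWhole_mono {e : Fin (m + 1) → ℤ} {L : ℂ}
    (h : HasPVWhole (m + 1) (fun u : Fin m → ℝ => altMono e u / (deltaTilde (m + 1) u : ℂ)) L) :
    HasPVWhole (m + 1) (fun u : Fin m → ℝ => mono e u / (deltaTilde (m + 1) u : ℂ))
      (((m + 1).factorial : ℂ)⁻¹ * L) := by
  refine (h.const_mul ((m + 1).factorial : ℂ)⁻¹).congr' ?_
  have hpos : ∀ᶠ q in 𝓝[>] (0 : ℝ) ×ˢ (atTop : Filter ℝ), 0 < q.1 :=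
    tendsto_fst.eventually self_mem_nhdsWithin
  filter_upwards [hpos] with q hq
  simp only [div_eq_mul_inv]
  exact (setIntegral_gapRegion e hq).symm

theorem Divisible.hasPVWhole (hm : 2 ≤ m) {W : (Fin m → ℝ) → ℂ} (hW : Divisible W) :
    HasPVWhole (m + 1) (fun u : Fin m → ℝ => W u / (deltaTilde (m + 1) u : ℂ))
      (Complex.I ^ ((m + 1) * m / 2) * ∫ u in cell m, W u * kern u) := by
  have hcov : AECover (volume : Measure (Fin m → ℝ)) (𝓝[>] (0 : ℝ) ×ˢ atTop) (gapRegion m) :=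
    ⟨ae_eventually_mem_gapRegion, fun ε => (isOpen_gapRegion ε).measurableSet⟩
  rw [← hW.integral_div hm]
  exact hcov.integral_tendsto_of_countably_generated (hW.integrable_div hm)

/-! ### The case n = 2, where the integral over the line is conditional. -/

/-- With b = j + 1, the opposite terms combine to -2x²/(4π²b² - x²), which is of order 1/b²
uniformly for |x| ≤ π. -/
theorem abs_mul_pair_le {x : ℝ} (hx : |x| ≤ Real.pi) (j : ℕ) :
    |x * ((x + 2 * Real.pi * ((-((j : ℤ) + 1) : ℤ) : ℝ))⁻¹
      + (x + 2 * Real.pi * (((j : ℤ) + 1 : ℤ) : ℝ))⁻¹)| ≤ 1 / ((j + 1 : ℕ) : ℝ) ^ 2 := by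
  have hpi := Real.pi_pos
  obtain ⟨b, hb⟩ : ∃ b : ℝ, b = (j : ℝ) + 1 := ⟨_, rfl⟩
  have hb1 : 1 ≤ b := by rw [hb]; linarith [(Nat.cast_nonneg j : (0 : ℝ) ≤ j)]
  have hx2 := abs_le.mp hx
  have h1 : x - 2 * Real.pi * b < 0 := by nlinarith
  have h2 : 0 < x + 2 * Real.pi * b := by nlinarith
  push_cast
  rw [← hb]
  have e : x * ((x + 2 * Real.pi * -b)⁻¹ + (x + 2 * Real.pi * b)⁻¹)
      = -(2 * x ^ 2 / ((2 * Real.pi * b - x) * (x + 2 * Real.pi * b))) := by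
    have h3 : x + 2 * Real.pi * -b = -(2 * Real.pi * b - x) := by ring
    have h4 : 2 * Real.pi * b - x ≠ 0 := by linarith
    rw [h3, inv_neg]
    have h5 := h2.ne'
    field_simp
    ring
  have h3 : 0 < 2 * Real.pi * b - x := by linarith
  rw [e, abs_neg, abs_of_nonneg (by positivity), div_le_div_iff₀ (by positivity) (by positivity)]
  have h6 : x ^ 2 ≤ Real.pi ^ 2 := sq_le_sq' hx2.1 hx2.2
  have h7 : Real.pi ^ 2 ≤ Real.pi ^ 2 * b ^ 2 := by
    have : 1 ≤ b ^ 2 := one_le_pow₀ hb1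
    nlinarith [sq_nonneg Real.pi]
  have h8 : x ^ 2 * b ^ 2 ≤ Real.pi ^ 2 * b ^ 2 := mul_le_mul_of_nonneg_right h6 (sq_nonneg b)
  nlinarith

theorem exists_norm_mul_powSum_one_le :
    ∃ C : ℝ, ∀ x : ℝ, |x| ≤ Real.pi → ∀ N, ‖(x : ℂ) * powSum 1 N x‖ ≤ C := by
  have hs : Summable fun j : ℕ => 1 / ((j + 1 : ℕ) : ℝ) ^ 2 :=
    (summable_nat_add_iff 1).mpr (Real.summable_one_div_nat_pow.mpr one_lt_two)
  refine ⟨1 + ∑' j : ℕ, 1 / ((j + 1 : ℕ) : ℝ) ^ 2, fun x hx N => ?_⟩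
  have e : (x : ℂ) * powSum 1 N x
      = ((x * ∑ s ∈ Finset.Icc (-(N : ℤ)) N, (x + 2 * Real.pi * s)⁻¹ : ℝ) : ℂ) := by
    simp [powSum]
  rw [e, Complex.norm_real, Real.norm_eq_abs, sum_Icc_neg_int, mul_add, Finset.mul_sum]
  refine (abs_add_le _ _).trans (add_le_add ?_ ?_)
  · rw [Int.cast_zero, mul_zero, add_zero]
    by_cases h : x = 0
    · simp [h]
    · rw [mul_inv_cancel₀ h, abs_one]
  · refine (Finset.abs_sum_le_sum_abs _ _).trans ?_
    refine (Finset.sum_le_sum fun j _ => abs_mul_pair_le hx j).trans ?_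
    exact hs.sum_le_tsum _ fun j _ => by positivity

theorem norm_fin_one (u : Fin 1 → ℝ) : ‖u‖ = |u 0| := by
  simp [Pi.norm_def]

theorem coord_one (u : Fin 1 → ℝ) : coord u 0 = u 0 := by simp [coord]

theorem gapRegion_one (q : ℝ × ℝ) :
    gapRegion 1 q = Metric.ball 0 q.2 \ Metric.closedBall 0 q.1 := by
  have e1 : ∀ u : Fin 1 → ℝ, coord u 1 = 0 := fun u => coord_last u
  ext u
  rw [Set.mem_sdiff, mem_ball_zero_iff, mem_closedBall_zero_iff, norm_fin_one, not_le, and_comm,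
    mem_gapRegion]
  constructor
  · intro h
    simpa [coord_one, e1] using h 0 1 (by decide)
  · intro h i j hij
    fin_cases i <;> fin_cases j <;> simp_all [coord_one]

/-- Boundedness disposes of the cut-off at 0; decay like 1/|u| controls shells at infinity. -/
theorem Divisible.exists_norm_div_le {W : (Fin 1 → ℝ) → ℂ} (hW : Divisible W) :
    ∃ C : ℝ, 0 ≤ C ∧ ∀ u, ‖W u / (deltaTilde (1 + 1) u : ℂ)‖ ≤ C ∧
      ‖W u / (deltaTilde (1 + 1) u : ℂ)‖ * ‖u‖ ≤ 2 * C := by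
  obtain ⟨C, hC⟩ := hW.norm_div_deltaTilde_le
  have hs : ∀ u : Fin 1 → ℝ, sincProd u = Real.sinc (u 0 / 2) := by
    intro u
    have i0 : Finset.Ioi (0 : Fin 2) = {1} := by decide
    have i1 : Finset.Ioi (1 : Fin 2) = ∅ := by decide
    have e1 : coord u 1 = 0 := coord_last u
    rw [sincProd, Fin.prod_univ_two, i0, i1, Finset.prod_singleton, Finset.prod_empty, mul_one,
      coord_one, e1, sub_zero]
  have hC0 : 0 ≤ C := by
    have := (norm_nonneg _).trans (hC 0)
    rw [hs] at this
    simpa using this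
  refine ⟨C, hC0, fun u => ⟨(hC u).trans ?_, ?_⟩⟩
  · rw [hs]
    exact mul_le_of_le_one_right hC0 (Real.abs_sinc_le_one _)
  · have h1 : |Real.sinc (u 0 / 2)| * |u 0| ≤ 2 := by
      by_cases h : u 0 = 0
      · simp [h]
      · rw [Real.sinc_of_ne_zero (by positivity), ← abs_mul]
        have : Real.sin (u 0 / 2) / (u 0 / 2) * u 0 = 2 * Real.sin (u 0 / 2) := by field_simp
        rw [this, abs_mul, abs_two]
        linarith [Real.abs_sin_le_one (u 0 / 2)]
    calc ‖W u / (deltaTilde (1 + 1) u : ℂ)‖ * ‖u‖ ≤ C * |Real.sinc (u 0 / 2)| * |u 0| := by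
          rw [← hs, norm_fin_one]
          exact mul_le_mul_of_nonneg_right (hC u) (abs_nonneg _)
      _ = C * (|Real.sinc (u 0 / 2)| * |u 0|) := by ring
      _ ≤ C * 2 := mul_le_mul_of_nonneg_left h1 hC0
      _ = 2 * C := mul_comm _ _

theorem Divisible.integrableOn_ball {W : (Fin 1 → ℝ) → ℂ} (hW : Divisible W) (r : ℝ) :
    IntegrableOn (fun u => W u / (deltaTilde (1 + 1) u : ℂ)) (Metric.ball 0 r) := by
  obtain ⟨C, -, hC⟩ := hW.exists_norm_div_le
  exact Measure.integrableOn_of_bounded measure_ball_lt_top.ne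
    hW.measurable_div.aestronglyMeasurable (ae_of_all _ fun u => (hC u).1)

/-- The radius (2N + 1)π is the one for which the ball consists, up to endpoints, of the translates
of the cell indexed by the box. -/
theorem vadd_mem_ball_iff {u : Fin 1 → ℝ} (hu : u ∈ cell 1) (p : Fin 1 → ℤ) (N : ℕ) :
    p +ᵥ u ∈ Metric.ball (0 : Fin 1 → ℝ) ((2 * N + 1) * Real.pi) ↔ p ∈ box (1 + 1) N := by
  have h1 := hu 0
  have hpi := Real.pi_pos
  have e : (p +ᵥ u) 0 = u 0 + (p 0 : ℝ) * (2 * Real.pi) := rfl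
  rw [mem_ball_zero_iff, norm_fin_one, e, abs_lt]
  have h2 : p ∈ box (1 + 1) N ↔ -(N : ℤ) ≤ p 0 ∧ p 0 ≤ N := by
    rw [box, Fintype.mem_piFinset]
    constructor
    · exact fun h => Finset.mem_Icc.mp (h 0)
    · intro h k
      obtain rfl : k = 0 := Subsingleton.elim (α := Fin 1) _ _
      exact Finset.mem_Icc.mpr h
  rw [h2]
  constructor
  · rintro ⟨ha, hb⟩
    constructor
    · by_contra! h
      have : (p 0 : ℝ) + 1 ≤ -N := by exact_mod_cast h
      nlinarith [h1.2]
    · by_contra! h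
      have : (N : ℝ) + 1 ≤ p 0 := by exact_mod_cast h
      nlinarith [h1.1]
  · rintro ⟨ha, hb⟩
    have ha' : -(N : ℝ) ≤ p 0 := by exact_mod_cast ha
    have hb' : (p 0 : ℝ) ≤ N := by exact_mod_cast hb
    constructor <;> nlinarith [h1.1, h1.2]

theorem Divisible.setIntegral_ball {W : (Fin 1 → ℝ) → ℂ} (hW : Divisible W) (N : ℕ) :
    ∫ u in Metric.ball 0 ((2 * N + 1) * Real.pi), W u / (deltaTilde (1 + 1) u : ℂ)
      = ∫ u in cell 1, W u * (DhatPartial (1 + 1) u N : ℂ) := by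
  obtain ⟨C, -, hC⟩ := hW.exists_norm_div_le
  have hb : MeasurableSet (Metric.ball (0 : Fin 1 → ℝ) ((2 * N + 1) * Real.pi)) :=
    Metric.isOpen_ball.measurableSet
  have hint := (integrable_indicator_iff hb).mpr (hW.integrableOn_ball ((2 * N + 1) * Real.pi))
  have hcell : MeasurableSet (cell 1) := isOpen_cube.measurableSet
  have hfin : Fact (volume (cell 1) < ⊤) := ⟨volume_cube_lt_top⟩
  rw [← integral_indicator hb, isAddFundamentalDomain_cube.integral_eq_tsum'' _ hint,
    tsum_eq_sum (s := (box (1 + 1) N : Finset (Fin 1 → ℤ))) fun p hp =>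
      setIntegral_eq_zero_of_forall_eq_zero fun u hu =>
        Set.indicator_of_notMem (fun h => hp ((vadd_mem_ball_iff hu p N).mp h)) _]
  have h1 : ∀ p ∈ (box (1 + 1) N : Finset (Fin 1 → ℤ)),
      ∫ u in cell 1, (Metric.ball (0 : Fin 1 → ℝ) ((2 * N + 1) * Real.pi)).indicator
        (fun u => W u / (deltaTilde (1 + 1) u : ℂ)) (p +ᵥ u)
      = ∫ u in cell 1, W (p +ᵥ u) / (deltaTilde (1 + 1) (p +ᵥ u : Fin 1 → ℝ) : ℂ) :=
    fun p hp => setIntegral_congr_fun hcell fun u hu =>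
      Set.indicator_of_mem ((vadd_mem_ball_iff hu p N).mpr hp) _
  have h2 : ∀ p : Fin 1 → ℤ, IntegrableOn (fun u : Fin 1 → ℝ =>
      W (p +ᵥ u) / (deltaTilde (1 + 1) (p +ᵥ u : Fin 1 → ℝ) : ℂ)) (cell 1) := fun p =>
    Integrable.of_bound (hW.measurable_div.comp (measurable_const_vadd p)).aestronglyMeasurable C
      (ae_of_all _ fun u => (hC _).1)
  rw [Finset.sum_congr rfl h1, ← integral_finsetSum _ fun p _ => h2 p]
  refine integral_congr_ae (ae_of_all _ fun u => ?_)
  dsimp only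
  rw [DhatPartial]
  push_cast
  rw [Finset.mul_sum]
  refine Finset.sum_congr rfl fun p _ => ?_
  rw [vadd_eq_shift, hW.1, div_eq_mul_one_div]

/-- Dominated convergence on the cell: the zero of W at 0 provides the factor u that
`exists_norm_mul_powSum_one_le` requires. -/
theorem Divisible.tendsto_setIntegral_ball_nat {W : (Fin 1 → ℝ) → ℂ} (hW : Divisible W) :
    Tendsto (fun N : ℕ => ∫ u in Metric.ball 0 ((2 * N + 1) * Real.pi),
        W u / (deltaTilde (1 + 1) u : ℂ)) atTop
      (𝓝 (Complex.I ^ ((1 + 1) * 1 / 2) * ∫ u in cell 1, W u * kern u)) := by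
  simp only [hW.setIntegral_ball]
  rw [← integral_const_mul]
  have hWc := hW.continuous
  obtain ⟨-, S, -, ⟨C, hC⟩, h⟩ := hW
  obtain ⟨K, hK⟩ := exists_norm_mul_powSum_one_le
  have hcell : MeasurableSet (cell 1) := isOpen_cube.measurableSet
  have hfin : Fact (volume (cell 1) < ⊤) := ⟨volume_cube_lt_top⟩
  have hC0 := (norm_nonneg _).trans (hC 0)
  refine tendsto_integral_of_dominated_convergence (fun _ => C * K) (fun N => ?_)
    (integrable_const _) (fun N => ?_) ?_
  · refine (hWc.measurable.mul (Complex.measurable_ofReal.comp ?_)).aestronglyMeasurable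
    unfold DhatPartial
    refine Finset.measurable_fun_sum _ fun p _ => ?_
    exact (measurable_const.div (continuous_deltaTilde.comp (continuous_shift p)).measurable)
  · refine (ae_restrict_mem hcell).mono fun u hu => ?_
    have hu0 : |u 0| ≤ Real.pi := abs_le.mpr ⟨(hu 0).1.le, (hu 0).2.le⟩
    have h2 : ‖deltaExp (1 + 1) u‖ ≤ ‖(u 0 : ℂ)‖ := by
      have h3 : |sincProd u| ≤ 1 := by
        rw [sincProd, Finset.abs_prod]
        refine Finset.prod_le_one (fun _ _ => abs_nonneg _) fun i _ => ?_
        rw [Finset.abs_prod]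
        exact Finset.prod_le_one (fun _ _ => abs_nonneg _) fun j _ => Real.abs_sinc_le_one _
      rw [deltaExp_eq_varpi, ← sincProd_mul_deltaTilde, deltaTilde_two, norm_mul, norm_pow,
        Complex.norm_I, one_pow, one_mul, Complex.norm_real, Complex.norm_real, norm_mul]
      exact mul_le_of_le_one_left (norm_nonneg _) h3
    rw [h, DhatPartial_two, mul_right_comm, norm_mul, mul_comm]
    refine mul_le_mul (hC u) (le_trans ?_ (hK (u 0) hu0 N)) (norm_nonneg _) hC0
    rw [norm_mul, norm_mul]
    exact mul_le_mul_of_nonneg_right h2 (norm_nonneg _)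
  · refine (ae_restrict_of_ae ae_regular).mono fun u hu => ?_
    rw [mul_left_comm, I_pow_mul_kern le_rfl hu]
    obtain ⟨P, hP⟩ := exists_Dhat_poly (m := 1) le_rfl
    exact ((Complex.continuous_ofReal.tendsto _).comp (hP u hu).1).const_mul _

/-- The shell has volume 2(s - r), and the integrand on it is at most 2C / r. -/
theorem Divisible.norm_setIntegral_ball_sub_le {W : (Fin 1 → ℝ) → ℂ} (hW : Divisible W) :
    ∃ C : ℝ, 0 ≤ C ∧ ∀ r s : ℝ, 0 < r → r ≤ s →
      ‖(∫ u in Metric.ball 0 s, W u / (deltaTilde (1 + 1) u : ℂ))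
        - ∫ u in Metric.ball 0 r, W u / (deltaTilde (1 + 1) u : ℂ)‖ ≤ C * (s - r) / r := by
  obtain ⟨C, hC0, hC⟩ := hW.exists_norm_div_le
  refine ⟨4 * C, by positivity, fun r s hr hrs => ?_⟩
  have hsub := Metric.ball_subset_ball (x := (0 : Fin 1 → ℝ)) hrs
  have hmr : MeasurableSet (Metric.ball (0 : Fin 1 → ℝ) r) := Metric.isOpen_ball.measurableSet
  have hms : MeasurableSet (Metric.ball (0 : Fin 1 → ℝ) s) := Metric.isOpen_ball.measurableSet
  rw [← setIntegral_sdiff hmr (hW.integrableOn_ball s) hsub]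
  have hvol : volume.real (Metric.ball (0 : Fin 1 → ℝ) s \ Metric.ball 0 r) = 2 * (s - r) := by
    rw [measureReal_sdiff hsub hmr, measureReal_def, measureReal_def,
      Real.volume_pi_ball _ (hr.trans_le hrs), Real.volume_pi_ball _ hr]
    simp only [Fintype.card_fin, pow_one]
    rw [ENNReal.toReal_ofReal (by linarith), ENNReal.toReal_ofReal (by linarith)]
    ring
  refine (norm_setIntegral_le_of_norm_le_const (C := 2 * C / r) ?_ fun u hu => ?_).trans
    (le_of_eq ?_)
  · exact (measure_mono Set.sdiff_subset).trans_lt measure_ball_lt_top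
  · have h1 : r ≤ ‖u‖ := by simpa using hu.2
    rw [le_div_iff₀ hr]
    exact (mul_le_mul_of_nonneg_left h1 (norm_nonneg _)).trans (hC u).2
  · rw [hvol]; ring

theorem Divisible.tendsto_setIntegral_ball {W : (Fin 1 → ℝ) → ℂ} (hW : Divisible W) :
    Tendsto (fun r : ℝ => ∫ u in Metric.ball 0 r, W u / (deltaTilde (1 + 1) u : ℂ)) atTop
      (𝓝 (Complex.I ^ ((1 + 1) * 1 / 2) * ∫ u in cell 1, W u * kern u)) := by
  obtain ⟨C, hC0, hC⟩ := hW.norm_setIntegral_ball_sub_le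
  have hpi := Real.pi_pos
  -- For r ≥ π this is the largest N with (2N + 1)π ≤ r. The leftover shell has width at most 2π, so
  -- its contribution tends to 0.
  let ν : ℝ → ℕ := fun r => ⌊(r / Real.pi - 1) / 2⌋₊
  have hν : Tendsto ν atTop atTop := by
    refine tendsto_nat_floor_atTop.comp (Tendsto.atTop_div_const two_pos ?_)
    exact tendsto_atTop_add_const_right _ _ (tendsto_id.atTop_div_const hpi)
  have h1 := hW.tendsto_setIntegral_ball_nat.comp hν
  have h2 : Tendsto (fun r : ℝ => C * 2 / (2 * (ν r : ℝ) + 1)) atTop (𝓝 0) := by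
    refine Tendsto.div_atTop tendsto_const_nhds ?_
    refine tendsto_atTop_add_const_right _ _ (Tendsto.const_mul_atTop two_pos ?_)
    exact tendsto_natCast_atTop_atTop.comp hν
  have h3 : Tendsto (fun r : ℝ => (∫ u in Metric.ball 0 r, W u / (deltaTilde (1 + 1) u : ℂ))
      - ∫ u in Metric.ball 0 ((2 * (ν r : ℝ) + 1) * Real.pi), W u / (deltaTilde (1 + 1) u : ℂ))
      atTop (𝓝 0) := by
    refine squeeze_zero_norm' ?_ h2
    filter_upwards [eventually_ge_atTop Real.pi] with r hr
    have h4 : 0 ≤ (r / Real.pi - 1) / 2 := by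
      have : 1 ≤ r / Real.pi := (one_le_div hpi).mpr hr
      linarith
    have h5 : (ν r : ℝ) ≤ (r / Real.pi - 1) / 2 := Nat.floor_le h4
    have h6 : (r / Real.pi - 1) / 2 < ν r + 1 := Nat.lt_floor_add_one _
    have e : r = r / Real.pi * Real.pi := by field_simp
    have h7 : (2 * (ν r : ℝ) + 1) * Real.pi ≤ r := by
      have : (2 * (ν r : ℝ) + 1) * Real.pi ≤ r / Real.pi * Real.pi :=
        mul_le_mul_of_nonneg_right (by linarith) hpi.le
      rwa [← e] at this
    have h8 : r - (2 * (ν r : ℝ) + 1) * Real.pi ≤ 2 * Real.pi := by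
      have : r / Real.pi * Real.pi ≤ (2 * (ν r : ℝ) + 3) * Real.pi :=
        mul_le_mul_of_nonneg_right (by linarith) hpi.le
      rw [← e] at this
      linarith
    refine (hC _ r (by positivity) h7).trans ?_
    rw [div_le_div_iff₀ (by positivity) (by positivity)]
    calc C * (r - (2 * (ν r : ℝ) + 1) * Real.pi) * (2 * (ν r : ℝ) + 1)
        ≤ C * (2 * Real.pi) * (2 * (ν r : ℝ) + 1) := by gcongr
      _ = C * 2 * ((2 * (ν r : ℝ) + 1) * Real.pi) := by ring
  have h9 := h1.add h3
  rw [add_zero] at h9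
  refine h9.congr fun r => ?_
  simp only [Function.comp]
  ring

/-- The region is a ball minus a small closed ball, whose integral tends to 0. The two limits
separate, so ε and M may vary independently. -/
theorem Divisible.hasPVWhole_two {W : (Fin 1 → ℝ) → ℂ} (hW : Divisible W) :
    HasPVWhole (1 + 1) (fun u : Fin 1 → ℝ => W u / (deltaTilde (1 + 1) u : ℂ))
      (Complex.I ^ ((1 + 1) * 1 / 2) * ∫ u in cell 1, W u * kern u) := by
  obtain ⟨C, hC0, hC⟩ := hW.exists_norm_div_le
  have h1 := hW.tendsto_setIntegral_ball.comp (tendsto_snd (f := 𝓝[>] (0 : ℝ)))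
  have h2 : Tendsto (fun ε : ℝ => ∫ u in Metric.closedBall 0 ε,
      W u / (deltaTilde (1 + 1) u : ℂ)) (𝓝[>] 0) (𝓝 0) := by
    have h3 : Tendsto (fun ε : ℝ => C * (2 * ε)) (𝓝[>] 0) (𝓝 0) := by
      have : Continuous fun ε : ℝ => C * (2 * ε) := by fun_prop
      simpa using (this.tendsto 0).mono_left nhdsWithin_le_nhds
    refine squeeze_zero_norm' ?_ h3
    filter_upwards [self_mem_nhdsWithin] with ε hε
    have hvol : volume.real (Metric.closedBall (0 : Fin 1 → ℝ) ε) = 2 * ε := by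
      rw [measureReal_def, Real.volume_pi_closedBall _ (le_of_lt hε), Fintype.card_fin, pow_one,
        ENNReal.toReal_ofReal (by linarith [Set.mem_Ioi.mp hε])]
    rw [← hvol]
    exact norm_setIntegral_le_of_norm_le_const measure_closedBall_lt_top fun u _ => (hC u).1
  have h3 := h1.sub (h2.comp (tendsto_fst (g := (atTop : Filter ℝ))))
  rw [sub_zero] at h3
  refine h3.congr' ?_
  have he1 : ∀ᶠ q in 𝓝[>] (0 : ℝ) ×ˢ (atTop : Filter ℝ), q.1 < 1 :=
    tendsto_fst.eventually
      (eventually_nhdsWithin_of_eventually_nhds (eventually_lt_nhds one_pos))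
  have he2 : ∀ᶠ q in 𝓝[>] (0 : ℝ) ×ˢ (atTop : Filter ℝ), 1 < q.2 :=
    tendsto_snd.eventually (eventually_gt_atTop 1)
  filter_upwards [he1, he2] with q hq1 hq2
  have h4 := setIntegral_sdiff (μ := volume) Metric.isClosed_closedBall.measurableSet
    (hW.integrableOn_ball q.2)
    (Metric.closedBall_subset_ball (x := (0 : Fin 1 → ℝ)) (hq1.trans hq2))
  rw [← gapRegion_one] at h4
  exact h4.symm

/-! ### Conclusion. -/

theorem exists_hasPV (hm : 1 ≤ m) {e : Fin (m + 1) → ℤ} (he : ∑ k, e k = 0) :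
    ∃ L : ℂ, HasPVCube (m + 1) (fun u : Fin m → ℝ => mono e u * kern u) L ∧
      HasPVWhole (m + 1) (fun u : Fin m → ℝ => mono e u / (deltaTilde (m + 1) u : ℂ))
        (Complex.I ^ ((m + 1) * m / 2) * L) := by
  refine ⟨_, hasPVCube_mono hm he, ?_⟩
  rw [mul_left_comm]
  refine hasPVWhole_mono ?_
  rcases (by omega : m = 1 ∨ 2 ≤ m) with rfl | hm
  · exact (divisible_altMono he).hasPVWhole_two
  · exact (divisible_altMono he).hasPVWhole hm

theorem eq_of_expansion {r r' : (Fin m → ℕ) →₀ ℚ}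
    (h : ∀ u : Fin m → ℝ, ∑ κ ∈ r.support, (r κ : ℂ) * character (m + 1) κ u
      = ∑ κ ∈ r'.support, (r' κ : ℂ) * character (m + 1) κ u) : r = r' := by
  refine linearIndependent_char (m := m) (funext fun u => ?_)
  rw [linearCombination_char_apply, linearCombination_char_apply]
  exact h u

end Horn

end

theorem mainTheorem7 (n : ℕ) (hn : 2 ≤ n) :
    -- the series converges, absolutely for `n > 2`, and `R̂_n = D̂_n ϖ_n` extends continuously
    (∀ u ∈ Horn.regular n, Tendsto (Horn.DhatPartial n u) atTop (𝓝 (Horn.Dhat n u))) ∧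
    (2 < n → ∀ u ∈ Horn.regular n,
      Summable fun p : Fin (n - 1) → ℤ => 1 / Horn.deltaTilde n (Horn.shift n u p)) ∧
    Continuous (Horn.Rhat n) ∧
    (∀ u ∈ Horn.regular n, Horn.Rhat n u = Horn.Dhat n u * Horn.varpi n u) ∧
    -- compactification of each of the integrals, and of their alternating sum
    (∀ lam mu nu : Fin n → ℤ, Horn.Compatible n lam mu nu →
      (∀ P P' P'' : Equiv.Perm (Fin n),
        ∃ L : ℂ,
          Horn.HasPVCube n
            (fun u => Horn.planeWave n
              (Horn.A n (Horn.ell n lam) (Horn.ell n mu) (Horn.ell n nu) P P' P'') u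
                * ((Horn.Rhat n u : ℂ) / Horn.deltaExp n u)) L ∧
          Horn.HasPVWhole n
            (fun u => Horn.planeWave n
              (Horn.A n (Horn.ell n lam) (Horn.ell n mu) (Horn.ell n nu) P P' P'') u
                / (Horn.deltaTilde n u : ℂ)) (Complex.I ^ (n * (n - 1) / 2) * L)) ∧
      (2 < n →
        Integrable (fun u : Fin (n - 1) → ℝ =>
          Horn.alternatingWave n (Horn.ell n lam) (Horn.ell n mu) (Horn.ell n nu) u
            / (Horn.deltaTilde n u : ℂ)) ∧
        IntegrableOn (fun u : Fin (n - 1) → ℝ =>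
          Horn.alternatingWave n (Horn.ell n lam) (Horn.ell n mu) (Horn.ell n nu) u
            * ((Horn.Rhat n u : ℂ) / Horn.deltaExp n u)) (Horn.cube n) ∧
        ∫ u : Fin (n - 1) → ℝ,
            Horn.alternatingWave n (Horn.ell n lam) (Horn.ell n mu) (Horn.ell n nu) u
              / (Horn.deltaTilde n u : ℂ)
          = Complex.I ^ (n * (n - 1) / 2) *
            ∫ u in Horn.cube n,
              Horn.alternatingWave n (Horn.ell n lam) (Horn.ell n mu) (Horn.ell n nu) u
                * ((Horn.Rhat n u : ℂ) / Horn.deltaExp n u))) ∧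
    -- `R̂_n` is a real symmetric polynomial in the eigenvalues of `T`
    (∃ p : MvPolynomial (Fin n) ℝ, p.IsSymmetric ∧
      ∀ u, (Horn.Rhat n u : ℂ) = MvPolynomial.aeval (Horn.torusEntry n u) p) ∧
    -- its expansion on characters, and the comparison with `R_n` for odd `n`
    (∃ rhat : (Fin (n - 1) → ℕ) →₀ ℚ,
      (∀ u, (Horn.Rhat n u : ℂ) = ∑ κ ∈ rhat.support, (rhat κ : ℂ) * Horn.character n κ u) ∧
      (∀ κ, rhat (κ ∘ Fin.rev) = rhat κ) ∧
      (∀ r : (Fin (n - 1) → ℕ) →₀ ℚ,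
        (∀ u, (Horn.Rhat n u : ℂ) = ∑ κ ∈ r.support, (r κ : ℂ) * Horn.character n κ u) →
          r = rhat) ∧
      (Odd n → Horn.R n = Horn.Rhat n ∧
        ∀ r : (Fin (n - 1) → ℕ) →₀ ℚ,
          (∀ u, (Horn.R n u : ℂ) = ∑ κ ∈ r.support, (r κ : ℂ) * Horn.character n κ u) →
            r.support = rhat.support ∧ r = rhat)) ∧
    Horn.Rhat n 0 = 1 := by
  obtain ⟨m, rfl⟩ : ∃ m, n = m + 1 := ⟨n - 1, by omega⟩
  have hm : 1 ≤ m := by omega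
  obtain ⟨P, hP⟩ := Horn.exists_Dhat_poly hm
  obtain ⟨hcont, h0, hR⟩ := Horn.Rhat_spec hm
  obtain ⟨r, hr⟩ := Horn.exists_expansion hm
  have hr' : ∀ u : Fin m → ℝ, (Horn.Rhat (m + 1) u : ℂ)
      = ∑ κ ∈ r.support, (r κ : ℂ) * Horn.character (m + 1) κ u := fun u => by
    rw [← Horn.linearCombination_char_apply, hr]
  have huniq : ∀ r' : (Fin m → ℕ) →₀ ℚ, (∀ u : Fin m → ℝ, (Horn.Rhat (m + 1) u : ℂ)
      = ∑ κ ∈ r'.support, (r' κ : ℂ) * Horn.character (m + 1) κ u) → r' = r :=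
    fun r' h => Horn.eq_of_expansion fun u => (h u).symm.trans (hr' u)
  refine ⟨fun u hu => (hP u hu).1, fun h2 u hu => Horn.summable_one_div_deltaTilde (by omega) hu,
    hcont, hR, fun lam mu nu hc => ⟨fun P P' P'' => ?_, fun h2 => ?_⟩, Horn.exists_symmetric hm,
    ⟨r, hr', Horn.apply_comp_rev hr, huniq, fun hodd => ⟨Horn.R_eq_Rhat hodd, fun r' h => ?_⟩⟩, h0⟩
  · obtain ⟨L, hL⟩ := Horn.exists_hasPV hm (Horn.sum_expo hc P P' P'')
    rw [← funext (Horn.planeWave_A hc P P' P'')] at hL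
    exact ⟨L, hL⟩
  · have hW := Horn.divisible_alternatingWave hc
    exact ⟨hW.integrable_div (by omega), hW.integrableOn_mul_kern hm, hW.integral_div (by omega)⟩
  · rw [Horn.R_eq_Rhat hodd] at h
    have := huniq r' h
    exact ⟨by rw [this], this⟩
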